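/- Let $N\ge 0$ be an integer, $Q=(q_{ij})_{i,j=1}^N$ a real symmetric matrix with $q_{ij}=q(i,j)\in[-1,1]$, and let $\varepsilon(a,b):\Omega\to\{-1,1\}$, $a,b\in[N]\times\mathbb N$, be random signs on a probability space with $\varepsilon(a,b)=\varepsilon(b,a)$, $\varepsilon(a,a)=-1$, such that the $\varepsilon(a,b)$ with $a<b$ (lexicographic order) are independent and $\mathbb P(\varepsilon((i,k),(j,l))=\pm1)=\frac{1\pm q(i,j)}2$. For fixed $\omega\in\Omega$ let $\mathcal A_m$ be the spin matrix algebra generated by self-adjoint $x_i(k)$, $i\in[N]$, $k\in[m]$, with $$x_i(k)x_j(l)-\varepsilon((i,k),(j,l))\,x_j(l)x_i(k)=2\delta_{(i,k),(j,l)},$$ with normalized trace $\tau_m$. For a free ultrafilter $\mathcal U$ on $\mathbb N$ let $(\mathcal A_{\mathcal U},\tau_{\mathcal U})$ be the tracial von Neumann algebra ultraproduct of the $(\mathcal A_m,\tau_m)$, and write $(y_m)^\bullet$ for the element of $L_2(\mathcal A_{\mathcal U},\tau_{\mathcal U})$ represented by a sequence $(y_m)$. Let $x_j=\big(m^{-1/2}\sum_{k=1}^m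 x_j(k)\big)^\bullet$ (as a possibly unbounded operator on $L_2(\mathcal A_{\mathcal U})$ it is the closure of left multiplication on $\mathcal A_{\mathcal U}$), let $\Gamma_Q$ be the von Neumann algebra generated by the spectral projections of $x_1,\dots,x_N$, and let $L_2(\Gamma_Q)$ be the closure of $\Gamma_Q$ in $L_2(\mathcal A_{\mathcal U})$. For $\vec i\in[N]^s$, $s\ge0$, the special Wick word is $$w(\vec i)=\Big(m^{-s/2}\sum_{k_1,\dots,k_s\in[m]\text{ pairwise different}}x_{i_1}(k_1)\cdots x_{i_s}(k_s)\Big)^\bullet .$$ Let $H_Q^s=\operatorname{span}\{w(\vec i):\vec i\in[N]^s\}$, let $\mathcal F_Q$ (the mixed Fock space) be the closed sum of the $H_Q^s$, $s\ge 0$, in $L_2(\mathcal A_{\mathcal U})$, let $P_s$ be the orthogonal projection onto $H_Q^s$, and let $D\subset\mathcal F_Q$ be the linear span of all the $w(\vec i)$. Then there is a set $\Omega_0\subset\Omega$ of full probability such that for all $\omega\in\Omega_0$ and every free ultrafilter $\mathcal U$ the $x_j$ are well-defined self-adjoint operators, the $w(\vec i)$ are well-defined vectors of $L_2(\mathcal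 A_{\mathcal U})$, and the following hold. 1. $L_2(\Gamma_Q)$ is the closed linear span of $\{w(\vec i):\vec i\in[N]^s,\ s\ge0\}$. 2. For $\vec i\in[N]^s$, $\vec i'\in[N]^{s'}$, if $\vec i$ and $\vec i'$ are equal as multisets (so $s=s'$), then $$\langle w(\vec i),w(\vec i')\rangle=\tau_{\mathcal U}\big(w(\vec i')^*w(\vec i)\big)=\sum_{\pi}\ \prod_{\substack{1\le r<t\le s\\ \pi(r)>\pi(t)}}q(i_r,i_t),$$ where $\pi$ runs over the bijections of $[s]$ with $i_r=i'_{\pi(r)}$ for all $r$ (the bipartite pair partitions of $[s]\sqcup[s]$ that pair equal letters); otherwise $\langle w(\vec i),w(\vec i')\rangle=0$. Empty products are $1$. 3. The $H_Q^s$ are pairwise orthogonal, so $L_2(\Gamma_Q)=\mathcal F_Q=\bigoplus_{s\ge0}H_Q^s$, and every $w(\vec i)$, $\vec i\in[N]^s$, is in the domain of $x_j$, with $$x_jw(\vec i)=w(j,i_1,\dots,i_s)+\sum_{l=1}^s\delta_{j,i_l}\Big(\prod_{r=1}^{l-1}q(i_r,i_l)\Big)w(i_1,\dots,i_{l-1},i_{l+1},\dots,i_s).$$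 4. There are linear operators $c_j,a_j$ ($j=1,\dots,N$) on $\mathcal F_Q$ with domain $D$ such that $c_jw(\vec i)=w(j,i_1,\dots,i_s)$ and $a_jw(\vec i)=\sum_{l=1}^s\delta_{j,i_l}\big(\prod_{r<l}q(i_r,i_l)\big)w(i_1,\dots,i_{l-1},i_{l+1},\dots,i_s)$ for all $\vec i$. On $D$ one has $x_j=c_j+a_j$, $c_j=\sum_{s\ge0}P_{s+1}x_jP_s$ and $a_j=\sum_{s\ge1}P_{s-1}x_jP_s$. Moreover $c_j^*$ is the closure of $a_j$; in particular $c_j^*=a_j$ on $D$. 5. For $j,k=1,\dots,N$, on $D$, $$c_k^*c_j-q(j,k)\,c_jc_k^*=\delta_{j,k}1 .$$ -/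

import Mathlib

open scoped ComplexConjugate Matrix ComplexOrder

noncomputable section

namespace MixedQGaussian

/-! ### The spin matrix model -/

/-- The index set `[N] × [m]` with the lexicographic order. -/
abbrev SpinIndex (N m : ℕ) : Type := Fin N ×ₗ Fin m

/-- The index set `[N] × ℕ` with the lexicographic order. -/
abbrev SpinIndexInf (N : ℕ) : Type := Fin N ×ₗ ℕ

/-- The inclusion `[N] × [m] ⊆ [N] × ℕ`. -/
def SpinIndex.incl {N m : ℕ} (a : SpinIndex N m) : SpinIndexInf N :=
  toLex ((ofLex a).1, ((ofLex a).2 : ℕ))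

/-- Complex matrices of size `2 ^ (N m)`, the basis vectors being indexed by the subsets
of `[N] × [m]` (a subset lists the tensor factors in which the second basis vector of `ℂ²`
occurs). -/
abbrev SpinMat (N m : ℕ) : Type :=
  Matrix (Finset (SpinIndex N m)) (Finset (SpinIndex N m)) ℂ

/-- The generator `x_a`: the tensor product of the Pauli matrix `σ_x` in the factor `a`,
of `diag(1, e a b)` in the factors `b < a`, and of the identity in the factors `b > a`. On basis
vectors, `x_a e_B = (∏_{b ∈ B, b < a} e a b) e_{B ∆ {a}}`. For symmetric signs `e a b = ±1` these
matrices are self-adjoint with `x_a ^ 2 = 1` and `x_a x_b = e a b • x_b x_a` for `a ≠ b`. -/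
def spinMatrix {ι : Type*} [LinearOrder ι] [Fintype ι] (e : ι → ι → ℝ) (a : ι) :
    Matrix (Finset ι) (Finset ι) ℂ :=
  Matrix.of fun C B => if C = symmDiff B {a} then ∏ b ∈ B with b < a, (e a b : ℂ) else 0

/-- The generator `x_i(k)` of the spin matrix model of size `m` with signs `e`. -/
def gen {N : ℕ} (e : SpinIndexInf N → SpinIndexInf N → ℝ) (m : ℕ) (i : Fin N) (k : Fin m) :
    SpinMat N m :=
  spinMatrix (fun a b : SpinIndex N m => e a.incl b.incl) (toLex (i, k))

/-- The algebra `𝓐_m` generated by the `x_i(k)`, `i ∈ [N]`, `k ∈ [m]`. -/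
def spinAlgebra {N : ℕ} (e : SpinIndexInf N → SpinIndexInf N → ℝ) (m : ℕ) :
    StarSubalgebra ℂ (SpinMat N m) :=
  StarAlgebra.adjoin ℂ (Set.range fun p : Fin N × Fin m => gen e m p.1 p.2)

/-- The normalized trace `τ_m`. -/
def ntrace {n : Type*} [Fintype n] (A : Matrix n n ℂ) : ℂ := A.trace / Fintype.card n

/-- The operator norm of a matrix acting on the Hilbert space `ℂⁿ`. -/
def opNorm {n : Type*} [Fintype n] [DecidableEq n] (A : Matrix n n ℂ) : ℝ :=
  ‖Matrix.toEuclideanCLM (n := n) (𝕜 := ℂ) A‖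

/-- `τ(A^* B)`, the inner product of `L₂(τ)` (conjugate linear in the first variable). -/
def nip {n : Type*} [Fintype n] (A B : Matrix n n ℂ) : ℂ := ntrace (Aᴴ * B)

/-- `A, B ↦ τ(A^* B)` is a positive semidefinite sesquilinear form. -/
@[reducible]
def nipCore (n : Type*) [Fintype n] : PreInnerProductSpace.Core ℂ (Matrix n n ℂ) where
  inner := nip
  conj_inner_symm A B := by
    simp only [nip, ntrace, map_div₀, map_natCast]
    rw [starRingEnd_apply, ← Matrix.trace_conjTranspose]
    simp
  re_inner_nonneg A := by
    have h : 0 ≤ nip A A := by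
      unfold nip ntrace
      have := (Matrix.posSemidef_conjTranspose_mul_self A).trace_nonneg
      positivity
    exact (Complex.le_def.1 h).1
  add_left A B C := by simp [nip, ntrace, add_mul, add_div]
  smul_left A B r := by simp [nip, ntrace, mul_div_assoc]

lemma norm_nip_le {n : Type*} [Fintype n] (A B : Matrix n n ℂ) :
    ‖nip A B‖ ≤ (nip A A).re + (nip B B).re := by
  let _ := nipCore n
  have h := InnerProductSpace.Core.inner_mul_inner_self_le (𝕜 := ℂ) A B
  have h2 := InnerProductSpace.Core.norm_inner_symm (𝕜 := ℂ) A B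
  have hA : 0 ≤ (nip A A).re := (nipCore n).re_inner_nonneg A
  have hB : 0 ≤ (nip B B).re := (nipCore n).re_inner_nonneg B
  change ‖nip A B‖ * ‖nip B A‖ ≤ (nip A A).re * (nip B B).re at h
  change ‖nip A B‖ = ‖nip B A‖ at h2
  rw [← h2] at h
  nlinarith [norm_nonneg (nip A B)]

/-! ### The tracial ultraproduct -/

/-- Sequences `(y_m)` with `y_m ∈ 𝓐_m` that are bounded in `L₂`. -/
def L2Seq {N : ℕ} (e : SpinIndexInf N → SpinIndexInf N → ℝ) :
    Submodule ℂ (∀ m : ℕ, SpinMat N m) where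
  carrier := {y | (∀ m, y m ∈ spinAlgebra e m) ∧ ∃ C : ℝ, ∀ m, (nip (y m) (y m)).re ≤ C}
  zero_mem' := ⟨fun m => zero_mem _, 0, fun m => by simp [nip, ntrace]⟩
  add_mem' := by
    rintro y z ⟨hy, C, hC⟩ ⟨hz, D, hD⟩
    refine ⟨fun m => add_mem (hy m) (hz m), 4 * (C + D), fun m => ?_⟩
    have h1 := norm_nip_le (y m) (z m)
    have h2 := norm_nip_le (z m) (y m)
    have h3 := Complex.re_le_norm (nip (y m) (z m))
    have h4 := Complex.re_le_norm (nip (z m) (y m))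
    have hy0 : 0 ≤ (nip (y m) (y m)).re := (nipCore _).re_inner_nonneg _
    have hz0 : 0 ≤ (nip (z m) (z m)).re := (nipCore _).re_inner_nonneg _
    have : nip ((y + z) m) ((y + z) m) =
        nip (y m) (y m) + nip (y m) (z m) + nip (z m) (y m) + nip (z m) (z m) := by
      simp [nip, ntrace, add_mul, mul_add]; ring
    rw [this]
    simp only [Complex.add_re]
    linarith [hC m, hD m]
  smul_mem' := by
    rintro r y ⟨hy, C, hC⟩
    refine ⟨fun m => (spinAlgebra e m).smul_mem (hy m) r, ‖r‖ ^ 2 * C, fun m => ?_⟩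
    have : nip ((r • y) m) ((r • y) m) = ((‖r‖ ^ 2 : ℝ) : ℂ) * nip (y m) (y m) := by
      simp only [nip, ntrace, Pi.smul_apply, Matrix.conjTranspose_smul, Matrix.smul_mul,
        Matrix.mul_smul, Matrix.trace_smul, smul_eq_mul, Complex.ofReal_pow,
        ← Complex.conj_mul', mul_div_assoc, Complex.star_def]
      ring
    rw [this, Complex.re_ofReal_mul]
    exact mul_le_mul_of_nonneg_left (hC m) (by positivity)

/-- The `L₂`-bounded sequences, as a space with the semi-inner product
`⟪y, z⟫ = lim_{m, U} τ_m(y_m^* z_m)`. -/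
def PreL2 {N : ℕ} (_U : Ultrafilter ℕ) (e : SpinIndexInf N → SpinIndexInf N → ℝ) : Type :=
  L2Seq e

section

variable {N : ℕ} (U : Ultrafilter ℕ) (e : SpinIndexInf N → SpinIndexInf N → ℝ)

instance : AddCommGroup (PreL2 U e) := inferInstanceAs (AddCommGroup (L2Seq e))

instance : Module ℂ (PreL2 U e) := inferInstanceAs (Module ℂ (L2Seq e))

variable {U e}

/-- `lim_{m, U} τ_m(y_m^* z_m)`. -/
def preInner (y z : PreL2 U e) : ℂ :=
  Filter.limUnder (U : Filter ℕ) fun m => nip (y.1 m) (z.1 m)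

lemma tendsto_preInner (y z : PreL2 U e) :
    Filter.Tendsto (fun m => nip (y.1 m) (z.1 m)) (U : Filter ℕ) (nhds (preInner y z)) := by
  obtain ⟨-, C, hC⟩ := y.2
  obtain ⟨-, D, hD⟩ := z.2
  apply tendsto_nhds_limUnder
  have hK := isCompact_closedBall (0 : ℂ) (C + D)
  obtain ⟨x, -, hx⟩ := hK.ultrafilter_le_nhds (U.map fun m => nip (y.1 m) (z.1 m)) (by
    rw [Filter.le_principal_iff]
    refine Filter.Eventually.of_forall (f := (U : Filter ℕ)) fun m => ?_
    rw [mem_closedBall_zero_iff]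
    exact (norm_nip_le _ _).trans (add_le_add (hC m) (hD m)))
  exact ⟨x, hx⟩

variable (U e)

/-- The semi-inner product on `L₂`-bounded sequences. -/
@[reducible]
def preCore : PreInnerProductSpace.Core ℂ (PreL2 U e) where
  inner := preInner
  conj_inner_symm y z := by
    refine tendsto_nhds_unique ?_ (tendsto_preInner y z)
    have h := (Complex.continuous_conj.tendsto _).comp (tendsto_preInner z y)
    refine h.congr fun m => ?_
    exact (nipCore _).conj_inner_symm (y.1 m) (z.1 m)
  re_inner_nonneg y := by
    refine ge_of_tendsto ((Complex.continuous_re.tendsto _).comp (tendsto_preInner y y)) ?_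
    exact Filter.Eventually.of_forall fun m => (nipCore _).re_inner_nonneg (y.1 m)
  add_left x y z := by
    refine tendsto_nhds_unique (tendsto_preInner (x + y) z) ?_
    refine ((tendsto_preInner x z).add (tendsto_preInner y z)).congr fun m => ?_
    exact ((nipCore _).add_left (x.1 m) (y.1 m) (z.1 m)).symm
  smul_left x y r := by
    refine tendsto_nhds_unique (tendsto_preInner (r • x) y) ?_
    refine ((tendsto_preInner x y).const_mul (conj r)).congr fun m => ?_
    exact ((nipCore _).smul_left (x.1 m) (y.1 m) r).symm

instance : SeminormedAddCommGroup (PreL2 U e) :=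
  @InnerProductSpace.Core.toSeminormedAddCommGroup ℂ (PreL2 U e) _ _ _ (preCore U e)

instance : InnerProductSpace ℂ (PreL2 U e) := InnerProductSpace.ofCore (preCore U e)

/-- The Hilbert space ultraproduct `∏_{m, U} L₂(𝓐_m, τ_m)`. -/
abbrev UltraL2 : Type := UniformSpace.Completion (PreL2 U e)

variable {e}

/-- The class in the Hilbert space ultraproduct of an `L₂`-bounded sequence. -/
def cls (y : L2Seq e) : UltraL2 U e :=
  UniformSpace.Completion.coe' (show PreL2 U e from y)

variable (e)

/-- Sequences `(a_m)` with `a_m ∈ 𝓐_m` that are bounded in operator norm. They represent the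
elements of the von Neumann algebra ultraproduct `𝓐_U`. -/
def IsBddSeq (a : ∀ m : ℕ, SpinMat N m) : Prop :=
  (∀ m, a m ∈ spinAlgebra e m) ∧ ∃ C : ℝ, ∀ m, opNorm (a m) ≤ C

/-- `L₂(𝓐_U, τ_U)`, the completion of `𝓐_U` for the norm `τ_U(a^* a)^{1/2}`, where
`τ_U((a_m)^•) = lim_{m, U} τ_m(a_m)`. It is realized as the closure, in the ultraproduct of the
spaces `L₂(𝓐_m, τ_m)`, of the classes of sequences that are bounded in operator norm. -/
def ultraSpace : Submodule ℂ (UltraL2 U e) :=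
  (Submodule.span ℂ
    {ξ | ∃ y : L2Seq e, IsBddSeq e y.1 ∧ ξ = cls U y}).topologicalClosure

/-- `L₂(𝓐_U, τ_U)` as a Hilbert space. -/
abbrev L2A : Type := ultraSpace U e

instance : CompleteSpace (L2A U e) :=
  inferInstanceAs (CompleteSpace (Submodule.topologicalClosure _))

variable {e}

/-- `Represents U y ξ` says `ξ = (y_m)^•`: the sequence `(y_m)` is bounded in `L₂` and its class
is the vector `ξ` of `L₂(𝓐_U, τ_U)`. (Every sequence bounded in `L_p` for some `p > 2` represents
a vector.) -/
def Represents (y : ∀ m : ℕ, SpinMat N m) (ξ : L2A U e) : Prop :=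
  ∃ hy : y ∈ L2Seq e, (ξ : UltraL2 U e) = cls U ⟨y, hy⟩

variable (e)

open Classical in
/-- The vector `(y_m)^•` of `L₂(𝓐_U, τ_U)` (and `0` if the sequence does not represent one). -/
def bullet (y : ∀ m : ℕ, SpinMat N m) : L2A U e :=
  if h : ∃ ξ : L2A U e, Represents U y ξ then h.choose else 0

end

/-! ### Unbounded operators and von Neumann algebras -/

/-- `P` is the spectral projection `1_{(-∞, t]}(T)` of the self-adjoint operator `T`: the
projection `P` reduces `T`, one has `T ≤ t` on the range of `P`, and `T > t` on the orthogonal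
complement of the range. -/
structure IsSpectralProjection {H : Type*} [NormedAddCommGroup H] [InnerProductSpace ℂ H]
    [CompleteSpace H] (T : H →ₗ.[ℂ] H) (t : ℝ) (P : H →L[ℂ] H) : Prop where
  isStarProjection : IsStarProjection P
  reduces : ∀ u v : H, (u, v) ∈ T.graph → (P u, P v) ∈ T.graph
  le : ∀ u v : H, (u, v) ∈ T.graph → P u = u → (inner ℂ u v).re ≤ t * ‖u‖ ^ 2
  gt : ∀ u v : H, (u, v) ∈ T.graph → P u = 0 → u ≠ 0 → t * ‖u‖ ^ 2 < (inner ℂ u v).re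

/-- The von Neumann algebra generated by a set of bounded operators: the bicommutant of
`S ∪ S^*`. -/
def generatedVN {H : Type*} [NormedAddCommGroup H] [InnerProductSpace ℂ H] [CompleteSpace H]
    (S : Set (H →L[ℂ] H)) : VonNeumannAlgebra H where
  toStarSubalgebra :=
    StarSubalgebra.centralizer ℂ (StarSubalgebra.centralizer ℂ S : Set (H →L[ℂ] H))
  centralizer_centralizer' := by
    have hstar : star (StarSubalgebra.centralizer ℂ S : Set (H →L[ℂ] H)) =
        (StarSubalgebra.centralizer ℂ S : Set (H →L[ℂ] H)) := by
      ext x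
      rw [Set.mem_star, SetLike.mem_coe, SetLike.mem_coe]
      exact ⟨fun h => by simpa using star_mem h, fun h => star_mem h⟩
    change Set.centralizer (Set.centralizer
      (StarSubalgebra.centralizer ℂ (StarSubalgebra.centralizer ℂ S : Set (H →L[ℂ] H)) :
        Set (H →L[ℂ] H))) =
      (StarSubalgebra.centralizer ℂ (StarSubalgebra.centralizer ℂ S : Set (H →L[ℂ] H)) :
        Set (H →L[ℂ] H))
    rw [StarSubalgebra.coe_centralizer ℂ (StarSubalgebra.centralizer ℂ S : Set (H →L[ℂ] H)),
      hstar, Set.union_self, Set.centralizer_centralizer_centralizer]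

/-! ### The mixed q-Gaussian algebra and Wick words -/

section

variable {N : ℕ} (U : Ultrafilter ℕ) (e : SpinIndexInf N → SpinIndexInf N → ℝ)

/-- The sequence `m ↦ m^{-1/2} ∑_{k=1}^m x_j(k)`. -/
def genSeq (j : Fin N) (m : ℕ) : SpinMat N m :=
  ((Real.sqrt m : ℂ)⁻¹) • ∑ k : Fin m, gen e m j k

/-- The graph of left multiplication by `x_j = (m^{-1/2} ∑_k x_j(k))^•` on `𝓐_U ⊆ L₂(𝓐_U, τ_U)`:
all pairs `((a_m)^•, (y_m)^•)` with `(a_m)` bounded in operator norm and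
`y_m = (m^{-1/2} ∑_k x_j(k)) a_m`. -/
def leftMulGraph (j : Fin N) : Set (L2A U e × L2A U e) :=
  {p | ∃ a : ∀ m : ℕ, SpinMat N m, IsBddSeq e a ∧ Represents U a p.1 ∧
    Represents U (fun m => genSeq e j m * a m) p.2}

/-- The closure of the graph of left multiplication by `x_j`. -/
def generatorGraph (j : Fin N) : Submodule ℂ (L2A U e × L2A U e) :=
  (Submodule.span ℂ (leftMulGraph U e j)).topologicalClosure

/-- The generator `x_j = (m^{-1/2} ∑_k x_j(k))^•` as a (possibly unbounded) operator on
`L₂(𝓐_U, τ_U)`: the closure of left multiplication by `x_j` on `𝓐_U`. -/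
def generator (j : Fin N) : L2A U e →ₗ.[ℂ] L2A U e := (generatorGraph U e j).toLinearPMap

/-- The mixed q-Gaussian algebra `Γ_Q`, acting on `L₂(𝓐_U, τ_U)`: the von Neumann algebra
generated by the spectral projections of `x_1, …, x_N`. -/
def mixedGaussian : VonNeumannAlgebra (L2A U e) :=
  generatedVN {P | ∃ (j : Fin N) (t : ℝ), IsSpectralProjection (generator U e j) t P}

/-- The vector `1 ∈ 𝓐_U ⊆ L₂(𝓐_U, τ_U)`, which implements the trace `τ_U`. -/
def vacuum : L2A U e := bullet U e fun _ => 1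

/-- `L₂(Γ_Q)`, the closure of `Γ_Q` in `L₂(𝓐_U, τ_U)`. -/
def L2Gaussian : Submodule ℂ (L2A U e) :=
  (Submodule.span ℂ {ξ | ∃ T ∈ mixedGaussian U e, ξ = T (vacuum U e)}).topologicalClosure

/-- For `i = (i_1, …, i_s)`, the sequence
`m ↦ m^{-s/2} ∑ x_{i_1}(k_1) ⋯ x_{i_s}(k_s)`, the sum being over all
`(k_1, …, k_s) ∈ [m]^s` with pairwise different entries. -/
def wickSeq (i : List (Fin N)) (m : ℕ) : SpinMat N m :=
  ((Real.sqrt m : ℂ)⁻¹ ^ i.length) •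
    ∑ k : Fin i.length ↪ Fin m, (List.ofFn fun r => gen e m (i.get r) (k r)).prod

/-- The special Wick word `w(i)`. -/
def wick (i : List (Fin N)) : L2A U e := bullet U e (wickSeq e i)

/-- `H_Q^s`, the span of the special Wick words of length `s`. -/
def wickLevel (s : ℕ) : Submodule ℂ (L2A U e) :=
  Submodule.span ℂ (wick U e '' {i | i.length = s})

instance (s : ℕ) : FiniteDimensional ℂ (wickLevel U e s) :=
  FiniteDimensional.span_of_finite ℂ ((List.finite_length_eq (Fin N) s).image _)

/-- The mixed Fock space `𝓕_Q`, the closed sum of the spaces `H_Q^s`, `s ≥ 0`. -/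
def fock : Submodule ℂ (L2A U e) := (⨆ s, wickLevel U e s).topologicalClosure

instance : CompleteSpace (fock U e) :=
  inferInstanceAs (CompleteSpace (Submodule.topologicalClosure _))

/-- The mixed Fock space as a Hilbert space. -/
abbrev FockSpace : Type := fock U e

instance : NormedAddCommGroup (FockSpace U e) := Submodule.normedAddCommGroup _

instance : InnerProductSpace ℂ (FockSpace U e) := Submodule.innerProductSpace _

/-- The special Wick word `w(i)` as a vector of the mixed Fock space. -/
def wickFock (i : List (Fin N)) : FockSpace U e :=
  ⟨wick U e i, Submodule.le_topologicalClosure _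
    (Submodule.mem_iSup_of_mem i.length (Submodule.subset_span ⟨i, rfl, rfl⟩))⟩

/-- The algebraic sum of the spaces `H_Q^s`, i.e. the linear span of the special Wick words,
as a subspace of the mixed Fock space. -/
def finiteParticle : Submodule ℂ (FockSpace U e) := Submodule.span ℂ (Set.range (wickFock U e))

end

/-- The bipartite crossing sum. A bipartite pair partition of `{1, …, s} ⊔ {1, …, s'}` is a
bijection `π`; it has to pair equal letters, and it crosses at each pair `r < t` with
`π t < π r`. -/
def bipartiteSum {N : ℕ} (Q : Matrix (Fin N) (Fin N) ℝ) (i i' : List (Fin N)) : ℝ :=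
  ∑ π : Fin i.length ≃ Fin i'.length with ∀ r, i.get r = i'.get (π r),
    ∏ p : Fin i.length × Fin i.length with p.1 < p.2 ∧ π p.2 < π p.1,
      Q (i.get p.1) (i.get p.2)

/-- The annihilation formula
`∑_l δ_{j, i_l} (∏_{r < l} q(i_r, i_l)) w(i_1, …, i_{l-1}, i_{l+1}, …, i_s)`
for a family `w` of vectors indexed by words. -/
def annihilationSum {N : ℕ} {V : Type*} [AddCommMonoid V] [Module ℂ V]
    (Q : Matrix (Fin N) (Fin N) ℝ) (w : List (Fin N) → V) (j : Fin N) (i : List (Fin N)) : V :=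
  ∑ l : Fin i.length with j = i.get l,
    ((∏ r : Fin i.length with r < l, Q (i.get r) (i.get l) : ℝ) : ℂ) • w (i.eraseIdx l)

open MeasureTheory in
/-- The random signs: a symmetric family `ε(a, b) : Ω → {-1, 1}`, `a, b ∈ [N] × ℕ`, with
`ε(a, a) = -1`, such that the `ε(a, b)`, `a < b`, are independent and
`ε((i, k), (j, l))` takes the values `-1` and `1` with probabilities
`(1 - q(i, j)) / 2` and `(1 + q(i, j)) / 2`. -/
structure IsRandomSigns {N : ℕ} {Ω : Type*} [MeasurableSpace Ω] (P : Measure Ω)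
    (Q : Matrix (Fin N) (Fin N) ℝ) (ε : Ω → SpinIndexInf N → SpinIndexInf N → ℝ) : Prop where
  measurable : ∀ a b, Measurable fun ω => ε ω a b
  values : ∀ a b ω, ε ω a b = -1 ∨ ε ω a b = 1
  symm : ∀ a b ω, ε ω a b = ε ω b a
  diag : ∀ a ω, ε ω a a = -1
  prob_neg : ∀ a b, a < b →
    P {ω | ε ω a b = -1} = ENNReal.ofReal ((1 - Q (ofLex a).1 (ofLex b).1) / 2)
  prob_pos : ∀ a b, a < b →
    P {ω | ε ω a b = 1} = ENNReal.ofReal ((1 + Q (ofLex a).1 (ofLex b).1) / 2)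
  indep : ProbabilityTheory.iIndepFun
    (fun p : {p : SpinIndexInf N × SpinIndexInf N // p.1 < p.2} =>
      fun ω => ε ω p.1.1 p.1.2) P

end MixedQGaussian

end

open MixedQGaussian

open scoped ComplexConjugate Matrix ComplexOrder

noncomputable section

namespace MixedQGaussian

-- The random signs enter through a single law of large numbers, `SignAverage`: if all but one index
-- of a product of signs is fixed, the average over the remaining index tends to the corresponding
-- product of the `q(i, j)`, uniformly in the fixed indices. For fixed indices the summands are
-- products over disjoint blocks of independent signs, so Hoeffding's inequality gives an error
-- probability exponentially small in `m`. A union bound over polynomially many indices and the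
-- Borel–Cantelli lemma then give an almost sure statement. Everything afterwards is deterministic,
-- so the null set does not depend on the ultrafilter.
--
-- A word in the generators maps each basis vector `e_B` to a multiple of `e_{B ∆ A}`, where `A`
-- consists of the letters of odd multiplicity. Hence two words are orthogonal unless they have the
-- same odd letters, and counting the remaining pairs gives all `L₂` bounds. In the product of
-- `m^{-1/2} ∑_k x_j(k)` with a Wick sum, the new index is either different from all old ones, which
-- creates a letter, or equal to exactly one of them. In the second case the term is negligible if
-- the letters differ. If they agree, `x_j(k)` is commuted to its copy and cancels, and the average
-- of the resulting signs tends to a product of `q`'s (`tendsto_genSeq_mul_wickSeq_sub`).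
--
-- That a Wick word lies in `L₂(𝓐_U)`, and not merely in the Hilbert space ultraproduct, follows by
-- induction on the length with a resolvent cutoff (`Represents.genSeq_mul`). The generators are
-- self-adjoint because the matrix resolvents are bounded sequences (`generator_isSelfAdjoint`).
-- Their symmetry, with the orthogonality of different lengths, says that creation is formally
-- adjoint to annihilation (`isWickFamily_wick`). This abstract property determines the inner
-- products recursively, makes `c_j` and `a_j` well defined on possibly dependent Wick words, and
-- leads to the commutation relation and to the adjoint of `c_j`.
--
-- For the equality of `L₂(Γ_Q)` and the Fock space, the commutation relation gives `‖c_j u‖² ≤ (s +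
-- 1) ‖u‖²` on level `s`. Carleman's argument (`IsWickFamily.eq_zero_of_orthogonal`) then shows that
-- `x_j + z` maps the finite particle vectors onto a dense subspace of the Fock space for non-real
-- `z`. So the Fock space reduces every `x_j`, and its projection commutes with `Γ_Q`; applied to
-- the vacuum this is one inclusion. Conversely, the projection onto `L₂(Γ_Q)` commutes with the
-- spectral projections, hence with `x_j` (`mem_graph_of_commute_spectralProjections`), and Wick
-- words are reached from the vacuum by induction. The facts needed about spectral projections of
-- unbounded operators are derived from resolvents and the functional calculus of bounded operators.

local notation "⟪" x "," y "⟫" => @inner ℂ _ InnerProductSpace.toInner x y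

/-! ### Matrices that shift the basis vectors -/

section Shift

variable {ι : Type*} [DecidableEq ι]

/-- `M` maps each basis vector `e_B` to a multiple, of modulus at most one, of `e_{B ∆ A}`. -/
def IsShift (A : Finset ι) (M : Matrix (Finset ι) (Finset ι) ℂ) : Prop :=
  (∀ C B, C ≠ symmDiff B A → M C B = 0) ∧ ∀ C B, ‖M C B‖ ≤ 1

lemma IsShift.one : IsShift (∅ : Finset ι) (1 : Matrix (Finset ι) (Finset ι) ℂ) := by
  refine ⟨fun C B h => ?_, fun C B => ?_⟩
  · rw [Matrix.one_apply_ne]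
    simpa [← Finset.bot_eq_empty] using h
  · rw [Matrix.one_apply]
    split_ifs <;> simp

lemma IsShift.mul [Fintype ι] {A A' : Finset ι} {M M' : Matrix (Finset ι) (Finset ι) ℂ}
    (h : IsShift A M) (h' : IsShift A' M') : IsShift (symmDiff A' A) (M * M') := by
  have key : ∀ C B, (M * M') C B = M C (symmDiff B A') * M' (symmDiff B A') B := by
    intro C B
    rw [Matrix.mul_apply, Finset.sum_eq_single (symmDiff B A')]
    · intro D _ hD
      rw [h'.1 _ _ hD, mul_zero]
    · simp
  refine ⟨fun C B hC => ?_, fun C B => ?_⟩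
  · rw [key, h.1, zero_mul]
    rwa [symmDiff_assoc]
  · rw [key, norm_mul]
    exact mul_le_one₀ (h.2 _ _) (norm_nonneg _) (h'.2 _ _)

lemma IsShift.conjTranspose {A : Finset ι} {M : Matrix (Finset ι) (Finset ι) ℂ}
    (h : IsShift A M) : IsShift A Mᴴ := by
  refine ⟨fun C B hC => ?_, fun C B => ?_⟩
  · rw [Matrix.conjTranspose_apply, h.1, star_zero]
    rintro rfl
    simp at hC
  · rw [Matrix.conjTranspose_apply, norm_star]
    exact h.2 _ _

lemma IsShift.ntrace_eq_zero [Fintype ι] {A : Finset ι} {M : Matrix (Finset ι) (Finset ι) ℂ}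
    (h : IsShift A M) (hA : A ≠ ∅) : ntrace M = 0 := by
  rw [ntrace, Matrix.trace, Finset.sum_eq_zero, zero_div]
  intro B _
  refine h.1 _ _ fun hB => hA ?_
  simpa using hB.symm

lemma IsShift.norm_ntrace_le [Fintype ι] {A : Finset ι} {M : Matrix (Finset ι) (Finset ι) ℂ}
    (h : IsShift A M) : ‖ntrace M‖ ≤ 1 := by
  rw [ntrace, norm_div]
  have h1 : ‖M.trace‖ ≤ Fintype.card (Finset ι) := by
    refine (norm_sum_le _ _).trans ?_
    refine (Finset.sum_le_sum fun B _ => h.2 B B).trans ?_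
    simp
  rw [div_le_one]
  · simpa using h1
  · simp

lemma IsShift.norm_nip_le [Fintype ι] {A A' : Finset ι} {M M' : Matrix (Finset ι) (Finset ι) ℂ}
    (h : IsShift A M) (h' : IsShift A' M') : ‖nip M M'‖ ≤ 1 :=
  (h.conjTranspose.mul h').norm_ntrace_le

/-- `Mᴴ * M'` shifts by `A' ∆ A`, and a shift by a nonempty set has zero diagonal. The orthogonality
of words used below comes from this. -/
lemma IsShift.nip_eq_zero [Fintype ι] {A A' : Finset ι} {M M' : Matrix (Finset ι) (Finset ι) ℂ}
    (h : IsShift A M) (h' : IsShift A' M') (hA : A ≠ A') : nip M M' = 0 := by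
  refine (h.conjTranspose.mul h').ntrace_eq_zero fun h0 => hA ?_
  rw [← Finset.bot_eq_empty, symmDiff_eq_bot] at h0
  exact h0.symm

end Shift

/-! ### Relations between the spin matrices. -/

section Spin

variable {ι : Type*} [LinearOrder ι] {e : ι → ι → ℝ}

lemma norm_prod_sign {α : Type*} (s : Finset α) (f : α → ℝ) (hf : ∀ a, f a = -1 ∨ f a = 1) :
    ‖∏ b ∈ s, (f b : ℂ)‖ = 1 := by
  rw [norm_prod, Finset.prod_eq_one]
  intro b _
  rcases hf b with h | h <;> simp [h]

lemma isShift_spinMatrix [Fintype ι] (he : ∀ a b, e a b = -1 ∨ e a b = 1) (a : ι) :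
    IsShift {a} (spinMatrix e a) := by
  refine ⟨fun C B h => ?_, fun C B => ?_⟩
  · simp [spinMatrix, h]
  · rw [spinMatrix, Matrix.of_apply]
    split_ifs
    · exact (norm_prod_sign _ _ (he a)).le
    · simp

lemma filter_symmDiff_singleton (B : Finset ι) (a : ι) :
    ((symmDiff B {a}).filter (· < a)) = B.filter (· < a) := by
  ext x
  simp only [Finset.mem_filter, Finset.mem_symmDiff, Finset.mem_singleton]
  constructor
  · rintro ⟨h1 | h1, h2⟩
    · exact ⟨h1.1, h2⟩
    · exact absurd h2 (by simp [h1.1])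
  · rintro ⟨h1, h2⟩
    exact ⟨Or.inl ⟨h1, h2.ne⟩, h2⟩

lemma conjTranspose_spinMatrix [Fintype ι] (a : ι) : (spinMatrix e a)ᴴ = spinMatrix e a := by
  ext C B
  simp only [spinMatrix, Matrix.conjTranspose_apply, Matrix.of_apply]
  have h : B = symmDiff C {a} ↔ C = symmDiff B {a} := by
    constructor <;> · rintro rfl; simp
  by_cases hC : C = symmDiff B {a}
  · rw [if_pos hC, if_pos (h.2 hC), hC, filter_symmDiff_singleton]
    simp
  · rw [if_neg hC, if_neg (fun h' => hC (h.1 h')), star_zero]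

lemma spinMatrix_mul_apply [Fintype ι] (a b : ι) (C B : Finset ι) :
    (spinMatrix e a * spinMatrix e b) C B =
      if C = symmDiff (symmDiff B {b}) {a} then
        (∏ x ∈ symmDiff B {b} with x < a, (e a x : ℂ)) * ∏ x ∈ B with x < b, (e b x : ℂ)
      else 0 := by
  rw [Matrix.mul_apply, Finset.sum_eq_single (symmDiff B {b})]
  · simp only [spinMatrix, Matrix.of_apply, if_true]
    split_ifs <;> simp
  · intro D _ hD
    simp [spinMatrix, hD]
  · simp

lemma spinMatrix_mul_self [Fintype ι] (he : ∀ a b, e a b = -1 ∨ e a b = 1) (a : ι) :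
    spinMatrix e a * spinMatrix e a = 1 := by
  ext C B
  rw [spinMatrix_mul_apply, filter_symmDiff_singleton, symmDiff_symmDiff_cancel_right,
    Matrix.one_apply, ← Finset.prod_mul_distrib, Finset.prod_eq_one]
  intro x _
  rcases he a x with h | h <;> simp [h]

lemma prod_symmDiff_singleton_of_lt (f : ι → ℂ) (hf : ∀ x, f x * f x = 1) (B : Finset ι)
    {a b : ι} (h : b < a) :
    ∏ x ∈ symmDiff B {b} with x < a, f x = f b * ∏ x ∈ B with x < a, f x := by
  by_cases hb : b ∈ B
  · have h1 : (symmDiff B {b}).filter (· < a) = (B.filter (· < a)).erase b := by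
      ext x
      simp only [Finset.mem_filter, Finset.mem_symmDiff, Finset.mem_singleton, Finset.mem_erase]
      grind
    rw [h1, ← Finset.mul_prod_erase (B.filter (· < a)) f (a := b) (by simp [hb, h]), ← mul_assoc,
      hf, one_mul]
  · have h1 : (symmDiff B {b}).filter (· < a) = insert b (B.filter (· < a)) := by
      ext x
      simp only [Finset.mem_filter, Finset.mem_symmDiff, Finset.mem_singleton, Finset.mem_insert]
      grind
    rw [h1, Finset.prod_insert (by simp [hb])]

lemma prod_symmDiff_singleton_of_not_lt (f : ι → ℂ) (B : Finset ι)
    {a b : ι} (h : ¬ b < a) :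
    ∏ x ∈ symmDiff B {b} with x < a, f x = ∏ x ∈ B with x < a, f x := by
  refine Finset.prod_congr ?_ fun _ _ => rfl
  ext x
  simp only [Finset.mem_filter, Finset.mem_symmDiff, Finset.mem_singleton]
  grind

/-- Toggling `b` before applying `x_a` changes the sign product of `x_a` by the factor `e a b`,
since `b < a`. Toggling `a` does not affect the sign product of `x_b`. -/
lemma spinMatrix_mul_of_lt [Fintype ι] (he : ∀ a b, e a b = -1 ∨ e a b = 1) {a b : ι} (h : b < a) :
    spinMatrix e a * spinMatrix e b = (e a b : ℂ) • (spinMatrix e b * spinMatrix e a) := by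
  have hf : ∀ x, (e a x : ℂ) * (e a x : ℂ) = 1 := fun x => by
    rcases he a x with h | h <;> simp [h]
  ext C B
  rw [Matrix.smul_apply, spinMatrix_mul_apply, spinMatrix_mul_apply, symmDiff_right_comm,
    prod_symmDiff_singleton_of_lt _ hf B h, prod_symmDiff_singleton_of_not_lt _ B h.not_gt]
  split_ifs
  · simp only [smul_eq_mul]; ring
  · simp

lemma spinMatrix_mul_comm [Fintype ι] (he : ∀ a b, e a b = -1 ∨ e a b = 1)
    (hs : ∀ a b, e a b = e b a) {a b : ι} (h : a ≠ b) :
    spinMatrix e a * spinMatrix e b = (e a b : ℂ) • (spinMatrix e b * spinMatrix e a) := by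
  rcases h.lt_or_gt with h | h
  · have hf : (e a b : ℂ) * (e a b : ℂ) = 1 := by
      rcases he a b with h | h <;> simp [h]
    rw [spinMatrix_mul_of_lt he h, smul_smul, hs b a, hf, one_smul]
  · exact spinMatrix_mul_of_lt he h

end Spin

/-! ### Words in the spin matrices -/

section Word

variable {ι : Type*} [LinearOrder ι] [Fintype ι] {e : ι → ι → ℝ}

/-- The product `x_{F 0} ⋯ x_{F (n - 1)}` of spin matrices. -/
def spinWord (e : ι → ι → ℝ) {n : ℕ} (F : Fin n → ι) : Matrix (Finset ι) (Finset ι) ℂ :=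
  (List.ofFn fun r => spinMatrix e (F r)).prod

lemma spinWord_succ {n : ℕ} (F : Fin (n + 1) → ι) :
    spinWord e F = spinMatrix e (F 0) * spinWord e (fun r => F r.succ) := by
  simp [spinWord, List.ofFn_succ]

/-- The set of those letters that occur an odd number of times. -/
def oddLetters {n : ℕ} (F : Fin n → ι) : Finset ι :=
  Finset.univ.filter fun a => Odd (∑ r, if F r = a then 1 else 0)

lemma oddLetters_succ {n : ℕ} (F : Fin (n + 1) → ι) :
    oddLetters F = symmDiff (oddLetters fun r => F r.succ) {F 0} := by
  ext a
  simp only [oddLetters, Finset.mem_filter, Finset.mem_univ, true_and, Fin.sum_univ_succ,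
    Finset.mem_symmDiff, Finset.mem_singleton]
  by_cases h : F 0 = a
  · subst h
    simp [Nat.odd_add, add_comm 1]
  · simp [h, Ne.symm h]

lemma isShift_spinWord (he : ∀ a b, e a b = -1 ∨ e a b = 1) {n : ℕ} (F : Fin n → ι) :
    IsShift (oddLetters F) (spinWord e F) := by
  induction n with
  | zero =>
    have h : oddLetters F = ∅ := by simp [oddLetters]
    rw [h]
    simpa [spinWord] using IsShift.one
  | succ n ih =>
    rw [oddLetters_succ, spinWord_succ]
    exact (isShift_spinMatrix he _).mul (ih _)

lemma oddLetters_of_injective {n : ℕ} {F : Fin n → ι} (hF : Function.Injective F) :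
    oddLetters F = Finset.univ.image F := by
  ext a
  simp only [oddLetters, Finset.mem_filter, Finset.mem_univ, true_and, Finset.mem_image]
  constructor
  · intro h
    by_contra! h'
    simp [h'] at h
  · rintro ⟨r, rfl⟩
    simp [hF.eq_iff]

/-- The left factor moves past the letters before position `l`, each exchange costing one sign,
until it meets its own copy and squares to `1`. Injectivity ensures that the letters on the way are
different from it. -/
lemma spinMatrix_mul_spinWord (he : ∀ a b, e a b = -1 ∨ e a b = 1) (hs : ∀ a b, e a b = e b a)
    {n : ℕ} (F : Fin (n + 1) → ι) (hF : Function.Injective F) (l : Fin (n + 1)) :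
    spinMatrix e (F l) * spinWord e F =
      (∏ r : Fin n with r.castSucc < l, (e (F (l.succAbove r)) (F l) : ℂ)) •
        spinWord e (fun r => F (l.succAbove r)) := by
  induction n with
  | zero =>
    obtain rfl : l = 0 := Fin.fin_one_eq_zero l
    simp [spinWord, spinMatrix_mul_self he]
  | succ n ih =>
    refine Fin.cases ?_ (fun l => ?_) l
    · rw [spinWord_succ, ← mul_assoc, spinMatrix_mul_self he]
      simp
    · have hne : F l.succ ≠ F 0 := fun h => Fin.succ_ne_zero l (hF h)
      rw [spinWord_succ, ← mul_assoc, spinMatrix_mul_comm he hs hne, Matrix.smul_mul, mul_assoc,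
        ih (fun r => F r.succ) (hF.comp (Fin.succ_injective _)) l, spinWord_succ,
        Matrix.mul_smul, smul_smul, Finset.prod_filter, Finset.prod_filter,
        Fin.prod_univ_succ, hs (F l.succ) (F 0)]
      simp [Fin.succ_succAbove_succ, Fin.succ_lt_succ_iff]

end Word

/-! ### The normalized trace and operator norms of matrices -/

section MatrixNorms

variable {n : Type*} [Fintype n]

lemma nip_self_nonneg (A : Matrix n n ℂ) : 0 ≤ (nip A A).re := (nipCore n).re_inner_nonneg A

lemma nip_self_eq (A : Matrix n n ℂ) :
    (nip A A).re = (∑ j, ∑ i, ‖A i j‖ ^ 2) / Fintype.card n := by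
  have h : nip A A = (((∑ j, ∑ i, ‖A i j‖ ^ 2) / Fintype.card n : ℝ) : ℂ) := by
    simp only [nip, ntrace, Matrix.trace, Matrix.diag, Matrix.mul_apply,
      Matrix.conjTranspose_apply]
    push_cast
    congr 1
    refine Finset.sum_congr rfl fun j _ => Finset.sum_congr rfl fun i _ => ?_
    rw [← Complex.conj_mul']
    rfl
  rw [h, Complex.ofReal_re]

lemma nip_conjTranspose (A : Matrix n n ℂ) : nip Aᴴ Aᴴ = nip A A := by
  rw [nip, nip, Matrix.conjTranspose_conjTranspose, ntrace, ntrace, Matrix.trace_mul_comm]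

lemma nip_add_left (A B C : Matrix n n ℂ) : nip (A + B) C = nip A C + nip B C :=
  (nipCore n).add_left A B C

lemma nip_add_right (A B C : Matrix n n ℂ) : nip A (B + C) = nip A B + nip A C := by
  simp [nip, ntrace, mul_add, add_div]

lemma nip_smul_left (c : ℂ) (A B : Matrix n n ℂ) : nip (c • A) B = conj c * nip A B :=
  (nipCore n).smul_left A B c

lemma nip_smul_right (c : ℂ) (A B : Matrix n n ℂ) : nip A (c • B) = c * nip A B := by
  simp [nip, ntrace, mul_div_assoc]

lemma nip_sum_left {α : Type*} (s : Finset α) (A : α → Matrix n n ℂ) (B : Matrix n n ℂ) :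
    nip (∑ k ∈ s, A k) B = ∑ k ∈ s, nip (A k) B := by
  simp [nip, ntrace, Matrix.conjTranspose_sum, Finset.sum_mul, Matrix.trace_sum, Finset.sum_div]

lemma nip_sum_right {α : Type*} (s : Finset α) (A : Matrix n n ℂ) (B : α → Matrix n n ℂ) :
    nip A (∑ k ∈ s, B k) = ∑ k ∈ s, nip A (B k) := by
  simp [nip, ntrace, Finset.mul_sum, Matrix.trace_sum, Finset.sum_div]

lemma nip_mul_left (A B C : Matrix n n ℂ) : nip (A * B) C = nip B (Aᴴ * C) := by
  rw [nip, nip, Matrix.conjTranspose_mul, mul_assoc]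

lemma nip_smul_self (c : ℂ) (A : Matrix n n ℂ) :
    (nip (c • A) (c • A)).re = ‖c‖ ^ 2 * (nip A A).re := by
  rw [nip_smul_left, nip_smul_right, ← mul_assoc, Complex.conj_mul', ← Complex.ofReal_pow,
    Complex.re_ofReal_mul]

lemma nip_sum_self_le {α : Type*} (s : Finset α) (A : α → Matrix n n ℂ) :
    (nip (∑ k ∈ s, A k) (∑ k ∈ s, A k)).re ≤ s.card * ∑ k ∈ s, (nip (A k) (A k)).re := by
  have h : (nip (∑ k ∈ s, A k) (∑ k ∈ s, A k)).re ≤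
      ∑ k ∈ s, ∑ l ∈ s, ((nip (A k) (A k)).re + (nip (A l) (A l)).re) / 2 := by
    rw [nip_sum_left, Complex.re_sum]
    have h2 : ∑ k ∈ s, (nip (A k) (∑ l ∈ s, A l)).re =
        ∑ k ∈ s, ∑ l ∈ s, ((nip (A k) (A l)).re + (nip (A l) (A k)).re) / 2 := by
      have h3 : ∑ k ∈ s, (nip (A k) (∑ l ∈ s, A l)).re = ∑ k ∈ s, ∑ l ∈ s, (nip (A k) (A l)).re :=
        Finset.sum_congr rfl fun k _ => by rw [nip_sum_right, Complex.re_sum]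
      have h4 := Finset.sum_comm (s := s) (t := s) (f := fun k l => (nip (A k) (A l)).re)
      simp only [← Finset.sum_div, Finset.sum_add_distrib]
      rw [h3, ← h4]
      ring
    rw [h2]
    refine Finset.sum_le_sum fun k _ => Finset.sum_le_sum fun l _ => ?_
    have h := nip_self_nonneg (A k + (-1 : ℂ) • A l)
    simp only [nip_add_left, nip_add_right, nip_smul_left, nip_smul_right, Complex.add_re,
      map_neg, map_one, neg_mul, one_mul, Complex.neg_re] at h
    linarith
  refine h.trans_eq ?_
  simp only [← Finset.sum_div, Finset.sum_add_distrib, Finset.sum_const, nsmul_eq_mul,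
    ← Finset.mul_sum]
  ring

variable [DecidableEq n]

lemma opNorm_nonneg (A : Matrix n n ℂ) : 0 ≤ opNorm A := norm_nonneg _

lemma opNorm_add_le (A B : Matrix n n ℂ) : opNorm (A + B) ≤ opNorm A + opNorm B := by
  rw [opNorm, map_add]; exact norm_add_le _ _

lemma opNorm_mul_le (A B : Matrix n n ℂ) : opNorm (A * B) ≤ opNorm A * opNorm B := by
  rw [opNorm, map_mul]; exact norm_mul_le _ _

lemma opNorm_smul (c : ℂ) (A : Matrix n n ℂ) : opNorm (c • A) = ‖c‖ * opNorm A := by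
  rw [opNorm, map_smul]; exact norm_smul _ _

lemma opNorm_one_le : opNorm (1 : Matrix n n ℂ) ≤ 1 := by
  rw [opNorm, map_one]; exact ContinuousLinearMap.norm_id_le

lemma opNorm_conjTranspose (A : Matrix n n ℂ) : opNorm Aᴴ = opNorm A := by
  rw [opNorm, ← Matrix.star_eq_conjTranspose, map_star]
  exact norm_star (Matrix.toEuclideanCLM (n := n) (𝕜 := ℂ) A)

lemma nip_mul_left_self_le (A B : Matrix n n ℂ) :
    (nip (A * B) (A * B)).re ≤ opNorm A ^ 2 * (nip B B).re := by
  rw [nip_self_eq, nip_self_eq, ← mul_div_assoc, Finset.mul_sum]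
  gcongr with j
  have h := (Matrix.toEuclideanCLM (n := n) (𝕜 := ℂ) A).le_opNorm (WithLp.toLp 2 fun i => B i j)
  have h2 := pow_le_pow_left₀ (norm_nonneg _) h 2
  rw [mul_pow, EuclideanSpace.norm_sq_eq, EuclideanSpace.norm_sq_eq] at h2
  simpa [opNorm, Matrix.toEuclideanCLM_toLp, Matrix.mulVec, dotProduct, Matrix.mul_apply] using h2

lemma nip_mul_right_self_le (A B : Matrix n n ℂ) :
    (nip (A * B) (A * B)).re ≤ opNorm B ^ 2 * (nip A A).re := by
  rw [← nip_conjTranspose (A * B), Matrix.conjTranspose_mul, ← opNorm_conjTranspose B,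
    ← nip_conjTranspose A]
  exact nip_mul_left_self_le _ _

lemma nip_self_le_opNorm [Nonempty n] (A : Matrix n n ℂ) : (nip A A).re ≤ opNorm A ^ 2 := by
  have h := nip_mul_left_self_le A 1
  have h1 : nip (1 : Matrix n n ℂ) 1 = 1 := by simp [nip, ntrace]
  simpa [h1] using h

/-- Since `⟪v, A v⟫` is real, the imaginary part of `⟪v, (A + i t) v⟫` is `t ‖v‖²`; Cauchy–Schwarz
does the rest. -/
lemma le_norm_shift_mulVec {A : Matrix n n ℂ} (hA : Aᴴ = A) (t : ℝ) (v : EuclideanSpace ℂ n) :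
    |t| * ‖v‖ ≤ ‖Matrix.toEuclideanCLM (n := n) (𝕜 := ℂ) (A + (t * Complex.I : ℂ) • 1) v‖ := by
  set T := Matrix.toEuclideanCLM (n := n) (𝕜 := ℂ) A with hT
  have hsa : IsSelfAdjoint T := by
    rw [hT, IsSelfAdjoint, ← map_star, Matrix.star_eq_conjTranspose, hA]
  have h1 : Matrix.toEuclideanCLM (n := n) (𝕜 := ℂ) (A + (t * Complex.I : ℂ) • 1) v =
      T v + (t * Complex.I : ℂ) • v := by
    simp [hT]
  have hre : (inner ℂ v (T v)).im = 0 := by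
    have h2 : inner ℂ v (T v) = conj (inner ℂ v (T v)) := by
      rw [inner_conj_symm]
      conv_lhs => rw [← ContinuousLinearMap.adjoint_inner_left]
      rw [← ContinuousLinearMap.star_eq_adjoint, hsa.star_eq]
    exact Complex.conj_eq_iff_im.1 h2.symm
  have h3 : (inner ℂ v (T v + (t * Complex.I : ℂ) • v)).im = t * ‖v‖ ^ 2 := by
    rw [inner_add_right, inner_smul_right, inner_self_eq_norm_sq_to_K, Complex.add_im, hre]
    simp [← Complex.ofReal_pow, Complex.mul_im]
  rw [h1]
  rcases eq_or_ne v 0 with rfl | hv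
  · simp
  have h4 := (Complex.abs_im_le_norm _).trans
    (norm_inner_le_norm (𝕜 := ℂ) v (T v + (t * Complex.I : ℂ) • v))
  rw [h3, abs_mul, abs_of_nonneg (sq_nonneg ‖v‖)] at h4
  have h5 : 0 < ‖v‖ := norm_pos_iff.2 hv
  nlinarith

lemma isUnit_shift {A : Matrix n n ℂ} (hA : Aᴴ = A) {t : ℝ} (ht : t ≠ 0) :
    IsUnit (A + (t * Complex.I : ℂ) • (1 : Matrix n n ℂ)) := by
  rw [← Matrix.mulVec_injective_iff_isUnit]
  refine (injective_iff_map_eq_zero (Matrix.mulVecLin _)).2 fun v hv => ?_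
  have h := le_norm_shift_mulVec hA t (WithLp.toLp 2 v)
  rw [Matrix.toEuclideanCLM_toLp] at h
  change _ = _ at hv
  rw [Matrix.mulVecLin_apply] at hv
  rw [hv, WithLp.toLp_zero, norm_zero] at h
  have h1 : 0 < |t| := abs_pos.2 ht
  have h2 : ‖WithLp.toLp 2 v‖ = 0 := le_antisymm (by nlinarith) (norm_nonneg _)
  simpa using h2

/-- The resolvent `(A + i t)⁻¹`. -/
def shiftInv (A : Matrix n n ℂ) (t : ℝ) : Matrix n n ℂ := (A + (t * Complex.I : ℂ) • 1)⁻¹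

lemma mul_shiftInv {A : Matrix n n ℂ} (hA : Aᴴ = A) {t : ℝ} (ht : t ≠ 0) :
    (A + (t * Complex.I : ℂ) • 1) * shiftInv A t = 1 :=
  Matrix.mul_nonsing_inv _ ((Matrix.isUnit_iff_isUnit_det _).1 (isUnit_shift hA ht))

lemma shiftInv_mul {A : Matrix n n ℂ} (hA : Aᴴ = A) {t : ℝ} (ht : t ≠ 0) :
    shiftInv A t * (A + (t * Complex.I : ℂ) • 1) = 1 :=
  Matrix.nonsing_inv_mul _ ((Matrix.isUnit_iff_isUnit_det _).1 (isUnit_shift hA ht))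

lemma opNorm_shiftInv_le {A : Matrix n n ℂ} (hA : Aᴴ = A) {t : ℝ} (ht : t ≠ 0) :
    opNorm (shiftInv A t) ≤ |t|⁻¹ := by
  have h1 : 0 < |t| := abs_pos.2 ht
  refine ContinuousLinearMap.opNorm_le_bound _ (by positivity) fun v => ?_
  have h := le_norm_shift_mulVec hA t (Matrix.toEuclideanCLM (n := n) (𝕜 := ℂ) (shiftInv A t) v)
  rw [← mul_apply_eq_comp, ← map_mul, mul_shiftInv hA ht, map_one,
    one_apply_eq_self] at h
  rw [inv_mul_eq_div, le_div_iff₀ h1, mul_comm]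
  exact h

/-- Left multiplication by `A + i t` is injective on the finite-dimensional space `S`, hence
surjective, so `1` has a preimage in `S`. This keeps the resolvents inside the spin algebras. -/
lemma shiftInv_mem (S : StarSubalgebra ℂ (Matrix n n ℂ)) {A : Matrix n n ℂ} (hA : Aᴴ = A)
    (hS : A ∈ S) {t : ℝ} (ht : t ≠ 0) : shiftInv A t ∈ S := by
  set B := A + (t * Complex.I : ℂ) • (1 : Matrix n n ℂ) with hB
  have hBS : B ∈ S := add_mem hS (S.smul_mem (one_mem _) _)
  let f : S →ₗ[ℂ] S := LinearMap.mulLeft ℂ (⟨B, hBS⟩ : S)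
  have hf : Function.Injective f := by
    refine (injective_iff_map_eq_zero f).2 fun y hy => ?_
    have h1 : B * (y : Matrix n n ℂ) = 0 := congrArg Subtype.val hy
    have h2 : shiftInv A t * (B * (y : Matrix n n ℂ)) = y := by
      rw [← mul_assoc, shiftInv_mul hA ht, one_mul]
    rw [h1, mul_zero] at h2
    exact Subtype.ext h2.symm
  have : FiniteDimensional ℂ S := inferInstanceAs (FiniteDimensional ℂ S.toSubalgebra.toSubmodule)
  obtain ⟨y, hy⟩ := LinearMap.injective_iff_surjective.1 hf 1
  have h1 : B * (y : Matrix n n ℂ) = 1 := congrArg Subtype.val hy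
  have h2 : shiftInv A t = y := by
    rw [← mul_one (shiftInv A t), ← h1, ← mul_assoc, shiftInv_mul hA ht, one_mul]
  rw [h2]
  exact y.2

end MatrixNorms

lemma re_inner_self {H : Type*} [NormedAddCommGroup H] [InnerProductSpace ℂ H] (x : H) :
    (⟪x, x⟫).re = ‖x‖ ^ 2 := inner_self_eq_norm_sq (𝕜 := ℂ) x

/-! ### Vectors represented by sequences of matrices -/

section Represents

open Filter

variable {N : ℕ} {U : Ultrafilter ℕ} {e : SpinIndexInf N → SpinIndexInf N → ℝ}

lemma cls_add (y z : L2Seq e) : cls U (y + z) = cls U y + cls U z :=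
  UniformSpace.Completion.coe_add (show PreL2 U e from y) (show PreL2 U e from z)

lemma cls_smul (c : ℂ) (y : L2Seq e) : cls U (c • y) = c • cls U y :=
  UniformSpace.Completion.coe_smul c (show PreL2 U e from y)

lemma tendsto_nip_cls (y z : L2Seq e) :
    Tendsto (fun m => nip (y.1 m) (z.1 m)) U (nhds (⟪cls U y, cls U z⟫)) := by
  have h : ⟪cls U y, cls U z⟫ =
      preInner (show PreL2 U e from y) (show PreL2 U e from z) :=
    UniformSpace.Completion.inner_coe (show PreL2 U e from y) (show PreL2 U e from z)
  rw [h]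
  exact tendsto_preInner _ _

variable {y z b : ∀ m : ℕ, SpinMat N m} {ξ η : L2A U e}

lemma Represents.tendsto (hy : Represents U y ξ) (hz : Represents U z η) :
    Tendsto (fun m => nip (y m) (z m)) U (nhds (⟪ξ, η⟫)) := by
  obtain ⟨hy, h1⟩ := hy
  obtain ⟨hz, h2⟩ := hz
  have h3 : ⟪ξ, η⟫ = ⟪(ξ : UltraL2 U e), (η : UltraL2 U e)⟫ := rfl
  rw [h3, h1, h2]
  exact tendsto_nip_cls (⟨y, hy⟩ : L2Seq e) ⟨z, hz⟩

lemma Represents.tendsto_norm_sq (hy : Represents U y ξ) :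
    Tendsto (fun m => (nip (y m) (y m)).re) U (nhds (‖ξ‖ ^ 2)) := by
  have h := (Complex.continuous_re.tendsto _).comp (hy.tendsto hy)
  rwa [re_inner_self] at h

lemma Represents.unique (hy : Represents U y ξ) (hz : Represents U y η) : ξ = η := by
  obtain ⟨_, h1⟩ := hy
  obtain ⟨_, h2⟩ := hz
  exact Subtype.ext (h1.trans h2.symm)

lemma Represents.add (hy : Represents U y ξ) (hz : Represents U z η) :
    Represents U (fun m => y m + z m) (ξ + η) := by
  obtain ⟨hy, h1⟩ := hy
  obtain ⟨hz, h2⟩ := hz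
  exact ⟨add_mem hy hz, by
    rw [Submodule.coe_add, h1, h2]; exact (cls_add (⟨y, hy⟩ : L2Seq e) ⟨z, hz⟩).symm⟩

lemma Represents.smul (c : ℂ) (hy : Represents U y ξ) :
    Represents U (fun m => c • y m) (c • ξ) := by
  obtain ⟨hy, h1⟩ := hy
  exact ⟨Submodule.smul_mem _ c hy, by
    rw [Submodule.coe_smul, h1]; exact (cls_smul c (⟨y, hy⟩ : L2Seq e)).symm⟩

lemma Represents.sub (hy : Represents U y ξ) (hz : Represents U z η) :
    Represents U (fun m => y m - z m) (ξ - η) := by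
  simpa [sub_eq_add_neg] using hy.add (hz.smul (-1))

lemma Represents.zero : Represents U (fun _ => 0) (0 : L2A U e) := by
  refine ⟨zero_mem (L2Seq e), ?_⟩
  have h := cls_smul (U := U) 0 (0 : L2Seq e)
  rw [zero_smul, zero_smul] at h
  exact h.symm

lemma Represents.sum {α : Type*} (s : Finset α) {y : α → ∀ m : ℕ, SpinMat N m} {ξ : α → L2A U e}
    (h : ∀ k ∈ s, Represents U (y k) (ξ k)) :
    Represents U (fun m => ∑ k ∈ s, y k m) (∑ k ∈ s, ξ k) := by
  classical
  induction s using Finset.induction_on with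
  | empty => simpa using Represents.zero
  | insert a s ha ih =>
    simp only [Finset.sum_insert ha]
    exact (h a (by simp)).add (ih fun k hk => h k (by simp [hk]))

lemma Represents.of_null (hy : Represents U y ξ) (hz : z ∈ L2Seq e)
    (h : Tendsto (fun m => (nip (z m - y m) (z m - y m)).re) U (nhds 0)) :
    Represents U z ξ := by
  obtain ⟨hy, h1⟩ := hy
  refine ⟨hz, ?_⟩
  have h2 : cls U (⟨z, hz⟩ : L2Seq e) =
      cls U (⟨y, hy⟩ : L2Seq e) + cls U (⟨z, hz⟩ - ⟨y, hy⟩ : L2Seq e) := by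
    rw [← cls_add]; congr 1; abel
  have h3 := (Complex.continuous_re.tendsto _).comp
    (tendsto_nip_cls (U := U) (⟨z, hz⟩ - ⟨y, hy⟩ : L2Seq e) (⟨z, hz⟩ - ⟨y, hy⟩ : L2Seq e))
  have h4 := tendsto_nhds_unique h3 h
  rw [re_inner_self] at h4
  rw [h1, h2, norm_eq_zero.1 (pow_eq_zero_iff two_ne_zero |>.1 h4), add_zero]

lemma Represents.bullet_eq (hy : Represents U y ξ) : bullet U e y = ξ := by
  have h : ∃ ξ : L2A U e, Represents U y ξ := ⟨ξ, hy⟩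
  rw [bullet, dif_pos h]
  exact h.choose_spec.unique hy

lemma represents_bullet (h : ∃ ξ : L2A U e, Represents U y ξ) :
    Represents U y (bullet U e y) := by
  obtain ⟨ξ, hξ⟩ := h
  rwa [hξ.bullet_eq]

/-! ### Bounded sequences -/

lemma IsBddSeq.add (hy : IsBddSeq e y) (hz : IsBddSeq e z) : IsBddSeq e fun m => y m + z m := by
  obtain ⟨hy, C, hC⟩ := hy
  obtain ⟨hz, D, hD⟩ := hz
  exact ⟨fun m => add_mem (hy m) (hz m), C + D,
    fun m => (opNorm_add_le _ _).trans (add_le_add (hC m) (hD m))⟩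

lemma IsBddSeq.smul (c : ℂ) (hy : IsBddSeq e y) : IsBddSeq e fun m => c • y m := by
  obtain ⟨hy, C, hC⟩ := hy
  exact ⟨fun m => (spinAlgebra e m).smul_mem (hy m) c, ‖c‖ * C,
    fun m => (opNorm_smul _ _).trans_le (mul_le_mul_of_nonneg_left (hC m) (norm_nonneg _))⟩

lemma IsBddSeq.mul (hy : IsBddSeq e y) (hz : IsBddSeq e z) : IsBddSeq e fun m => y m * z m := by
  obtain ⟨hy, C, hC⟩ := hy
  obtain ⟨hz, D, hD⟩ := hz
  exact ⟨fun m => mul_mem (hy m) (hz m), C * D, fun m => (opNorm_mul_le _ _).trans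
    (mul_le_mul (hC m) (hD m) (opNorm_nonneg _) ((opNorm_nonneg _).trans (hC m)))⟩

lemma IsBddSeq.one : IsBddSeq e fun _ => 1 :=
  ⟨fun _ => one_mem _, 1, fun _ => opNorm_one_le⟩

lemma IsBddSeq.mem_L2Seq (hy : IsBddSeq e y) : y ∈ L2Seq e := by
  obtain ⟨hy, C, hC⟩ := hy
  exact ⟨hy, C ^ 2, fun m => (nip_self_le_opNorm _).trans
    (pow_le_pow_left₀ (opNorm_nonneg _) (hC m) 2)⟩

lemma IsBddSeq.exists_represents (hy : IsBddSeq e y) : ∃ ξ : L2A U e, Represents U y ξ :=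
  ⟨⟨cls U ⟨y, hy.mem_L2Seq⟩, Submodule.le_topologicalClosure _
    (Submodule.subset_span ⟨⟨y, hy.mem_L2Seq⟩, hy, rfl⟩)⟩, hy.mem_L2Seq, rfl⟩

lemma exists_isBddSeq_norm_sub_lt (ξ : L2A U e) {ε : ℝ} (hε : 0 < ε) :
    ∃ (a : ∀ m : ℕ, SpinMat N m) (η : L2A U e),
      IsBddSeq e a ∧ Represents U a η ∧ ‖ξ - η‖ < ε := by
  obtain ⟨ζ, hζ, hd⟩ := Metric.mem_closure_iff.1
    (show (ξ : UltraL2 U e) ∈ closure (Submodule.span ℂ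
      {ξ | ∃ y : L2Seq e, IsBddSeq e y.1 ∧ ξ = cls U y} : Set (UltraL2 U e)) from ξ.2) ε hε
  obtain ⟨y, hy, rfl⟩ : ∃ y : L2Seq e, IsBddSeq e y.1 ∧ ζ = cls U y := by
    refine Submodule.span_induction (p := fun ζ _ => ∃ y : L2Seq e, IsBddSeq e y.1 ∧ ζ = cls U y)
      (fun x hx => hx) ?_ ?_ ?_ hζ
    · refine ⟨(0 : ℂ) • ⟨_, IsBddSeq.one.mem_L2Seq⟩, IsBddSeq.one.smul 0, ?_⟩
      rw [cls_smul, zero_smul]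
    · rintro _ _ _ _ ⟨y, hy, rfl⟩ ⟨z, hz, rfl⟩
      exact ⟨y + z, hy.add hz, (cls_add y z).symm⟩
    · rintro c _ _ ⟨y, hy, rfl⟩
      exact ⟨c • y, hy.smul c, (cls_smul c y).symm⟩
  obtain ⟨η, hη⟩ := hy.exists_represents (U := U)
  refine ⟨y.1, η, hy, hη, ?_⟩
  obtain ⟨_, h2⟩ := hη
  change ‖((ξ - η : L2A U e) : UltraL2 U e)‖ < ε
  rw [Submodule.coe_sub, h2, ← dist_eq_norm]
  exact hd

/-- The class of an `L₂`-bounded sequence lies in the Hilbert space ultraproduct but need not lie in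
`ultraSpace`. As that subspace is closed, it suffices to approximate along `U` by sequences that
represent vectors. -/
lemma exists_represents_of_approx (hy : y ∈ L2Seq e)
    (h : ∀ ε > 0, ∃ (z : ∀ m : ℕ, SpinMat N m) (η : L2A U e), Represents U z η ∧
      ∀ᶠ m in (U : Filter ℕ), (nip (y m - z m) (y m - z m)).re ≤ ε) :
    ∃ ξ : L2A U e, Represents U y ξ := by
  suffices h1 : cls U (⟨y, hy⟩ : L2Seq e) ∈ ultraSpace U e from ⟨⟨_, h1⟩, hy, rfl⟩
  have hcl : IsClosed (ultraSpace U e : Set (UltraL2 U e)) :=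
    Submodule.isClosed_topologicalClosure _
  rw [← SetLike.mem_coe, ← hcl.closure_eq, Metric.mem_closure_iff]
  intro ε hε
  obtain ⟨z, η, ⟨hz, hη⟩, hle⟩ := h ((ε / 2) ^ 2) (by positivity)
  refine ⟨η, η.2, ?_⟩
  have h3 := (Complex.continuous_re.tendsto _).comp
    (tendsto_nip_cls (U := U) (⟨y, hy⟩ - ⟨z, hz⟩ : L2Seq e) (⟨y, hy⟩ - ⟨z, hz⟩ : L2Seq e))
  have h4 := le_of_tendsto h3 hle
  rw [re_inner_self] at h4
  have h6 := (sq_le_sq₀ (norm_nonneg _) (by positivity)).1 h4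
  have h2 : cls U (⟨y, hy⟩ : L2Seq e) - η = cls U (⟨y, hy⟩ - ⟨z, hz⟩ : L2Seq e) := by
    rw [hη, sub_eq_iff_eq_add, ← cls_add]; congr 1; abel
  rw [dist_eq_norm, h2]
  linarith

lemma L2Seq.mul_left (hb : IsBddSeq e b) (hy : y ∈ L2Seq e) :
    (fun m => b m * y m) ∈ L2Seq e := by
  obtain ⟨hb, C, hC⟩ := hb
  obtain ⟨hy, D, hD⟩ := hy
  refine ⟨fun m => mul_mem (hb m) (hy m), C ^ 2 * D, fun m => (nip_mul_left_self_le _ _).trans ?_⟩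
  exact mul_le_mul (pow_le_pow_left₀ (opNorm_nonneg _) (hC m) 2) (hD m) (nip_self_nonneg _)
    (by positivity)

lemma L2Seq.mul_right (hb : IsBddSeq e b) (hy : y ∈ L2Seq e) :
    (fun m => y m * b m) ∈ L2Seq e := by
  obtain ⟨hb, C, hC⟩ := hb
  obtain ⟨hy, D, hD⟩ := hy
  refine ⟨fun m => mul_mem (hy m) (hb m), C ^ 2 * D, fun m => (nip_mul_right_self_le _ _).trans ?_⟩
  exact mul_le_mul (pow_le_pow_left₀ (opNorm_nonneg _) (hC m) 2) (hD m) (nip_self_nonneg _)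
    (by positivity)

lemma Represents.exists_eventually_le (hy : Represents U y ξ) {ε : ℝ} (hε : 0 < ε) :
    ∃ a : ∀ m : ℕ, SpinMat N m, IsBddSeq e a ∧
      ∀ᶠ m in (U : Filter ℕ), (nip (y m - a m) (y m - a m)).re ≤ ε := by
  obtain ⟨a, η, ha, hη, hlt⟩ := exists_isBddSeq_norm_sub_lt ξ (Real.sqrt_pos.2 hε)
  refine ⟨a, ha, ?_⟩
  have h1 : ‖ξ - η‖ ^ 2 < ε := by
    have := pow_lt_pow_left₀ hlt (norm_nonneg _) two_ne_zero
    rwa [Real.sq_sqrt hε.le] at this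
  exact ((hy.sub hη).tendsto_norm_sq.eventually_lt_const h1).mono fun m hm => hm.le

lemma Represents.mul_left (hb : IsBddSeq e b) (hy : Represents U y ξ) :
    ∃ η : L2A U e, Represents U (fun m => b m * y m) η := by
  obtain ⟨C, hC⟩ := hb.2
  refine exists_represents_of_approx (L2Seq.mul_left hb hy.1) fun ε hε => ?_
  -- Multiplication by `b` enlarges squared `L₂` norms by at most `C ^ 2`; the summand `1` keeps the
  -- denominator positive.
  obtain ⟨a, ha, hle⟩ := hy.exists_eventually_le (ε := ε / (C ^ 2 + 1)) (by positivity)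
  obtain ⟨η, hη⟩ := (hb.mul ha).exists_represents (U := U)
  refine ⟨_, η, hη, hle.mono fun m hm => ?_⟩
  rw [← mul_sub]
  rw [le_div_iff₀ (by positivity)] at hm
  have h1 := pow_le_pow_left₀ (opNorm_nonneg _) (hC m) 2
  have h2 := nip_self_nonneg (y m - a m)
  have h3 := nip_mul_left_self_le (b m) (y m - a m)
  nlinarith

lemma Represents.mul_right (hb : IsBddSeq e b) (hy : Represents U y ξ) :
    ∃ η : L2A U e, Represents U (fun m => y m * b m) η := by
  obtain ⟨C, hC⟩ := hb.2
  refine exists_represents_of_approx (L2Seq.mul_right hb hy.1) fun ε hε => ?_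
  obtain ⟨a, ha, hle⟩ := hy.exists_eventually_le (ε := ε / (C ^ 2 + 1)) (by positivity)
  obtain ⟨η, hη⟩ := (ha.mul hb).exists_represents (U := U)
  refine ⟨_, η, hη, hle.mono fun m hm => ?_⟩
  rw [← sub_mul]
  rw [le_div_iff₀ (by positivity)] at hm
  have h1 := pow_le_pow_left₀ (opNorm_nonneg _) (hC m) 2
  have h2 := nip_self_nonneg (y m - a m)
  have h3 := nip_mul_right_self_le (y m - a m) (b m)
  nlinarith

end Represents

/-! ### Self-adjoint operators -/

section SelfAdjoint

variable {H : Type*} [NormedAddCommGroup H] [InnerProductSpace ℂ H]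

lemma im_inner_self (x : H) : (⟪x, x⟫).im = 0 := inner_self_im (𝕜 := ℂ) x

/-- Two vectors with `⟪u, v⟫` real satisfy `|Im z| ‖u‖ ≤ ‖v + z u‖`. -/
lemma abs_im_mul_norm_le {u v : H} (h : (⟪u, v⟫).im = 0) (z : ℂ) :
    |z.im| * ‖u‖ ≤ ‖v + z • u‖ := by
  have h3 : (⟪u, v + z • u⟫).im = z.im * ‖u‖ ^ 2 := by
    rw [inner_add_right, inner_smul_right, Complex.add_im, h, Complex.mul_im, im_inner_self,
      re_inner_self]
    ring
  rcases eq_or_ne u 0 with rfl | hv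
  · simp
  have h4 := (Complex.abs_im_le_norm _).trans (norm_inner_le_norm (𝕜 := ℂ) u (v + z • u))
  rw [h3, abs_mul, abs_of_nonneg (sq_nonneg ‖u‖)] at h4
  have h5 : 0 < ‖u‖ := norm_pos_iff.2 hv
  nlinarith

lemma im_inner_eq_zero_of_symm {u v : H} (h : ⟪v, u⟫ = ⟪u, v⟫) : (⟪u, v⟫).im = 0 := by
  rw [← Complex.conj_eq_iff_im, inner_conj_symm, h]

variable [CompleteSpace H]

/-- If `G` is closed and symmetric, then the range of `T + z`, where `T` is the relation with
graph `G`, is closed. -/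
lemma isClosed_range_add_smul {G : Submodule ℂ (H × H)} (hG : IsClosed (G : Set (H × H)))
    (hsym : ∀ p ∈ G, ∀ q ∈ G, ⟪p.2, q.1⟫ = ⟪p.1, q.2⟫) {z : ℂ} (hz : z.im ≠ 0) :
    IsClosed {y | ∃ p ∈ G, p.2 + z • p.1 = y} := by
  let L : H × H →L[ℂ] H := ContinuousLinearMap.snd ℂ H H + z • ContinuousLinearMap.fst ℂ H H
  let f : G →L[ℂ] H := L.comp G.subtypeL
  have hz' : 0 < |z.im| := abs_pos.2 hz
  -- `T + z` is bounded below on the graph: its value controls `p.1` because `z` is not real, and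
  -- then `p.2`, which differs from that value by `z • p.1`. A map bounded below on a complete space
  -- has closed range.
  have hf : AntilipschitzWith (⟨1 + (1 + ‖z‖) / |z.im|, by positivity⟩ : NNReal) f := by
    refine ContinuousLinearMap.antilipschitz_of_bound f fun p => ?_
    have h1 := abs_im_mul_norm_le (im_inner_eq_zero_of_symm (hsym p p.2 p p.2)) z
    have h2 : f p = (p : H × H).2 + z • (p : H × H).1 := rfl
    rw [← h2] at h1
    have h3 : ‖(p : H × H).1‖ ≤ ‖f p‖ / |z.im| := by rw [le_div_iff₀ hz', mul_comm]; exact h1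
    have h4 : ‖(p : H × H).2‖ ≤ ‖f p‖ + ‖z‖ * ‖(p : H × H).1‖ := by
      rw [← norm_smul, h2]
      have := norm_sub_le ((p : H × H).2 + z • (p : H × H).1) (z • (p : H × H).1)
      rwa [add_sub_cancel_right] at this
    have h5 : ‖(p : H × H)‖ ≤ (1 + (1 + ‖z‖) / |z.im|) * ‖f p‖ := by
      rw [Prod.norm_def]
      have h6 : (1 + (1 + ‖z‖) / |z.im|) * ‖f p‖ =
        ‖f p‖ + ‖f p‖ / |z.im| + ‖z‖ * (‖f p‖ / |z.im|) := by ring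
      rw [h6]
      have h7 : 0 ≤ ‖z‖ * (‖f p‖ / |z.im|) := by positivity
      have h8 : 0 ≤ ‖f p‖ / |z.im| := by positivity
      have h9 := mul_le_mul_of_nonneg_left h3 (norm_nonneg z)
      refine max_le ?_ ?_
      · linarith [norm_nonneg (f p)]
      · linarith
    exact h5
  have : CompleteSpace G := hG.completeSpace_coe
  have h := hf.isClosed_range f.uniformContinuous
  convert h using 1
  ext y
  simp [f, L]

lemma mem_adjoint_graph_iff {T : H →ₗ.[ℂ] H} (hT : Dense (T.domain : Set H)) {u v : H} :
    (u, v) ∈ (LinearPMap.adjoint (𝕜 := ℂ) T).graph ↔ ∀ p ∈ T.graph, ⟪p.2, u⟫ = ⟪p.1, v⟫ := by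
  rw [LinearPMap.adjoint_graph_eq_graph_adjoint hT, Submodule.mem_adjoint_iff]
  simp only [sub_eq_zero, Prod.forall]

/-- The closure of a densely defined symmetric operator such that the ranges of `T ± i` are dense
is self-adjoint. -/
theorem isSelfAdjoint_of_dense_range {G₀ : Submodule ℂ (H × H)}
    (hsym : ∀ p ∈ G₀, ∀ q ∈ G₀, ⟪p.2, q.1⟫ = ⟪p.1, q.2⟫)
    (hdom : Dense (Prod.fst '' (G₀ : Set (H × H))))
    (hplus : Dense {y | ∃ p ∈ G₀, p.2 + Complex.I • p.1 = y})
    (hminus : Dense {y | ∃ p ∈ G₀, p.2 + (-Complex.I) • p.1 = y}) :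
    G₀.topologicalClosure.toLinearPMap.graph = G₀.topologicalClosure ∧
      IsSelfAdjoint G₀.topologicalClosure.toLinearPMap := by
  set G := G₀.topologicalClosure with hGdef
  have hle : G₀ ≤ G := Submodule.le_topologicalClosure _
  have hG : IsClosed (G : Set (H × H)) := Submodule.isClosed_topologicalClosure _
  have hsym' : ∀ p ∈ G, ∀ q ∈ G, ⟪p.2, q.1⟫ = ⟪p.1, q.2⟫ := by
    have h1 : ∀ p ∈ G₀, ∀ q ∈ G, ⟪p.2, q.1⟫ = ⟪p.1, q.2⟫ := by
      intro p hp q hq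
      have hcl : IsClosed {q : H × H | ⟪p.2, q.1⟫ = ⟪p.1, q.2⟫} :=
        isClosed_eq (by fun_prop) (by fun_prop)
      exact closure_minimal (fun q hq => hsym p hp q hq) hcl hq
    intro p hp q hq
    have hcl : IsClosed {p : H × H | ⟪p.2, q.1⟫ = ⟪p.1, q.2⟫} :=
      isClosed_eq (by fun_prop) (by fun_prop)
    exact closure_minimal (fun p hp => h1 p hp q hq) hcl hp
  have hsingle : ∀ x ∈ G, x.1 = 0 → x.2 = 0 := by
    intro x hx hx0
    refine hdom.eq_zero_of_inner_left ℂ ?_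
    rintro _ ⟨p, hp, rfl⟩
    have h := hsym' x hx p (hle hp)
    rw [hx0, inner_zero_left] at h
    exact h
  have hgraph : G.toLinearPMap.graph = G := Submodule.toLinearPMap_graph_eq G hsingle
  -- Maximality: the range of `T + i` on `G` is closed and dense, so some `p ∈ G` has the same image
  -- as `(u, v)`. Then `u - p.1` is orthogonal to the dense range of `T - i`, and both coordinates
  -- agree.
  have hmax : ∀ u v : H, (∀ p ∈ G, ⟪p.2, u⟫ = ⟪p.1, v⟫) → (u, v) ∈ G := by
    intro u v huv
    have hr : {y | ∃ p ∈ G, p.2 + Complex.I • p.1 = y} = Set.univ := by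
      rw [← (isClosed_range_add_smul hG hsym' (z := Complex.I) (by simp)).closure_eq]
      refine (hplus.mono ?_).closure_eq
      rintro _ ⟨p, hp, rfl⟩
      exact ⟨p, hle hp, rfl⟩
    obtain ⟨p, hp, hpe⟩ : v + Complex.I • u ∈ {y | ∃ p ∈ G, p.2 + Complex.I • p.1 = y} := by
      rw [hr]; trivial
    have h2 : v - p.2 = -(Complex.I • (u - p.1)) := by
      rw [smul_sub]
      rw [neg_sub, sub_eq_sub_iff_add_eq_add, ← hpe, add_comm]
    have h1 : u - p.1 = 0 := by
      refine hminus.eq_zero_of_inner_right ℂ ?_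
      rintro _ ⟨q, hq, rfl⟩
      have h3 := huv q (hle hq)
      have h4 := hsym' q (hle hq) p hp
      have h5 : ⟪q.2, u - p.1⟫ = ⟪q.1, v - p.2⟫ := by
        rw [inner_sub_right, inner_sub_right, h3, h4]
      change ⟪_, _⟫ = 0
      rw [inner_add_left, h5, h2, inner_neg_right, inner_smul_right, inner_smul_left]
      simp
    rw [h1, smul_zero, neg_zero] at h2
    rw [sub_eq_zero.1 h1, sub_eq_zero.1 h2]
    exact hp
  refine ⟨hgraph, ?_⟩
  have hdense : Dense (G.toLinearPMap.domain : Set H) := by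
    refine hdom.mono ?_
    rintro _ ⟨p, hp, rfl⟩
    exact LinearPMap.mem_domain_iff.2 ⟨p.2, by rw [hgraph]; exact hle hp⟩
  rw [LinearPMap.isSelfAdjoint_def]
  refine LinearPMap.eq_of_eq_graph ?_
  ext ⟨u, v⟩
  rw [mem_adjoint_graph_iff hdense, hgraph]
  exact ⟨hmax u v, fun h p hp => hsym' p hp _ h⟩

/-! ### Resolvents -/

variable {T : H →ₗ.[ℂ] H}

lemma mem_graph_iff_of_isSelfAdjoint (hT : IsSelfAdjoint T) {u v : H} :
    (u, v) ∈ T.graph ↔ ∀ p ∈ T.graph, ⟪p.2, u⟫ = ⟪p.1, v⟫ := by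
  rw [← mem_adjoint_graph_iff hT.dense_domain, LinearPMap.isSelfAdjoint_def.1 hT]

lemma inner_symm_of_isSelfAdjoint (hT : IsSelfAdjoint T) {u v u' v' : H} (h : (u, v) ∈ T.graph)
    (h' : (u', v') ∈ T.graph) : ⟪v, u'⟫ = ⟪u, v'⟫ :=
  (mem_graph_iff_of_isSelfAdjoint hT).1 h' _ h

lemma im_inner_of_isSelfAdjoint (hT : IsSelfAdjoint T) {u v : H}
    (h : (u, v) ∈ T.graph) : (⟪u, v⟫).im = 0 :=
  im_inner_eq_zero_of_symm (inner_symm_of_isSelfAdjoint hT h h)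

/-- `R` is the resolvent `(T + z)⁻¹`. -/
structure IsResolvent (T : H →ₗ.[ℂ] H) (z : ℂ) (R : H →L[ℂ] H) : Prop where
  mem_graph : ∀ y, (R y, y - z • R y) ∈ T.graph
  apply_eq : ∀ u v, (u, v) ∈ T.graph → R (v + z • u) = u

/-- The range of `T + z` is closed, and a vector orthogonal to it is an eigenvector of `T` for the
non-real number `-conj z`, hence zero. So `T + z` is onto, and the lower bound by `|z.im|` makes the
inverse bounded. -/
lemma exists_isResolvent (hT : IsSelfAdjoint T) {z : ℂ} (hz : z.im ≠ 0) :
    ∃ R : H →L[ℂ] H, IsResolvent T z R := by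
  have hz' : 0 < |z.im| := abs_pos.2 hz
  have hcl := isClosed_range_add_smul (G := T.graph) hT.isClosed
    (fun p hp q hq => inner_symm_of_isSelfAdjoint hT hp hq) hz
  have hsurj : ∀ y : H, ∃ u, (u, y - z • u) ∈ T.graph := by
    let K : Submodule ℂ H :=
      T.graph.map (LinearMap.snd ℂ H H + z • LinearMap.fst ℂ H H)
    have hK : (K : Set H) = {y | ∃ p ∈ T.graph, p.2 + z • p.1 = y} := by
      ext y; simp [K]
    have hKtop : K = ⊤ := by
      have : CompleteSpace K := (hK ▸ hcl : IsClosed (K : Set H)).completeSpace_coe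
      rw [← Submodule.orthogonal_eq_bot_iff, Submodule.eq_bot_iff]
      intro y hy
      have h1 : (y, -(conj z • y)) ∈ T.graph := by
        rw [mem_graph_iff_of_isSelfAdjoint hT]
        intro p hp
        have h2 : ⟪p.2 + z • p.1, y⟫ = 0 :=
          (Submodule.mem_orthogonal _ _).1 hy _ (by
            rw [← SetLike.mem_coe, hK]; exact ⟨p, hp, rfl⟩)
        rw [inner_add_left, inner_smul_left] at h2
        rw [inner_neg_right, inner_smul_right]
        linear_combination h2
      have h3 := abs_im_mul_norm_le (im_inner_of_isSelfAdjoint hT h1) (conj z)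
      rw [neg_add_cancel, norm_zero, Complex.conj_im, abs_neg] at h3
      have h4 : ‖y‖ ≤ 0 := by nlinarith
      exact norm_le_zero_iff.1 h4
    intro y
    have hy : y ∈ (K : Set H) := by rw [hKtop]; trivial
    rw [hK] at hy
    obtain ⟨p, hp, hpy⟩ := hy
    exact ⟨p.1, by rw [← hpy, add_sub_cancel_right]; exact hp⟩
  choose R hR using hsurj
  have huniq : ∀ u v, (u, v) ∈ T.graph → R (v + z • u) = u := by
    intro u v huv
    have h1 := T.graph.sub_mem (hR (v + z • u)) huv
    have h2 := abs_im_mul_norm_le (im_inner_of_isSelfAdjoint hT h1) z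
    have h3 : v + z • u - z • R (v + z • u) - v + z • (R (v + z • u) - u) = 0 := by
      rw [smul_sub]; abel
    rw [h3, norm_zero] at h2
    have h4 : ‖R (v + z • u) - u‖ ≤ 0 := by nlinarith
    exact sub_eq_zero.1 (norm_le_zero_iff.1 h4)
  let R' : H →ₗ[ℂ] H :=
    { toFun := R
      map_add' := fun x y => by
        have h := huniq _ _ (T.graph.add_mem (hR x) (hR y))
        rw [← h]
        congr 1
        dsimp only [Prod.fst_add, Prod.snd_add]
        rw [smul_add]; abel
      map_smul' := fun c x => by
        have h := huniq _ _ (T.graph.smul_mem c (hR x))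
        rw [RingHom.id_apply, ← h]
        congr 1
        dsimp only [Prod.smul_fst, Prod.smul_snd]
        rw [smul_sub, smul_comm c z]; abel }
  refine ⟨R'.mkContinuous |z.im|⁻¹ fun y => ?_, fun y => hR y, huniq⟩
  have h2 := abs_im_mul_norm_le (im_inner_of_isSelfAdjoint hT (hR y)) z
  rw [sub_add_cancel] at h2
  rw [inv_mul_eq_div, le_div_iff₀ hz', mul_comm]
  exact h2

lemma IsResolvent.norm_apply_le (hT : IsSelfAdjoint T) {z : ℂ} {R : H →L[ℂ] H}
    (hR : IsResolvent T z R) (y : H) :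
    |z.im| * ‖R y‖ ≤ ‖y‖ := by
  have h2 := abs_im_mul_norm_le (im_inner_of_isSelfAdjoint hT (hR.mem_graph y)) z
  rwa [sub_add_cancel] at h2

lemma IsResolvent.adjoint (hT : IsSelfAdjoint T) {z : ℂ} (hz : z.im ≠ 0) {R : H →L[ℂ] H}
    (hR : IsResolvent T z R) :
    IsResolvent T (conj z) (ContinuousLinearMap.adjoint R) := by
  obtain ⟨R', hR'⟩ := exists_isResolvent hT (z := conj z) (by simpa using hz)
  suffices h : R' = ContinuousLinearMap.adjoint R from h ▸ hR'
  rw [ContinuousLinearMap.eq_adjoint_iff]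
  intro x y
  have h := inner_symm_of_isSelfAdjoint hT (hR'.mem_graph x) (hR.mem_graph y)
  rw [inner_sub_left, inner_sub_right, inner_smul_left, inner_smul_right, Complex.conj_conj] at h
  change ⟪_, _⟫ = ⟪_, _⟫
  linear_combination -h

/-- `R` maps `H` bijectively onto the domain of `T` with inverse `T + z`, so commuting with the one
bounded operator `R` encodes commuting with the unbounded `T`. -/
lemma IsResolvent.commute_iff {z : ℂ} {R : H →L[ℂ] H} (hR : IsResolvent T z R)
    {A : H →L[ℂ] H} :
    Commute A R ↔ ∀ u v, (u, v) ∈ T.graph → (A u, A v) ∈ T.graph := by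
  constructor
  · intro h u v huv
    have h1 := hR.mem_graph (A (v + z • u))
    have h2 : R (A (v + z • u)) = A u := by
      rw [← mul_apply_eq_comp, ← h.eq, mul_apply_eq_comp, hR.apply_eq u v huv]
    rw [h2] at h1
    simpa using h1
  · intro h
    ext y
    have h1 := hR.apply_eq _ _ (h _ _ (hR.mem_graph y))
    rw [mul_apply_eq_comp, mul_apply_eq_comp, ← h1]
    simp

end SelfAdjoint

/-! ### Spectral projections -/

section SpectralProjection

variable {H : Type*} [NormedAddCommGroup H] [InnerProductSpace ℂ H] [CompleteSpace H]

lemma apply_eq_zero_of_re_inner_eq_zero {A : H →L[ℂ] H} (hA : 0 ≤ A) {y : H}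
    (h : (⟪A y, y⟫).re = 0) : A y = 0 := by
  obtain ⟨b, rfl⟩ := CStarAlgebra.nonneg_iff_eq_star_mul_self.1 hA
  rw [mul_apply_eq_comp, ContinuousLinearMap.star_eq_adjoint] at h ⊢
  have h1 : ⟪ContinuousLinearMap.adjoint b (b y), y⟫ = ⟪b y, b y⟫ :=
    ContinuousLinearMap.adjoint_inner_left b y (b y)
  rw [h1, re_inner_self] at h
  rw [norm_eq_zero.1 (pow_eq_zero_iff two_ne_zero |>.1 h), map_zero]

lemma inner_apply_of_isSelfAdjoint {A : H →L[ℂ] H} (hA : IsSelfAdjoint A) (x y : H) :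
    ⟪A x, y⟫ = ⟪x, A y⟫ := by
  have h := ContinuousLinearMap.adjoint_inner_left A y x
  rwa [← ContinuousLinearMap.star_eq_adjoint, hA.star_eq] at h

lemma norm_sq_add_of_isStarProjection {P : H →L[ℂ] H} (hP : IsStarProjection P) (y : H) :
    ‖y‖ ^ 2 = ‖P y‖ ^ 2 + ‖y - P y‖ ^ 2 := by
  have h1 : ⟪P y, y - P y⟫ = 0 := by
    rw [inner_apply_of_isSelfAdjoint hP.isSelfAdjoint, map_sub, ← mul_apply_eq_comp,
      hP.isIdempotentElem.eq, sub_self, inner_zero_right]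
  have h2 := norm_add_sq_eq_norm_sq_add_norm_sq_of_inner_eq_zero (𝕜 := ℂ) _ _ h1
  rw [add_sub_cancel] at h2
  nlinarith

variable {T : H →ₗ.[ℂ] H}

lemma snd_eq_of_mem_graph {u v v' : H} (h : (u, v) ∈ T.graph) (h' : (u, v') ∈ T.graph) :
    v = v' := T.mem_graph_snd_inj h h' rfl

/-- The bounded self-adjoint operator `S = R + R^*`, `R = (T - t + i)⁻¹`, has the same spectral
projection at `0` as `T` at `t`; it is the projection onto the kernel of the positive part. -/
lemma exists_isSpectralProjection (hT : IsSelfAdjoint T) (t : ℝ) :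
    ∃ P : H →L[ℂ] H, IsSpectralProjection T t P ∧
      ∀ A : H →L[ℂ] H, (∀ u v, (u, v) ∈ T.graph → (A u, A v) ∈ T.graph) → Commute A P := by
  have hz : (Complex.I - t).im ≠ 0 := by simp
  obtain ⟨R, hR⟩ := exists_isResolvent hT hz
  have hR' := hR.adjoint hT hz
  rw [← ContinuousLinearMap.star_eq_adjoint] at hR'
  set S : H →L[ℂ] H := R + star R with hS
  have hSsa : IsSelfAdjoint S := IsSelfAdjoint.add_star_self R
  set K : Submodule ℂ H := LinearMap.ker (S⁺ : H →L[ℂ] H).toLinearMap with hK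
  have hKc : IsClosed (K : Set H) := ContinuousLinearMap.isClosed_ker (S⁺)
  have : CompleteSpace K := hKc.completeSpace_coe
  have hmemK : ∀ x, x ∈ K ↔ S⁺ x = 0 := fun x => LinearMap.mem_ker
  have hcomm : ∀ A : H →L[ℂ] H, (∀ u v, (u, v) ∈ T.graph → (A u, A v) ∈ T.graph) →
      Commute A K.starProjection := by
    intro A hA
    have h1 : Commute A S := (hR.commute_iff.2 hA).add_right (hR'.commute_iff.2 hA)
    have h2 : Commute (star A) S := by
      have := h1.star_star
      rwa [hSsa.star_eq] at this
    -- `S⁺` belongs to the functional calculus of `S`, so whatever commutes with `S` preserves its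
    -- kernel. Using this for both `A` and `star A` makes `K` reducing for `A`.
    have key : ∀ B : H →L[ℂ] H, Commute B S → ∀ x ∈ K, B x ∈ K := by
      intro B hB x hx
      have h3 : Commute (S⁺) B := by
        rw [CFC.posPart_def]
        exact hB.symm.cfcₙ_real _
      rw [hmemK] at hx ⊢
      rw [← mul_apply_eq_comp, h3.eq, mul_apply_eq_comp, hx, map_zero]
    ext y
    rw [mul_apply_eq_comp, mul_apply_eq_comp]
    refine (Submodule.eq_starProjection_of_mem_of_inner_eq_zero
      (key A h1 _ (K.starProjection_apply_mem y)) fun w hw => ?_).symm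
    change ⟪_, _⟫ = 0
    rw [← map_sub]
    have h4 := ContinuousLinearMap.adjoint_inner_right A (y - K.starProjection y) w
    rw [← ContinuousLinearMap.star_eq_adjoint] at h4
    exact h4.symm.trans (K.starProjection_inner_eq_zero y _ (key _ h2 _ hw))
  have hPR : Commute K.starProjection R := by
    refine (hcomm R ?_).symm
    exact hR.commute_iff.1 (Commute.refl R)
  have hred : ∀ u v : H, (u, v) ∈ T.graph →
      (K.starProjection u, K.starProjection v) ∈ T.graph := hR.commute_iff.1 hPR
  -- With `y = (T - t + i) u` one has `R y = u`, and `⟪S y, y⟫` is twice the real part of `⟪u, y⟫`,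
  -- in which the term `i u` disappears. Thus `S` at `y` has the sign of the form of `T - t` at `u`.
  have hform : ∀ u v : H, (u, v) ∈ T.graph →
      (⟪u, v⟫).re = t * ‖u‖ ^ 2 + (⟪S (v + (Complex.I - t) • u),
        v + (Complex.I - t) • u⟫).re / 2 := by
    intro u v huv
    set y := v + (Complex.I - t) • u with hy
    have h1 : R y = u := hR.apply_eq u v huv
    have h2 : ⟪star R y, y⟫ = ⟪y, u⟫ := by
      rw [← h1]; exact ContinuousLinearMap.adjoint_inner_left R y y
    have h3 : (⟪y, u⟫).re = (⟪u, y⟫).re := by rw [← inner_conj_symm]; exact Complex.conj_re _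
    have h4 : ⟪S y, y⟫ = ⟪u, y⟫ + ⟪y, u⟫ := by
      rw [hS, add_apply, inner_add_left, h1, h2]
    have h5 : (⟪u, y⟫).re = (⟪u, v⟫).re - t * ‖u‖ ^ 2 := by
      rw [hy, inner_add_right, inner_smul_right, Complex.add_re, Complex.mul_re, re_inner_self,
        im_inner_self]
      simp; ring
    rw [h4, Complex.add_re, h3, h5]; ring
  have hSd : ∀ y, ⟪S y, y⟫ = ⟪S⁺ y, y⟫ - ⟪S⁻ y, y⟫ := by
    intro y
    rw [← inner_sub_left, ← sub_apply, CFC.posPart_sub_negPart S hSsa]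
  refine ⟨K.starProjection, ⟨isStarProjection_starProjection, hred, ?_, ?_⟩, hcomm⟩
  · intro u v huv hPu
    change (⟪u, v⟫).re ≤ _
    have hPv : K.starProjection v = v := by
      have h := hred u v huv
      rw [hPu] at h
      exact snd_eq_of_mem_graph h huv
    have hy : v + (Complex.I - t) • u ∈ K := by
      rw [← Submodule.starProjection_eq_self_iff, map_add, map_smul, hPu, hPv]
    rw [hmemK] at hy
    rw [hform u v huv, hSd, hy, inner_zero_left, zero_sub, Complex.neg_re]
    have h := ((ContinuousLinearMap.nonneg_iff_isPositive _).1
      (CFC.negPart_nonneg S)).re_inner_nonneg_left (v + (Complex.I - t) • u)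
    change 0 ≤ (⟪_, _⟫).re at h
    linarith
  · intro u v huv hPu hu
    change _ < (⟪u, v⟫).re
    have hPv : K.starProjection v = 0 := by
      have h := hred u v huv
      rw [hPu] at h
      exact snd_eq_of_mem_graph h T.graph.zero_mem
    set y := v + (Complex.I - t) • u with hy
    have hyK : y ∈ Kᗮ := by
      rw [← Submodule.starProjection_apply_eq_zero_iff, hy, map_add, map_smul, hPu, hPv, smul_zero,
        add_zero]
    -- `S⁺ S⁻ = 0` puts `S⁻ (S⁻ y)` into `K`, while `y` is orthogonal to `K`; the inner product of
    -- the two is `‖S⁻ y‖²`.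
    have hSn : S⁻ y = 0 := by
      have h1 : S⁻ (S⁻ y) ∈ K := by
        rw [hmemK, ← mul_apply_eq_comp, CFC.posPart_mul_negPart]; rfl
      have h2 : ⟪S⁻ y, S⁻ y⟫ = ⟪S⁻ (S⁻ y), y⟫ :=
        (inner_apply_of_isSelfAdjoint (CFC.negPart_nonneg S).isSelfAdjoint _ _).symm
      have h3 : ⟪S⁻ (S⁻ y), y⟫ = 0 := (Submodule.mem_orthogonal _ _).1 hyK _ h1
      rw [h3] at h2
      exact inner_self_eq_zero.1 h2
    have hpos := ((ContinuousLinearMap.nonneg_iff_isPositive _).1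
      (CFC.posPart_nonneg S)).re_inner_nonneg_left y
    change 0 ≤ (⟪_, _⟫).re at hpos
    rw [hform u v huv, hSd, hSn, inner_zero_left, sub_zero]
    rcases hpos.lt_or_eq with h | h
    · linarith
    -- Equality would put `y` into `K ∩ Kᗮ`, and then `u = R y = 0`. The strict inequality comes
    -- from the kernel of `S` being assigned to `K`.
    · exfalso
      have h1 := apply_eq_zero_of_re_inner_eq_zero (CFC.posPart_nonneg S) h.symm
      rw [← hmemK] at h1
      have h2 : y = 0 := inner_self_eq_zero.1 ((Submodule.mem_orthogonal _ _).1 hyK _ h1)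
      apply hu
      rw [← hR.apply_eq u v huv, ← hy, h2, map_zero]

/-- A nonzero domain vector in the range of `P (1 - P')` would have its form both at most `t ‖u‖²`,
by `P`, and greater than it, by `P'`. With the roles exchanged, this gives uniqueness of the
spectral projection. -/
lemma IsSpectralProjection.mul_one_sub_eq_zero (hT : IsSelfAdjoint T) {t : ℝ} {P P' : H →L[ℂ] H}
    (hP : IsSpectralProjection T t P) (hP' : IsSpectralProjection T t P') (hc : Commute P P') :
    P * (1 - P') = 0 := by
  obtain ⟨R, hR⟩ := exists_isResolvent hT (z := Complex.I) (by simp)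
  have hA : ∀ u v, (u, v) ∈ T.graph → ((P * (1 - P')) u, (P * (1 - P')) v) ∈ T.graph := by
    intro u v h
    exact hP.reduces _ _ (T.graph.sub_mem h (hP'.reduces u v h))
  have h0 : ∀ u v, (u, v) ∈ T.graph → (P * (1 - P')) u = 0 := by
    intro u v huv
    by_contra hne
    have h := hA u v huv
    have hP1 : P ((P * (1 - P')) u) = (P * (1 - P')) u := by
      rw [← mul_apply_eq_comp, ← mul_assoc, hP.isStarProjection.isIdempotentElem.eq]
    have hP2 : P' ((P * (1 - P')) u) = 0 := by
      rw [← mul_apply_eq_comp, ← mul_assoc, ← hc.eq, mul_assoc, mul_sub, mul_one,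
        hP'.isStarProjection.isIdempotentElem.eq, sub_self, mul_zero]; rfl
    exact absurd (hP'.gt _ _ h hP2 hne) (not_lt.2 (hP.le _ _ h hP1))
  have hd : Dense {u : H | (P * (1 - P')) u = 0} := by
    refine hT.dense_domain.mono fun u hu => ?_
    obtain ⟨v, hv⟩ := LinearPMap.mem_domain_iff.1 hu
    exact h0 u v hv
  have hcl : IsClosed {u : H | (P * (1 - P')) u = 0} := isClosed_eq (by fun_prop) continuous_const
  ext u
  have : u ∈ {u : H | (P * (1 - P')) u = 0} := by
    rw [← hcl.closure_eq, hd.closure_eq]; trivial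
  exact this

/-- A bounded operator that commutes with `T` commutes with the spectral projections of `T`. -/
theorem IsSpectralProjection.commute (hT : IsSelfAdjoint T) {t : ℝ} {P : H →L[ℂ] H}
    (hP : IsSpectralProjection T t P) {A : H →L[ℂ] H}
    (hA : ∀ u v, (u, v) ∈ T.graph → (A u, A v) ∈ T.graph) : Commute A P := by
  obtain ⟨P', hP', hc⟩ := exists_isSpectralProjection hT t
  have h1 : Commute P P' := hc P hP.reduces
  have h2 := hP.mul_one_sub_eq_zero hT hP' h1
  have h3 := hP'.mul_one_sub_eq_zero hT hP h1.symm
  rw [mul_sub, mul_one, sub_eq_zero] at h2 h3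
  have h4 : P = P' := by rw [h2, h1.eq, ← h3]
  exact h4 ▸ hc A hA

/-! ### Operators commuting with all spectral projections -/

/-- On the range of a projection that reduces `T`, the operator norm of `T - c` is bounded by its
numerical radius. -/
lemma norm_sub_smul_le_of_form_le (hT : IsSelfAdjoint T) {E : H →L[ℂ] H} {c δ : ℝ}
    (hEE : E * E = E) (hE : ∀ u v, (u, v) ∈ T.graph → (E u, E v) ∈ T.graph)
    (hform : ∀ u v, (u, v) ∈ T.graph → E u = u → |(⟪u, v - (c : ℂ) • u⟫).re| ≤ δ * ‖u‖ ^ 2)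
    {u v : H} (huv : (u, v) ∈ T.graph) (hu : E u = u) : ‖v - (c : ℂ) • u‖ ≤ δ * ‖u‖ := by
  set w := v - (c : ℂ) • u with hw
  have hv : E v = v := by
    have h := hE u v huv
    rw [hu] at h
    exact snd_eq_of_mem_graph h huv
  have hEw : E w = w := by rw [hw, map_sub, map_smul, hu, hv]
  -- Polarization: the form bound at `E x + u` and at `E x - u`, combined with the parallelogram
  -- law, controls the mixed term. It needs `x` in the domain, but the resulting inequality is
  -- continuous in `x` and so holds everywhere.
  have hdom : ∀ x : H, 2 * (⟪E x, w⟫).re ≤ δ * (‖E x‖ ^ 2 + ‖u‖ ^ 2) := by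
    have hd : Dense {x : H | 2 * (⟪E x, w⟫).re ≤ δ * (‖E x‖ ^ 2 + ‖u‖ ^ 2)} := by
      refine hT.dense_domain.mono fun x hx => ?_
      obtain ⟨x', hx'⟩ := LinearPMap.mem_domain_iff.1 hx
      have h1 := hE x x' hx'
      have hEx : E (E x) = E x := by rw [← mul_apply_eq_comp, hEE]
      have ha := hform _ _ (T.graph.add_mem h1 huv) (by
        dsimp only [Prod.fst_add]; rw [map_add, hEx, hu])
      have hs := hform _ _ (T.graph.sub_mem h1 huv) (by
        dsimp only [Prod.fst_sub]; rw [map_sub, hEx, hu])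
      dsimp only [Prod.fst_add, Prod.snd_add, Prod.fst_sub, Prod.snd_sub] at ha hs
      have h2 : E x' + v - (c : ℂ) • (E x + u) = (E x' - (c : ℂ) • E x) + w := by
        rw [hw, smul_add]; abel
      have h3 : E x' - v - (c : ℂ) • (E x - u) = (E x' - (c : ℂ) • E x) - w := by
        rw [hw, smul_sub]; abel
      rw [h2] at ha
      rw [h3] at hs
      have h4 : (⟪u, E x' - (c : ℂ) • E x⟫).re = (⟪E x, w⟫).re := by
        have h5 := inner_symm_of_isSelfAdjoint hT huv h1
        have h6 : ⟪u, E x' - (c : ℂ) • E x⟫ = ⟪w, E x⟫ := by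
          rw [hw, inner_sub_right, inner_sub_left, inner_smul_right, inner_smul_left, h5]
          simp
        rw [h6, ← inner_conj_symm]; exact Complex.conj_re _
      have h7 := congrArg (δ * ·) (parallelogram_law_with_norm ℂ (E x) u)
      generalize E x' - (c : ℂ) • E x = z at ha hs h4
      clear_value w
      simp only [inner_add_left, inner_add_right, Complex.add_re, h4] at ha
      simp only [inner_sub_left, inner_sub_right, Complex.sub_re, h4] at hs
      have ha' := (abs_le.1 ha).2
      have hs' := (abs_le.1 hs).1
      rw [Set.mem_ofPred_eq]
      linarith
    have hcl : IsClosed {x : H | 2 * (⟪E x, w⟫).re ≤ δ * (‖E x‖ ^ 2 + ‖u‖ ^ 2)} := by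
      refine isClosed_le ?_ (by fun_prop)
      exact continuous_const.mul (Complex.continuous_re.comp (by fun_prop))
    intro x
    have : x ∈ {x : H | 2 * (⟪E x, w⟫).re ≤ δ * (‖E x‖ ^ 2 + ‖u‖ ^ 2)} := by
      rw [← hcl.closure_eq, hd.closure_eq]; trivial
    exact this
  rcases eq_or_ne w 0 with h0 | h0
  · have hδ : 0 ≤ δ * ‖u‖ := by
      rcases eq_or_ne u 0 with hu0 | hu0
      · simp [hu0]
      · have h1 := (abs_nonneg _).trans (hform u v huv hu)
        have h2 : 0 < ‖u‖ := norm_pos_iff.2 hu0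
        by_contra! h3
        nlinarith
    rw [h0, norm_zero]; exact hδ
  · have hw0 : 0 < ‖w‖ := norm_pos_iff.2 h0
    -- The test vector is `w` rescaled to norm `‖u‖`, which balances the two squares. It need not
    -- lie in the domain, which is why `hdom` was extended to all of `H`.
    have h1 := hdom (((‖u‖ / ‖w‖ : ℝ) : ℂ) • w)
    rw [map_smul, hEw, inner_smul_left, norm_smul, Complex.conj_ofReal, Complex.re_ofReal_mul,
      re_inner_self, Complex.norm_real, Real.norm_eq_abs, abs_of_nonneg (by positivity),
      div_mul_cancel₀ _ hw0.ne'] at h1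
    have h2 : ‖u‖ / ‖w‖ * ‖w‖ ^ 2 = ‖u‖ * ‖w‖ := by field_simp
    rw [h2] at h1
    rcases eq_or_ne u 0 with hu0 | hu0
    · exfalso
      have hv0 : v = 0 := by
        have huv' := huv
        rw [hu0] at huv'
        exact T.graph_fst_eq_zero_snd huv' rfl
      apply h0
      rw [hw, hv0, hu0, smul_zero, sub_zero]
    · have h3 : 0 < ‖u‖ := norm_pos_iff.2 hu0
      nlinarith

lemma IsSpectralProjection.commute_isSpectralProjection (hT : IsSelfAdjoint T) {s t : ℝ}
    {P P' : H →L[ℂ] H} (hP : IsSpectralProjection T s P) (hP' : IsSpectralProjection T t P') :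
    Commute P P' := hP'.commute hT hP.reduces

/-- On the range of the spectral projection of `(a, b]`, the resolvent is almost scalar. -/
lemma norm_resolvent_sub_smul_le (hT : IsSelfAdjoint T) {R : H →L[ℂ] H}
    (hR : IsResolvent T Complex.I R) {a b : ℝ} {Pa Pb : H →L[ℂ] H}
    (ha : IsSpectralProjection T a Pa) (hb : IsSpectralProjection T b Pb) {w : H}
    (hwa : Pa w = 0) (hwb : Pb w = w) :
    ‖R w - ((((a + b) / 2 : ℝ) : ℂ) + Complex.I)⁻¹ • w‖ ≤ (b - a) / 2 * ‖w‖ := by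
  set c : ℝ := (a + b) / 2 with hc
  set δ : ℝ := (b - a) / 2 with hδ
  have hcomm : Commute Pb Pa := hb.commute_isSpectralProjection hT ha
  have hEE : (Pb * (1 - Pa)) * (Pb * (1 - Pa)) = Pb * (1 - Pa) := by
    have h1 : Commute (1 - Pa) Pb := (Commute.one_left Pb).sub_left hcomm.symm
    rw [mul_assoc, ← mul_assoc (1 - Pa), h1.eq, mul_assoc Pb (1 - Pa), ← mul_assoc Pb Pb,
      hb.isStarProjection.isIdempotentElem.eq,
      ha.isStarProjection.isIdempotentElem.one_sub.eq]
  have hE : ∀ u v, (u, v) ∈ T.graph → ((Pb * (1 - Pa)) u, (Pb * (1 - Pa)) v) ∈ T.graph :=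
    fun u v h => hb.reduces _ _ (T.graph.sub_mem h (ha.reduces u v h))
  have hform : ∀ u v, (u, v) ∈ T.graph → (Pb * (1 - Pa)) u = u →
      |(⟪u, v - (c : ℂ) • u⟫).re| ≤ δ * ‖u‖ ^ 2 := by
    intro u v huv hu
    have h1 : Pb u = u := by
      rw [← hu, ← mul_apply_eq_comp, ← mul_assoc, hb.isStarProjection.isIdempotentElem.eq]
    have h2 : Pa u = 0 := by
      rw [← hu, ← mul_apply_eq_comp, ← mul_assoc, ← hcomm.eq, mul_assoc, mul_sub, mul_one,
        ha.isStarProjection.isIdempotentElem.eq, sub_self, mul_zero]; rfl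
    have h3 : (⟪u, v⟫).re ≤ b * ‖u‖ ^ 2 := hb.le u v huv h1
    have h4 : a * ‖u‖ ^ 2 ≤ (⟪u, v⟫).re := by
      rcases eq_or_ne u 0 with hu0 | hu0
      · simp [hu0]
      · exact (ha.gt u v huv h2 hu0).le
    have h5 : (⟪u, v - (c : ℂ) • u⟫).re = (⟪u, v⟫).re - c * ‖u‖ ^ 2 := by
      rw [inner_sub_right, inner_smul_right, Complex.sub_re, Complex.re_ofReal_mul, re_inner_self]
    rw [h5, abs_le]
    constructor <;> · rw [hc, hδ]; linarith
  have hEw : (Pb * (1 - Pa)) w = w := by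
    rw [mul_apply_eq_comp, sub_apply, one_apply_eq_self, hwa, sub_zero, hwb]
  have hER : Commute (Pb * (1 - Pa)) R := hR.commute_iff.2 hE
  have hERw : (Pb * (1 - Pa)) (R w) = R w := by
    rw [← mul_apply_eq_comp, hER.eq, mul_apply_eq_comp, hEw]
  have h1 := norm_sub_smul_le_of_form_le hT hEE hE hform (hR.mem_graph w) hERw
  have h2 := hR.norm_apply_le hT w
  rw [Complex.I_im, abs_one, one_mul] at h2
  have hne : (c : ℂ) + Complex.I ≠ 0 := fun h => by
    have := congrArg Complex.im h
    simp at this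
  -- Since `w = (T + i) R w`, the difference is `-(c + i)⁻¹ (T - c) R w`. Here `T - c` is small on
  -- the slice and `|c + i| ≥ 1`.
  have h3 : R w - ((c : ℂ) + Complex.I)⁻¹ • w =
      (-((c : ℂ) + Complex.I)⁻¹) • (w - Complex.I • R w - (c : ℂ) • R w) := by
    have h4 : w - Complex.I • R w - (c : ℂ) • R w = w - ((c : ℂ) + Complex.I) • R w := by
      rw [add_smul]; abel
    rw [h4, smul_sub, smul_smul, neg_mul, inv_mul_cancel₀ hne]
    simp only [neg_smul, one_smul]; abel
  have h5 : ‖(-((c : ℂ) + Complex.I)⁻¹)‖ ≤ 1 := by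
    rw [norm_neg, norm_inv]
    refine inv_le_one_of_one_le₀ ?_
    have := Complex.abs_im_le_norm ((c : ℂ) + Complex.I)
    simpa using this
  have hδ0 : 0 ≤ δ * ‖w‖ := by
    rcases eq_or_ne w 0 with h0 | h0
    · simp [h0]
    · have hu0 : R w ≠ 0 := fun h => h0 (by
        have h6 := hR.mem_graph w
        rw [h, smul_zero, sub_zero] at h6
        exact T.graph_fst_eq_zero_snd h6 rfl)
      have h6 := (norm_nonneg _).trans h1
      have h7 : 0 < ‖R w‖ := norm_pos_iff.2 hu0
      have h8 : 0 ≤ δ := by by_contra! h; nlinarith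
      positivity
  rw [h3, norm_smul]
  refine (mul_le_of_le_one_left (norm_nonneg _) h5).trans (h1.trans ?_)
  rcases eq_or_ne w 0 with h0 | h0
  · simp [h0]
  · have h7 : 0 < ‖w‖ := norm_pos_iff.2 h0
    have h8 : 0 ≤ δ := by by_contra! h; nlinarith
    exact mul_le_mul_of_nonneg_left h2 h8

/-- For `u = R w` the vector `w - i u` is `T u`, and `i u` does not contribute to the real part. So
the resolvent is of size at most `M⁻¹` where the form of `T` is at least `M` in absolute value. -/
lemma norm_le_of_le_re_inner {M : ℝ} (hM : 0 < M) {u w : H}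
    (h : M * ‖u‖ ^ 2 ≤ |(⟪u, w - Complex.I • u⟫).re|) : ‖u‖ ≤ M⁻¹ * ‖w‖ := by
  have h1 : (⟪u, w - Complex.I • u⟫).re = (⟪u, w⟫).re := by
    rw [inner_sub_right, inner_smul_right, Complex.sub_re, Complex.mul_re, im_inner_self]
    simp
  rw [h1] at h
  have h2 := (Complex.abs_re_le_norm _).trans (norm_inner_le_norm (𝕜 := ℂ) u w)
  rw [inv_mul_eq_div, le_div_iff₀ hM]
  rcases eq_or_ne u 0 with h0 | h0
  · simp [h0]
  · have h3 : 0 < ‖u‖ := norm_pos_iff.2 h0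
    by_contra! h4
    nlinarith

/-- A bounded operator that commutes with all spectral projections of `T` commutes with `T`. -/
theorem mem_graph_of_commute_spectralProjections (hT : IsSelfAdjoint T) {A : H →L[ℂ] H}
    (hA : ∀ (t : ℝ) (P : H →L[ℂ] H), IsSpectralProjection T t P → Commute A P) :
    ∀ u v, (u, v) ∈ T.graph → (A u, A v) ∈ T.graph := by
  obtain ⟨R, hR⟩ := exists_isResolvent hT (z := Complex.I) (by simp)
  choose P hP _ using exists_isSpectralProjection hT
  have hAP : ∀ t, Commute A (P t) := fun t => hA t _ (hP t)
  have hPR : ∀ t, Commute (P t) R := fun t => hR.commute_iff.2 (hP t).reduces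
  have hPP : ∀ s t, Commute (P s) (P t) := fun s t =>
    (hP s).commute_isSpectralProjection hT (hP t)
  rw [← hR.commute_iff]
  -- The aim is `D = 0`. Since `D` commutes with every `P t`, it can be estimated separately on
  -- orthogonal spectral slices; where `R` is within `ε` of a scalar, the commutator is at most `2
  -- ‖A‖ ε`.
  set D : H →L[ℂ] H := A * R - R * A with hD
  have hPD : ∀ t, Commute (P t) D := fun t =>
    ((hAP t).symm.mul_right (hPR t)).sub_right ((hPR t).mul_right (hAP t).symm)
  have hscalar : ∀ {ε : ℝ} {r : ℂ} {y : H}, ‖R y - r • y‖ ≤ ε * ‖y‖ →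
      ‖R (A y) - r • A y‖ ≤ ε * ‖A y‖ → 0 ≤ ε → ‖D y‖ ≤ 2 * ‖A‖ * ε * ‖y‖ := by
    intro ε r y h1 h2 hε
    have h3 : D y = A (R y - r • y) - (R (A y) - r • A y) := by
      rw [hD, sub_apply, mul_apply_eq_comp, mul_apply_eq_comp, map_sub, map_smul]; abel
    have h4 := A.le_opNorm (R y - r • y)
    have h5 := A.le_opNorm y
    have h6 := norm_sub_le (A (R y - r • y)) (R (A y) - r • A y)
    rw [h3]
    have h7 := mul_le_mul_of_nonneg_left h1 (norm_nonneg A)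
    have h8 := mul_le_mul_of_nonneg_left h5 hε
    linarith
  have hcommA : ∀ {t : ℝ} {y : H}, P t y = y → P t (A y) = A y := fun {t y} h => by
    rw [← mul_apply_eq_comp, ← (hAP t).eq, mul_apply_eq_comp, h]
  have hcommA0 : ∀ {t : ℝ} {y : H}, P t y = 0 → P t (A y) = 0 := fun {t y} h => by
    rw [← mul_apply_eq_comp, ← (hAP t).eq, mul_apply_eq_comp, h, map_zero]
  have hcommR : ∀ {t : ℝ} {y : H}, P t y = y → P t (R y) = R y := fun {t y} h => by
    rw [← mul_apply_eq_comp, (hPR t).eq, mul_apply_eq_comp, h]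
  have hcommR0 : ∀ {t : ℝ} {y : H}, P t y = 0 → P t (R y) = 0 := fun {t y} h => by
    rw [← mul_apply_eq_comp, (hPR t).eq, mul_apply_eq_comp, h, map_zero]
  have hidem : ∀ t y, P t (P t y) = P t y := fun t y => by
    rw [← mul_apply_eq_comp, (hP t).isStarProjection.isIdempotentElem.eq]
  have hlow : ∀ {M : ℝ} {y : H}, 0 < M → P (-M) y = y → ‖R y‖ ≤ M⁻¹ * ‖y‖ := by
    intro M y hM hy
    refine norm_le_of_le_re_inner hM ?_
    have h1 : (⟪R y, y - Complex.I • R y⟫).re ≤ -M * ‖R y‖ ^ 2 :=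
      (hP (-M)).le _ _ (hR.mem_graph y) (hcommR hy)
    have h2 := neg_abs_le (⟪R y, y - Complex.I • R y⟫).re
    linarith
  have hhigh : ∀ {M : ℝ} {y : H}, 0 < M → P M y = 0 → ‖R y‖ ≤ M⁻¹ * ‖y‖ := by
    intro M y hM hy
    refine norm_le_of_le_re_inner hM ?_
    rcases eq_or_ne (R y) 0 with h0 | h0
    · simp [h0]
    · have h1 : M * ‖R y‖ ^ 2 < (⟪R y, y - Complex.I • R y⟫).re :=
        (hP M).gt _ _ (hR.mem_graph y) (hcommR0 hy) h0
      exact h1.le.trans (le_abs_self _)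
  have hsplit : ∀ {t C : ℝ} {y : H}, 0 ≤ C → ‖D (P t y)‖ ≤ C * ‖P t y‖ →
      ‖D (y - P t y)‖ ≤ C * ‖y - P t y‖ → ‖D y‖ ≤ C * ‖y‖ := by
    intro t C y hC h1 h2
    have h3 := norm_sq_add_of_isStarProjection (hP t).isStarProjection y
    have h4 := norm_sq_add_of_isStarProjection (hP t).isStarProjection (D y)
    rw [← mul_apply_eq_comp (P t) D, (hPD t).eq, mul_apply_eq_comp, ← map_sub] at h4
    have h5 := pow_le_pow_left₀ (norm_nonneg _) h1 2
    have h6 := pow_le_pow_left₀ (norm_nonneg _) h2 2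
    refine (sq_le_sq₀ (norm_nonneg _) (by positivity)).1 ?_
    rw [mul_pow] at h5 h6 ⊢
    rw [h4, h3]
    linarith
  have hbound : ∀ n : ℕ, 0 < n → ∀ y, ‖D y‖ ≤ 2 * ‖A‖ * (n : ℝ)⁻¹ * ‖y‖ := by
    intro n hn
    have hn' : (0 : ℝ) < n := Nat.cast_pos.2 hn
    set ε : ℝ := (n : ℝ)⁻¹ with hε
    have hε0 : 0 < ε := inv_pos.2 hn'
    have hC : 0 ≤ 2 * ‖A‖ * ε := by positivity
    -- Slices of width `1 / n` are peeled off downwards from `n`. The start is the part above `n`,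
    -- where `R` is close to `0`. After `2 n ²` steps the level `-n` is reached, and only the part
    -- below `-n` is left.
    have hsteps : ∀ k : ℕ, ∀ y, P ((n : ℝ) - k * ε) y = 0 → ‖D y‖ ≤ 2 * ‖A‖ * ε * ‖y‖ := by
      intro k
      induction k with
      | zero =>
        intro y hy
        rw [Nat.cast_zero, zero_mul, sub_zero] at hy
        refine hscalar (r := 0) ?_ ?_ hε0.le
        · rw [zero_smul, sub_zero]; exact hhigh hn' hy
        · rw [zero_smul, sub_zero]; exact hhigh hn' (hcommA0 hy)
      | succ k ih =>
        intro y hy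
        set a : ℝ := (n : ℝ) - (k + 1 : ℕ) * ε with ha
        set b : ℝ := (n : ℝ) - k * ε with hb
        have hba : (b - a) / 2 ≤ ε := by
          rw [ha, hb]; push_cast; linarith
        have hy1 : P a (P b y) = 0 := by
          rw [← mul_apply_eq_comp, (hPP a b).eq, mul_apply_eq_comp, hy, map_zero]
        refine hsplit (t := b) hC ?_ (ih _ (by rw [map_sub, hidem, sub_self]))
        refine hscalar (r := ((((a + b) / 2 : ℝ) : ℂ) + Complex.I)⁻¹) ?_ ?_ hε0.le
        · exact (norm_resolvent_sub_smul_le hT hR (hP a) (hP b) hy1 (hidem b y)).trans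
            (mul_le_mul_of_nonneg_right hba (norm_nonneg _))
        · exact (norm_resolvent_sub_smul_le hT hR (hP a) (hP b) (hcommA0 hy1)
            (hcommA (hidem b y))).trans (mul_le_mul_of_nonneg_right hba (norm_nonneg _))
    intro y
    refine hsplit (t := -(n : ℝ)) hC ?_ ?_
    · refine hscalar (r := 0) ?_ ?_ hε0.le
      · rw [zero_smul, sub_zero]; exact hlow hn' (hidem _ y)
      · rw [zero_smul, sub_zero]; exact hlow hn' (hcommA (hidem _ y))
    · refine hsteps (2 * n * n) _ ?_
      have h1 : (n : ℝ) - ((2 * n * n : ℕ) : ℝ) * ε = -n := by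
        rw [hε]; push_cast; field_simp; ring
      rw [h1, map_sub, hidem, sub_self]
  have hD0 : D = 0 := by
    ext y
    refine norm_le_zero_iff.1 (ge_of_tendsto (x := Filter.atTop)
      (f := fun n : ℕ => 2 * ‖A‖ * (n : ℝ)⁻¹ * ‖y‖) ?_ ?_)
    · have h := (tendsto_inv_atTop_nhds_zero_nat (𝕜 := ℝ)).const_mul (2 * ‖A‖)
      simpa using h.mul_const ‖y‖
    · filter_upwards [Filter.eventually_gt_atTop 0] with n hn using hbound n hn y
  exact sub_eq_zero.1 hD0

/-- A closed subspace that is invariant under the resolvents `(T ± i)⁻¹` reduces `T`. -/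
lemma starProjection_mem_graph_of_invariant (hT : IsSelfAdjoint T) {K : Submodule ℂ H}
    [K.HasOrthogonalProjection] {R R' : H →L[ℂ] H} (hR : IsResolvent T Complex.I R)
    (hR' : IsResolvent T (-Complex.I) R') (h : ∀ x ∈ K, R x ∈ K) (h' : ∀ x ∈ K, R' x ∈ K)
    {u v : H} (huv : (u, v) ∈ T.graph) : (K.starProjection u, K.starProjection v) ∈ T.graph := by
  refine hR.commute_iff.1 ?_ u v huv
  ext y
  rw [mul_apply_eq_comp, mul_apply_eq_comp]
  refine Submodule.eq_starProjection_of_mem_of_inner_eq_zero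
    (h _ (K.starProjection_apply_mem y)) fun w hw => ?_
  change ⟪_, _⟫ = 0
  rw [← map_sub]
  have h1 := hR.adjoint hT (by simp)
  have h2 : ContinuousLinearMap.adjoint R = R' := by
    rw [Complex.conj_I] at h1
    ext x
    have := h1.apply_eq _ _ (hR'.mem_graph x)
    rwa [sub_add_cancel] at this
  have h4 := ContinuousLinearMap.adjoint_inner_right R (y - K.starProjection y) w
  rw [h2] at h4
  exact h4.symm.trans (K.starProjection_inner_eq_zero y _ (h' _ hw))

end SpectralProjection

/-! ### The generators are self-adjoint -/

section Generator

open Filter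

variable {N : ℕ} {U : Ultrafilter ℕ} {e : SpinIndexInf N → SpinIndexInf N → ℝ}

lemma gen_mem_spinAlgebra (m : ℕ) (j : Fin N) (k : Fin m) : gen e m j k ∈ spinAlgebra e m :=
  StarAlgebra.subset_adjoin ℂ _ ⟨(j, k), rfl⟩

lemma conjTranspose_gen (m : ℕ) (j : Fin N) (k : Fin m) : (gen e m j k)ᴴ = gen e m j k :=
  conjTranspose_spinMatrix _

lemma genSeq_mem_spinAlgebra (j : Fin N) (m : ℕ) : genSeq e j m ∈ spinAlgebra e m :=
  (spinAlgebra e m).smul_mem (sum_mem fun k _ => gen_mem_spinAlgebra m j k) _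

lemma conjTranspose_genSeq (j : Fin N) (m : ℕ) : (genSeq e j m)ᴴ = genSeq e j m := by
  rw [genSeq, Matrix.conjTranspose_smul, Matrix.conjTranspose_sum]
  simp only [conjTranspose_gen]
  congr 1
  rw [Complex.star_def, map_inv₀, Complex.conj_ofReal]

lemma nip_genSeq_mul (j : Fin N) (m : ℕ) (A B : SpinMat N m) :
    nip (genSeq e j m * A) B = nip A (genSeq e j m * B) := by
  rw [nip_mul_left, conjTranspose_genSeq]

lemma isBddSeq_shiftInv_genSeq (j : Fin N) {t : ℝ} (ht : t ≠ 0) :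
    IsBddSeq e fun m => shiftInv (genSeq e j m) t :=
  ⟨fun m => shiftInv_mem _ (conjTranspose_genSeq j m) (genSeq_mem_spinAlgebra j m) ht, |t|⁻¹,
    fun m => opNorm_shiftInv_le (conjTranspose_genSeq j m) ht⟩

lemma mem_span_leftMulGraph {j : Fin N} {p : L2A U e × L2A U e} :
    p ∈ Submodule.span ℂ (leftMulGraph U e j) ↔ p ∈ leftMulGraph U e j := by
  refine ⟨fun hp => ?_, fun hp => Submodule.subset_span hp⟩
  refine Submodule.span_induction (p := fun p _ => p ∈ leftMulGraph U e j) (fun x hx => hx)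
    ?_ ?_ ?_ hp
  · refine ⟨fun _ => 0, by simpa using IsBddSeq.one.smul (e := e) 0, Represents.zero, ?_⟩
    simpa using Represents.zero
  · rintro p q _ _ ⟨a, ha, h1, h2⟩ ⟨b, hb, h3, h4⟩
    refine ⟨_, ha.add hb, h1.add h3, ?_⟩
    simp only [mul_add]
    exact h2.add h4
  · rintro c p _ ⟨a, ha, h1, h2⟩
    refine ⟨_, ha.smul c, h1.smul c, ?_⟩
    simp only [Matrix.mul_smul]
    exact h2.smul c

lemma Represents.inner_genSeq_mul {j : Fin N} {y z : ∀ m : ℕ, SpinMat N m} {ξ ξ' η η' : L2A U e}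
    (h1 : Represents U y ξ) (h2 : Represents U (fun m => genSeq e j m * y m) η)
    (h3 : Represents U z ξ') (h4 : Represents U (fun m => genSeq e j m * z m) η') :
    ⟪η, ξ'⟫ = ⟪ξ, η'⟫ := by
  refine tendsto_nhds_unique (h2.tendsto h3) ((h1.tendsto h4).congr fun m => ?_)
  exact (nip_genSeq_mul j m _ _).symm

lemma generator_isSelfAdjoint {j : Fin N} (hg : ∃ ξ : L2A U e, Represents U (genSeq e j) ξ) :
    (generator U e j).graph = generatorGraph U e j ∧ IsSelfAdjoint (generator U e j) := by
  -- For a bounded sequence `b`, the sequence `(g + i t)⁻¹ b` is again bounded in norm and in the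
  -- spin algebras. Hence every vector represented by a bounded sequence lies in the range, and
  -- these vectors are dense.
  have hrange : ∀ t : ℝ, t ≠ 0 → Dense {y : L2A U e | ∃ p ∈ Submodule.span ℂ (leftMulGraph U e j),
      p.2 + (t * Complex.I : ℂ) • p.1 = y} := by
    intro t ht
    rw [Metric.dense_iff]
    intro ξ ε hε
    obtain ⟨b, η, hb, hη, hlt⟩ := exists_isBddSeq_norm_sub_lt ξ hε
    refine ⟨η, by rwa [Metric.mem_ball', dist_eq_norm], ?_⟩
    have ha := (isBddSeq_shiftInv_genSeq (e := e) j ht).mul hb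
    obtain ⟨ζ, hζ⟩ := ha.exists_represents (U := U)
    refine ⟨(ζ, η - (t * Complex.I : ℂ) • ζ), ?_, by simp⟩
    refine mem_span_leftMulGraph.2 ⟨_, ha, hζ, ?_⟩
    have h1 := hη.sub (hζ.smul (t * Complex.I : ℂ))
    convert h1 using 2 with m
    have h2 := congrArg (· * b m) (mul_shiftInv (conjTranspose_genSeq (e := e) j m) ht)
    simp only [add_mul, one_mul, Matrix.smul_mul, mul_assoc] at h2
    exact eq_sub_of_add_eq h2
  refine isSelfAdjoint_of_dense_range ?_ ?_ ?_ ?_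
  · intro p hp q hq
    obtain ⟨a, -, h1, h2⟩ := mem_span_leftMulGraph.1 hp
    obtain ⟨b, -, h3, h4⟩ := mem_span_leftMulGraph.1 hq
    exact h1.inner_genSeq_mul h2 h3 h4
  · rw [Metric.dense_iff]
    intro ξ ε hε
    obtain ⟨b, η, hb, hη, hlt⟩ := exists_isBddSeq_norm_sub_lt ξ hε
    obtain ⟨ζ, hζ⟩ := hg
    obtain ⟨θ, hθ⟩ := hζ.mul_right hb
    exact ⟨η, by rwa [Metric.mem_ball', dist_eq_norm], (η, θ),
      mem_span_leftMulGraph.2 ⟨b, hb, hη, hθ⟩, rfl⟩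
  · simpa using hrange 1 one_ne_zero
  · simpa using hrange (-1) (by norm_num)

/-- By self-adjointness it suffices to test against the core of bounded sequences, where symmetry
holds already for matrices. So `y` need not be bounded in operator norm, as is needed for Wick
words. -/
lemma mem_generator_graph {j : Fin N} (hg : ∃ ξ : L2A U e, Represents U (genSeq e j) ξ)
    {y : ∀ m : ℕ, SpinMat N m} {ξ η : L2A U e} (h1 : Represents U y ξ)
    (h2 : Represents U (fun m => genSeq e j m * y m) η) : (ξ, η) ∈ (generator U e j).graph := by
  obtain ⟨hgr, hsa⟩ := generator_isSelfAdjoint hg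
  rw [mem_graph_iff_of_isSelfAdjoint hsa, hgr]
  have hcl : IsClosed {p : L2A U e × L2A U e | ⟪p.2, ξ⟫ = ⟪p.1, η⟫} :=
    isClosed_eq (by fun_prop) (by fun_prop)
  intro p hp
  refine closure_minimal (fun p hp => ?_) hcl hp
  obtain ⟨a, -, h3, h4⟩ := mem_span_leftMulGraph.1 hp
  exact h3.inner_genSeq_mul h4 h1 h2

/-- Left multiplication by `x_j` of a vector, provided that the result stays bounded after another
multiplication by `x_j`. -/
lemma Represents.genSeq_mul {j : Fin N} {y : ∀ m : ℕ, SpinMat N m} {ξ : L2A U e}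
    (hy : Represents U y ξ) (h1 : (fun m => genSeq e j m * y m) ∈ L2Seq e)
    (h2 : (fun m => genSeq e j m * (genSeq e j m * y m)) ∈ L2Seq e) :
    ∃ η : L2A U e, Represents U (fun m => genSeq e j m * y m) η := by
  obtain ⟨-, C, hC⟩ := h2
  refine exists_represents_of_approx h1 fun ε hε => ?_
  have hC' : 0 ≤ C := (nip_self_nonneg _).trans (hC 0)
  -- The squared cutoff error below is at most `t⁻¹ ^ 2 * C`, where `C` bounds the squared `L₂` norm
  -- of `g (g y)`.
  obtain ⟨t, ht, htC⟩ : ∃ t : ℝ, 0 < t ∧ t⁻¹ ^ 2 * C ≤ ε := by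
    refine ⟨Real.sqrt ((C + 1) / ε), by positivity, ?_⟩
    rw [inv_pow, Real.sq_sqrt (by positivity), inv_div, div_mul_eq_mul_div,
      div_le_iff₀ (by positivity)]
    nlinarith
  have hb := isBddSeq_shiftInv_genSeq (e := e) j ht.ne'
  -- The approximant of `g y` is `i t (y - i t (g + i t)⁻¹ y)`, which represents a vector because
  -- the resolvent is bounded. The error is exactly `(g + i t)⁻¹ g (g y)`, which is what `key`
  -- states.
  obtain ⟨η, hη⟩ := (hy.sub ((hy.mul_left hb).choose_spec.smul (t * Complex.I : ℂ)))
    |>.smul (t * Complex.I : ℂ) |> fun h => (⟨_, h⟩ : ∃ η : L2A U e, Represents U _ η)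
  refine ⟨_, η, hη, Eventually.of_forall fun m => ?_⟩
  set g := genSeq e j m with hg
  have hgh : gᴴ = g := conjTranspose_genSeq j m
  have h3 := shiftInv_mul hgh ht.ne'
  have key : g * y m - (t * Complex.I : ℂ) • (y m - (t * Complex.I : ℂ) • (shiftInv g t * y m)) =
      shiftInv g t * (g * (g * y m)) := by
    set r := shiftInv g t
    set c : ℂ := t * Complex.I
    have h4 : r * g = 1 - c • r := by
      rw [mul_add, Matrix.mul_smul, mul_one] at h3
      exact eq_sub_of_add_eq h3
    have h5 : r * (g * (g * y m)) = (r * g) * (g * y m) := by simp only [mul_assoc]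
    have h6 : r * (g * y m) = (r * g) * y m := by simp only [mul_assoc]
    rw [h5, h4, sub_mul, one_mul, Matrix.smul_mul, h6, h4, sub_mul, one_mul, Matrix.smul_mul]
  rw [key]
  have h7 := nip_mul_left_self_le (shiftInv g t) (g * (g * y m))
  have h8 := pow_le_pow_left₀ (opNorm_nonneg _) (opNorm_shiftInv_le hgh ht.ne') 2
  rw [abs_of_pos ht] at h8
  refine h7.trans (le_trans ?_ htC)
  exact mul_le_mul h8 (hC m) (nip_self_nonneg _) (by positivity)

end Generator

/-! ### The law of large numbers for products of signs -/

section Probability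

open MeasureTheory ProbabilityTheory Filter

variable {Ω : Type*} [MeasurableSpace Ω] {P : Measure Ω} [IsProbabilityMeasure P]

lemma mem_Icc_prod_of_mem_Icc {α : Type*} (s : Finset α) (f : α → ℝ)
    (hf : ∀ a, f a ∈ Set.Icc (-1 : ℝ) 1) : ∏ a ∈ s, f a ∈ Set.Icc (-1 : ℝ) 1 := by
  rw [Set.mem_Icc, ← abs_le, Finset.abs_prod]
  exact Finset.prod_le_one (fun _ _ => abs_nonneg _) fun a _ => abs_le.2 (hf a)

/-! ### Concentration for products over disjoint blocks of independent variables. -/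

section Blocks

variable {E I : Type*} {n : ℕ} {Y : E → Ω → ℝ} {edge : Fin n → I → E} {A : Finset (Fin n)}

lemma integral_prod_block (hY : iIndepFun Y P) (hm : ∀ a, Measurable (Y a))
    (hinj : ∀ r r' i i', edge r i = edge r' i' → r = r' ∧ i = i') (i : I) :
    ∫ ω, ∏ r ∈ A, Y (edge r i) ω ∂P = ∏ r ∈ A, ∫ ω, Y (edge r i) ω ∂P := by
  have h := hY.precomp (g := fun r : A => edge r i) fun r r' h => Subtype.ext (hinj _ _ _ _ h).1
  have h2 := h.integral_fun_prod_eq_prod_integral fun r => (hm _).aestronglyMeasurable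
  simp only [← Finset.prod_coe_sort A]
  exact h2

/-- Sums of centered products over disjoint blocks of independent variables are sub-Gaussian. -/
lemma hasSubgaussianMGF_sum_block [DecidableEq I] (hY : iIndepFun Y P)
    (hm : ∀ a, Measurable (Y a))
    (hb : ∀ a ω, Y a ω ∈ Set.Icc (-1 : ℝ) 1)
    (hinj : ∀ r r' i i', edge r i = edge r' i' → r = r' ∧ i = i') (s : Finset I) :
    HasSubgaussianMGF (fun ω => ∑ i ∈ s, (∏ r ∈ A, Y (edge r i) ω -
      ∫ ω, ∏ r ∈ A, Y (edge r i) ω ∂P)) s.card P := by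
  classical
  induction s using Finset.induction_on with
  | empty => simp
  | insert i s hi ih =>
    simp only [Finset.sum_insert hi]
    rw [Finset.card_insert_of_notMem hi, Nat.cast_add, Nat.cast_one, add_comm]
    refine HasSubgaussianMGF.add_of_indepFun ?_ ih ?_
    · have h := hasSubgaussianMGF_of_mem_Icc (μ := P) (X := fun ω => ∏ r ∈ A, Y (edge r i) ω)
        (a := -1) (b := 1) (by fun_prop)
        (Eventually.of_forall fun ω => mem_Icc_prod_of_mem_Icc A _ fun r => hb _ ω)
      convert h
      norm_num
    -- The new block uses the variables in `S`, the old sum those in `S'`. Injectivity of `edge`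
    -- makes these sets disjoint, so the two are functions of independent families.
    · let S : Finset E := A.image fun r => edge r i
      let S' : Finset E := s.biUnion fun i => A.image fun r => edge r i
      have hd : Disjoint S S' := by
        rw [Finset.disjoint_left]
        intro a ha ha'
        obtain ⟨r, -, rfl⟩ := Finset.mem_image.1 ha
        obtain ⟨i', hi', h2⟩ := Finset.mem_biUnion.1 ha'
        obtain ⟨r', -, h3⟩ := Finset.mem_image.1 h2
        exact hi ((hinj _ _ _ _ h3).2 ▸ hi')
      have h := hY.indepFun_finset S S' hd hm
      have hmem : ∀ r : A, edge r i ∈ S := fun r => Finset.mem_image_of_mem _ r.2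
      have hmem' : ∀ (i' : s) (r : A), edge r i' ∈ S' := fun i' r =>
        Finset.mem_biUnion.2 ⟨i', i'.2, Finset.mem_image_of_mem _ r.2⟩
      let φ : (S → ℝ) → ℝ := fun g => ∏ r : A, g ⟨_, hmem r⟩ -
        ∫ ω, ∏ r ∈ A, Y (edge r i) ω ∂P
      let ψ : (S' → ℝ) → ℝ := fun g => ∑ i' : s, (∏ r : A, g ⟨_, hmem' i' r⟩ -
        ∫ ω, ∏ r ∈ A, Y (edge r i') ω ∂P)
      have h2 := h.comp (φ := φ) (ψ := ψ) (by fun_prop) (by fun_prop)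
      convert h2 using 1
      · ext ω
        simp only [φ, Function.comp_apply]
        rw [Finset.prod_coe_sort A fun r => Y (edge r i) ω]
      · ext ω
        simp only [ψ, Function.comp_apply]
        rw [← Finset.sum_coe_sort s]
        refine Finset.sum_congr rfl fun i' _ => ?_
        rw [Finset.prod_coe_sort A fun r => Y (edge r i') ω]

lemma measure_abs_sum_block_ge_le [Fintype I] (hY : iIndepFun Y P)
    (hm : ∀ a, Measurable (Y a))
    (hb : ∀ a ω, Y a ω ∈ Set.Icc (-1 : ℝ) 1)
    (hinj : ∀ r r' i i', edge r i = edge r' i' → r = r' ∧ i = i') {m : ℕ}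
    (hcard : Fintype.card I ≤ m) {t : ℝ} (ht : 0 ≤ t) :
    P.real {ω | t ≤ |∑ i : I, (∏ r ∈ A, Y (edge r i) ω - ∏ r ∈ A, ∫ ω, Y (edge r i) ω ∂P)|} ≤
      2 * Real.exp (-t ^ 2 / (2 * m)) := by
  classical
  simp only [← integral_prod_block (A := A) hY hm hinj]
  have h0 := hasSubgaussianMGF_sum_block (A := A) hY hm hb hinj Finset.univ
  have h1 : HasSubgaussianMGF (fun ω => ∑ i : I, (∏ r ∈ A, Y (edge r i) ω -
      ∫ ω, ∏ r ∈ A, Y (edge r i) ω ∂P)) (m : NNReal) P := by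
    refine ⟨h0.integrable_exp_mul, fun t => (h0.mgf_le t).trans ?_⟩
    have : ((Finset.univ : Finset I).card : ℝ) ≤ m := by exact_mod_cast hcard
    gcongr
    exact_mod_cast this
  have h2 := h1.measure_ge_le ht
  have h3 := h1.neg.measure_ge_le ht
  refine le_trans (measureReal_mono (s₂ := _ ∪ _) ?_) ((measureReal_union_le _ _).trans
    ((add_le_add h2 h3).trans_eq ?_))
  · intro ω hω
    rcases le_abs.1 (Set.mem_ofPred_eq.mp hω) with h | h
    · exact Or.inl h
    · exact Or.inr h
  · rw [NNReal.coe_natCast]; ring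

end Blocks

/-- The averages of products of signs, with all but one of the indices fixed, converge to the
product of the means, uniformly in the fixed indices. -/
def SignAverage {N : ℕ} (Q : Matrix (Fin N) (Fin N) ℝ)
    (e : SpinIndexInf N → SpinIndexInf N → ℝ) : Prop :=
  ∀ (n : ℕ) (f : Fin n → Fin N) (A : Finset (Fin n)) (j : Fin N) (δ : ℝ), 0 < δ →
    ∀ᶠ m : ℕ in atTop, ∀ k : Fin n → Fin m, Function.Injective k →
      |(m : ℝ)⁻¹ * ∑ i : Fin m with i ∉ Set.range k,
        ∏ r ∈ A, e (toLex (f r, (k r : ℕ))) (toLex (j, (i : ℕ))) - ∏ r ∈ A, Q (f r) j| ≤ δ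

variable {N : ℕ} {Q : Matrix (Fin N) (Fin N) ℝ} {ε : Ω → SpinIndexInf N → SpinIndexInf N → ℝ}

lemma IsRandomSigns.integral_eq (hQ : ∀ i j, Q i j ∈ Set.Icc (-1 : ℝ) 1)
    (hε : IsRandomSigns P Q ε) {a b : SpinIndexInf N} (h : a < b) :
    ∫ ω, ε ω a b ∂P = Q (ofLex a).1 (ofLex b).1 := by
  have h1 : ∀ ω, ε ω a b = Set.indicator {ω | ε ω a b = 1} (fun _ => (1 : ℝ)) ω -
      Set.indicator {ω | ε ω a b = -1} (fun _ => (1 : ℝ)) ω := by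
    intro ω
    rcases hε.values a b ω with h | h <;> simp [Set.indicator, h] <;> norm_num
  have hm1 : MeasurableSet {ω | ε ω a b = 1} := hε.measurable a b (measurableSet_singleton 1)
  have hm2 : MeasurableSet {ω | ε ω a b = -1} := hε.measurable a b (measurableSet_singleton (-1))
  rw [integral_congr_ae (Eventually.of_forall h1),
    integral_sub ((integrable_const _).indicator hm1) ((integrable_const _).indicator hm2),
    integral_indicator_const _ hm1, integral_indicator_const _ hm2, Measure.real, Measure.real,
    hε.prob_pos a b h, hε.prob_neg a b h]
  obtain ⟨h3, h4⟩ := hQ (ofLex a).1 (ofLex b).1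
  rw [ENNReal.toReal_ofReal (by linarith), ENNReal.toReal_ofReal (by linarith)]
  rw [smul_eq_mul, smul_eq_mul]
  ring

/-- The ordered pair with entries `a`, `b`. -/
def orderedPair {a b : SpinIndexInf N} (h : a ≠ b) :
    {p : SpinIndexInf N × SpinIndexInf N // p.1 < p.2} :=
  if hlt : a < b then ⟨(a, b), hlt⟩ else ⟨(b, a), lt_of_le_of_ne (not_lt.1 hlt) h.symm⟩

lemma orderedPair_eq {a b a' b' : SpinIndexInf N} {h : a ≠ b} {h' : a' ≠ b'}
    (heq : orderedPair h = orderedPair h') : (a = a' ∧ b = b') ∨ (a = b' ∧ b = a') := by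
  unfold orderedPair at heq
  split_ifs at heq <;> simp only [Subtype.mk.injEq, Prod.mk.injEq] at heq <;> tauto

lemma IsRandomSigns.apply_orderedPair (hε : IsRandomSigns P Q ε) {a b : SpinIndexInf N}
    (h : a ≠ b) (ω : Ω) :
    ε ω (orderedPair h).1.1 (orderedPair h).1.2 = ε ω a b := by
  unfold orderedPair
  split_ifs
  · rfl
  · exact hε.symm _ _ _

lemma measureReal_signAverage_le (hsymm : Q.IsSymm) (hQ : ∀ i j, Q i j ∈ Set.Icc (-1 : ℝ) 1)
    (hε : IsRandomSigns P Q ε) {n : ℕ} (f : Fin n → Fin N) (A : Finset (Fin n)) (j : Fin N)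
    {m : ℕ} {k : Fin n → Fin m} (hk : Function.Injective k) {t : ℝ} (ht : 0 ≤ t) :
    P.real {ω | t ≤ |∑ i : {i : Fin m // i ∉ Set.range k},
      (∏ r ∈ A, ε ω (toLex (f r, (k r : ℕ))) (toLex (j, (i : ℕ))) - ∏ r ∈ A, Q (f r) j)|} ≤
      2 * Real.exp (-t ^ 2 / (2 * m)) := by
  classical
  have hne : ∀ (r : Fin n) (i : {i : Fin m // i ∉ Set.range k}),
      (toLex (f r, (k r : ℕ)) : SpinIndexInf N) ≠ toLex (j, (i : ℕ)) := by
    intro r i h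
    have h1 : (k r : ℕ) = (i : ℕ) := congrArg (fun a => (ofLex a).2) h
    exact i.2 ⟨r, Fin.ext h1⟩
  let edge : Fin n → {i : Fin m // i ∉ Set.range k} →
      {p : SpinIndexInf N × SpinIndexInf N // p.1 < p.2} := fun r i => orderedPair (hne r i)
  -- Independence is known only for ordered pairs, so two edges could also coincide crosswise. That
  -- would put `i'` into the range of `k`; excluding this range from the averages rules it out.
  have hinj : ∀ r r' i i', edge r i = edge r' i' → r = r' ∧ i = i' := by
    intro r r' i i' h
    rcases orderedPair_eq h with ⟨h1, h2⟩ | ⟨h1, h2⟩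
    · have h3 : (k r : ℕ) = (k r' : ℕ) := congrArg (fun a => (ofLex a).2) h1
      have h4 : (i : ℕ) = (i' : ℕ) := congrArg (fun a => (ofLex a).2) h2
      exact ⟨hk (Fin.ext h3), Subtype.ext (Fin.ext h4)⟩
    · have h3 : (k r : ℕ) = (i' : ℕ) := congrArg (fun a => (ofLex a).2) h1
      exact absurd ⟨r, Fin.ext h3⟩ i'.2
  have h := measure_abs_sum_block_ge_le (A := A) (edge := edge) hε.indep
    (fun a => hε.measurable _ _) (fun a ω => by
      rcases hε.values a.1.1 a.1.2 ω with h | h <;> rw [h] <;> norm_num) hinj (m := m)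
    ((Fintype.card_subtype_le _).trans_eq (Fintype.card_fin m)) ht
  have hval : ∀ r i ω, ε ω (edge r i).1.1 (edge r i).1.2 =
      ε ω (toLex (f r, (k r : ℕ))) (toLex (j, (i : ℕ))) := fun r i ω =>
    hε.apply_orderedPair (hne r i) ω
  have hint : ∀ r i, ∫ ω, ε ω (edge r i).1.1 (edge r i).1.2 ∂P = Q (f r) j := by
    intro r i
    rw [hε.integral_eq hQ (edge r i).2]
    simp only [edge, orderedPair]
    split_ifs
    · rfl
    · exact hsymm.apply _ _
  simp only [hval] at hint h
  simp only [hint] at h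
  exact h

/-- Almost surely, the random signs satisfy the uniform law of large numbers. -/
theorem IsRandomSigns.ae_signAverage (hsymm : Q.IsSymm)
    (hQ : ∀ i j, Q i j ∈ Set.Icc (-1 : ℝ) 1) (hε : IsRandomSigns P Q ε) :
    ∀ᵐ ω ∂P, SignAverage Q (ε ω) := by
  -- The tolerances are restricted to `1 / (l + 1)`, so that the data range over a countable set and
  -- the null sets can be united.
  have key : ∀ (n : ℕ) (f : Fin n → Fin N) (A : Finset (Fin n)) (j : Fin N) (l : ℕ),
      ∀ᵐ ω ∂P, ∀ᶠ m : ℕ in atTop, ∀ k : Fin n → Fin m, Function.Injective k →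
        |∑ i : {i : Fin m // i ∉ Set.range k},
          (∏ r ∈ A, ε ω (toLex (f r, (k r : ℕ))) (toLex (j, (i : ℕ))) - ∏ r ∈ A, Q (f r) j)| <
        (l + 1 : ℝ)⁻¹ * m := by
    intro n f A j l
    set δ : ℝ := (l + 1 : ℝ)⁻¹ with hδ
    have hδ0 : 0 < δ := by positivity
    let B : ℕ → Set Ω := fun m => ⋃ k : {k : Fin n → Fin m // Function.Injective k},
      {ω | δ * m ≤ |∑ i : {i : Fin m // i ∉ Set.range k.1},
        (∏ r ∈ A, ε ω (toLex (f r, (k.1 r : ℕ))) (toLex (j, (i : ℕ))) - ∏ r ∈ A, Q (f r) j)|}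
    -- Union bound over at most `m ^ n` injective tuples with deviation `t = δ m`. The result is
    -- summable in `m`, as Borel–Cantelli requires.
    have hB : ∀ m, P.real (B m) ≤ 2 * ((m : ℝ) ^ n * Real.exp (-(δ ^ 2 / 2) * m)) := by
      intro m
      refine (measureReal_iUnion_fintype_le _).trans ?_
      refine (Finset.sum_le_sum fun k _ => measureReal_signAverage_le hsymm hQ hε f A j k.2
        (t := δ * m) (by positivity)).trans ?_
      rw [Finset.sum_const, nsmul_eq_mul]
      have h1 : ((Finset.univ : Finset {k : Fin n → Fin m // Function.Injective k}).card : ℝ) ≤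
          (m : ℝ) ^ n := by
        have h2 := Fintype.card_subtype_le fun k : Fin n → Fin m => Function.Injective k
        rw [Fintype.card_fun, Fintype.card_fin, Fintype.card_fin] at h2
        exact_mod_cast h2
      have h3 : -(δ * m) ^ 2 / (2 * (m : ℝ)) = -(δ ^ 2 / 2) * m := by
        rcases eq_or_ne (m : ℝ) 0 with h | h
        · simp [h]
        · field_simp
      rw [h3]
      have h4 : 0 ≤ 2 * Real.exp (-(δ ^ 2 / 2) * m) := by positivity
      nlinarith [mul_le_mul_of_nonneg_right h1 h4]
    have hsum : ∑' m, P (B m) ≠ ⊤ := by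
      have hs : Summable fun m => P.real (B m) := by
        refine Summable.of_nonneg_of_le (fun _ => measureReal_nonneg) hB ?_
        exact (Real.summable_pow_mul_exp_neg_nat_mul n (by positivity)).mul_left 2
      have := hs.tsum_ofReal_ne_top
      simpa [measureReal_def, ENNReal.ofReal_toReal (measure_ne_top P _)] using this
    filter_upwards [ae_eventually_notMem hsum] with ω hω
    filter_upwards [hω] with m hm k hk
    by_contra! h
    exact hm (Set.mem_iUnion.2 ⟨⟨k, hk⟩, h⟩)
  have h2 : ∀ᵐ ω ∂P, ∀ (n : ℕ) (f : Fin n → Fin N) (A : Finset (Fin n)) (j : Fin N) (l : ℕ),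
      ∀ᶠ m : ℕ in atTop, ∀ k : Fin n → Fin m, Function.Injective k →
        |∑ i : {i : Fin m // i ∉ Set.range k},
          (∏ r ∈ A, ε ω (toLex (f r, (k r : ℕ))) (toLex (j, (i : ℕ))) - ∏ r ∈ A, Q (f r) j)| <
        (l + 1 : ℝ)⁻¹ * m := by
    simp only [ae_all_iff]
    exact key
  filter_upwards [h2] with ω hω n f A j δ hδ
  obtain ⟨l, hl⟩ := exists_nat_one_div_lt (half_pos hδ)
  rw [one_div] at hl
  filter_upwards [hω n f A j l, eventually_gt_atTop 0,
    (tendsto_const_div_atTop_nhds_zero_nat (n : ℝ)).eventually_le_const (half_pos hδ)]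
    with m hm hm0 hnm k hk
  have hm0' : (0 : ℝ) < m := Nat.cast_pos.2 hm0
  have h3 := hm k hk
  set F : Fin m → ℝ := fun i => ∏ r ∈ A, ε ω (toLex (f r, (k r : ℕ))) (toLex (j, (i : ℕ))) with hF
  set q : ℝ := ∏ r ∈ A, Q (f r) j with hq
  have hq1 : |q| ≤ 1 := abs_le.2 (mem_Icc_prod_of_mem_Icc A _ fun r => hQ _ _)
  have hs : ∑ i : Fin m with i ∉ Set.range k, F i = ∑ i : {i : Fin m // i ∉ Set.range k}, F i :=
    Finset.sum_subtype _ (by simp) _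
  have hcard : (Fintype.card {i : Fin m // i ∉ Set.range k} : ℝ) = m - n := by
    rw [Fintype.card_subtype_compl, Fintype.card_fin]
    have h5 : Fintype.card {x // x ∈ Set.range k} = n := by
      rw [Fintype.card_congr (Equiv.ofInjective k hk).symm, Fintype.card_fin]
    have h6 : n ≤ m := by simpa using Fintype.card_le_of_injective k hk
    rw [h5, Nat.cast_sub h6]
  have h4 : ∑ i : {i : Fin m // i ∉ Set.range k}, (F i - q) =
      ∑ i : Fin m with i ∉ Set.range k, F i - (m - n) * q := by
    rw [Finset.sum_sub_distrib, hs, Finset.sum_const, nsmul_eq_mul, Finset.card_univ, hcard]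
  change |∑ i : {i : Fin m // i ∉ Set.range k}, (F i - q)| < _ at h3
  rw [h4] at h3
  set B := ∑ i : Fin m with i ∉ Set.range k, F i
  -- The average has `m - n` terms but is normalized by `m`; the discrepancy `n q / m` takes the
  -- other half of `δ`.
  have h5 : (m : ℝ)⁻¹ * B - q = (m : ℝ)⁻¹ * (B - (m - n) * q) - (n / m) * q := by
    field_simp; ring
  rw [h5]
  refine (abs_sub _ _).trans ?_
  rw [abs_mul, abs_mul, abs_of_pos (inv_pos.2 hm0'), abs_of_nonneg (by positivity : (0:ℝ) ≤ n / m)]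
  have h6 : (m : ℝ)⁻¹ * |B - (m - n) * q| ≤ (l + 1 : ℝ)⁻¹ := by
    rw [inv_mul_le_iff₀ hm0']
    linarith
  have h7 : (n / m : ℝ) * |q| ≤ n / m := mul_le_of_le_one_right (by positivity) hq1
  linarith

end Probability

/-! ### Almost orthogonal sums -/

section AlmostOrthogonal

variable {n : Type*} [Fintype n]

-- A Schur test: every row of the Gram matrix has at most `D` nonzero entries, each of modulus at
-- most `1`, and `2 ‖c k‖ ‖c k'‖` is bounded by the sum of the squares.
open Classical in
lemma nip_sum_smul_self_le {α : Type*} (s : Finset α) (M : α → Matrix n n ℂ) (c : α → ℂ) (D : ℕ)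
    (hM : ∀ k ∈ s, ∀ k' ∈ s, ‖nip (M k) (M k')‖ ≤ 1)
    (hD : ∀ k ∈ s, (s.filter fun k' => nip (M k) (M k') ≠ 0).card ≤ D) :
    (nip (∑ k ∈ s, c k • M k) (∑ k ∈ s, c k • M k)).re ≤ D * ∑ k ∈ s, ‖c k‖ ^ 2 := by
  have hsymm : ∀ k k', nip (M k) (M k') ≠ 0 ↔ nip (M k') (M k) ≠ 0 := by
    intro k k'
    have h : conj (nip (M k) (M k')) = nip (M k') (M k) := (nipCore n).conj_inner_symm _ _
    rw [← h, Ne, Ne, map_eq_zero]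
  have h1 : ∀ k ∈ s, ∀ k' ∈ s, (nip (c k • M k) (c k' • M k')).re ≤
      if nip (M k) (M k') ≠ 0 then (‖c k‖ ^ 2 + ‖c k'‖ ^ 2) / 2 else 0 := by
    intro k hk k' hk'
    rw [nip_smul_left, nip_smul_right]
    split_ifs with h
    · refine (Complex.re_le_norm _).trans ?_
      rw [norm_mul, norm_mul, RCLike.norm_conj]
      have h2 : ‖c k‖ * (‖c k'‖ * ‖nip (M k) (M k')‖) ≤ ‖c k‖ * (‖c k'‖ * 1) := by
        gcongr
        exact hM k hk k' hk'
      nlinarith [sq_nonneg (‖c k‖ - ‖c k'‖)]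
    · rw [not_not] at h
      simp [h]
  have h2 : ∀ k ∈ s, ∑ k' ∈ s, (if nip (M k) (M k') ≠ 0 then ‖c k‖ ^ 2 else 0) ≤
      D * ‖c k‖ ^ 2 := by
    intro k hk
    rw [← Finset.sum_filter, Finset.sum_const, nsmul_eq_mul]
    have : ((s.filter fun k' => nip (M k) (M k') ≠ 0).card : ℝ) ≤ D := by exact_mod_cast hD k hk
    gcongr
  rw [nip_sum_left, Complex.re_sum]
  simp only [nip_sum_right, Complex.re_sum]
  refine (Finset.sum_le_sum fun k hk => Finset.sum_le_sum fun k' hk' => h1 k hk k' hk').trans ?_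
  have h3 : ∑ k ∈ s, ∑ k' ∈ s, (if nip (M k) (M k') ≠ 0 then (‖c k‖ ^ 2 + ‖c k'‖ ^ 2) / 2 else 0) =
      (∑ k ∈ s, ∑ k' ∈ s, (if nip (M k) (M k') ≠ 0 then ‖c k‖ ^ 2 else 0)) / 2 +
      (∑ k ∈ s, ∑ k' ∈ s, (if nip (M k) (M k') ≠ 0 then ‖c k'‖ ^ 2 else 0)) / 2 := by
    rw [← add_div, ← Finset.sum_add_distrib, Finset.sum_div]
    refine Finset.sum_congr rfl fun k _ => ?_
    rw [← Finset.sum_add_distrib, Finset.sum_div]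
    refine Finset.sum_congr rfl fun k' _ => ?_
    split_ifs <;> simp
  have h4 : ∑ k ∈ s, ∑ k' ∈ s, (if nip (M k) (M k') ≠ 0 then ‖c k'‖ ^ 2 else 0) =
      ∑ k ∈ s, ∑ k' ∈ s, (if nip (M k) (M k') ≠ 0 then ‖c k‖ ^ 2 else 0) := by
    rw [Finset.sum_comm]
    refine Finset.sum_congr rfl fun k _ => Finset.sum_congr rfl fun k' _ => ?_
    simp only [hsymm k' k]
  rw [h3, h4, add_halves, Finset.mul_sum]
  exact Finset.sum_le_sum h2

end AlmostOrthogonal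

/-! ### Counting -/

section Counting

lemma card_filter_forall_mem_range_le {n m : ℕ} (k : Fin n → Fin m)
    (s : Finset (Fin n → Fin m)) (hs : ∀ k' ∈ s, ∀ r, k' r ∈ Set.range k) : s.card ≤ n ^ n := by
  have h : s ⊆ Fintype.piFinset fun _ : Fin n => Finset.univ.image k := by
    intro k' hk'
    rw [Fintype.mem_piFinset]
    intro r
    obtain ⟨x, hx⟩ := hs k' hk' r
    exact Finset.mem_image.2 ⟨x, Finset.mem_univ _, hx⟩
  refine (Finset.card_le_card h).trans ?_
  rw [Fintype.card_piFinset_const]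
  refine Nat.pow_le_pow_left ?_ n
  exact Finset.card_image_le.trans_eq (Finset.card_fin n)

/-- The number of maps from a set with `2 n` elements to `[m]` without one-point fibres. -/
lemma card_le_of_no_singleton_fiber {n m : ℕ} (s : Finset (Fin n ⊕ Fin n → Fin m))
    (hs : ∀ κ ∈ s, ∀ x, ∃ y, y ≠ x ∧ κ y = κ x) : s.card ≤ n ^ (2 * n) * m ^ n := by
  classical
  have h : s ⊆ Finset.univ.image
      fun p : (Fin n ⊕ Fin n → Fin n) × (Fin n → Fin m) => p.2 ∘ p.1 := by
    intro κ hκ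
    set I : Finset (Fin m) := Finset.univ.image κ with hI
    -- The `2 n` points are divided among fibres with at least two points each. So `κ` takes at most
    -- `n` values and factors through `Fin n`.
    have hcard : I.card ≤ n := by
      have h1 : ∀ b ∈ I, 2 ≤ (Finset.univ.filter fun x => κ x = b).card := by
        intro b hb
        obtain ⟨x, -, rfl⟩ := Finset.mem_image.1 hb
        obtain ⟨y, hy, hxy⟩ := hs κ hκ x
        exact Finset.one_lt_card.2 ⟨y, by simp [hxy], x, by simp, hy⟩
      have h2 := Finset.card_eq_sum_card_image κ (Finset.univ : Finset (Fin n ⊕ Fin n))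
      have h3 : I.card * 2 ≤ ∑ b ∈ I, (Finset.univ.filter fun x => κ x = b).card := by
        rw [← smul_eq_mul]
        exact Finset.card_nsmul_le_sum _ _ _ h1
      rw [← h2, Finset.card_univ, Fintype.card_sum, Fintype.card_fin] at h3
      omega
    obtain ⟨φ⟩ : Nonempty (I ↪ Fin n) := Function.Embedding.nonempty_of_card_le (by
      rwa [Fintype.card_coe, Fintype.card_fin])
    have hmem : ∀ x, κ x ∈ I := fun x => Finset.mem_image_of_mem _ (Finset.mem_univ x)
    rcases isEmpty_or_nonempty I with hE | hE
    · refine Finset.mem_image.2 ⟨(fun x => (hE.false ⟨κ x, hmem x⟩).elim, ?_), by simp, ?_⟩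
      · exact fun i => (hE.false ⟨κ (Sum.inl i), hmem _⟩).elim
      · ext x; exact (hE.false ⟨κ x, hmem x⟩).elim
    · refine Finset.mem_image.2 ⟨(fun x => φ ⟨κ x, hmem x⟩, fun i => (Function.invFun φ i : I)),
        by simp, ?_⟩
      ext x
      simp [Function.leftInverse_invFun φ.injective ⟨κ x, hmem x⟩]
  refine (Finset.card_le_card h).trans (Finset.card_image_le.trans_eq ?_)
  rw [Finset.card_univ, Fintype.card_prod, Fintype.card_fun, Fintype.card_fun, Fintype.card_sum]
  simp [two_mul]

lemma card_injective_le (n m : ℕ) :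
    ((Finset.univ.filter fun k : Fin n → Fin m => Function.Injective k).card : ℝ) ≤
      (m : ℝ) ^ n := by
  have h := Finset.card_filter_le (Finset.univ : Finset (Fin n → Fin m)) Function.Injective
  rw [Finset.card_univ, Fintype.card_fun, Fintype.card_fin, Fintype.card_fin] at h
  exact_mod_cast h

/-- An injective map on `Fin (n + 1)` is an injective map on `Fin n` with one more value. -/
lemma sum_injective_succ {V : Type*} [AddCommMonoid V] {n m : ℕ} (l : Fin (n + 1))
    (F : Fin m → (Fin n → Fin m) → V) :
    ∑ κ : Fin (n + 1) → Fin m with Function.Injective κ, F (κ l) (fun r => κ (l.succAbove r)) =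
      ∑ k : Fin n → Fin m with Function.Injective k, ∑ i : Fin m with i ∉ Set.range k, F i k := by
  have hinj : ∀ (i : Fin m) (k : Fin n → Fin m),
      Function.Injective ((Fin.insertNthEquiv (fun _ => Fin m) l) (i, k)) ↔
        Function.Injective k ∧ i ∉ Set.range k := by
    intro i k
    change Function.Injective (l.insertNth i k : Fin (n + 1) → Fin m) ↔ _
    constructor
    · intro h
      refine ⟨fun r r' hr => l.succAbove_right_injective (h (by simpa using hr)), ?_⟩
      rintro ⟨r, hr⟩
      exact l.succAbove_ne r (h (by simpa using hr))
    · rintro ⟨h1, h2⟩ x y hxy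
      rcases Fin.eq_self_or_eq_succAbove l x with hx | ⟨r, rfl⟩ <;>
        rcases Fin.eq_self_or_eq_succAbove l y with hy | ⟨r', rfl⟩
      · rw [hx, hy]
      · exact absurd ⟨r', by simpa [hx] using hxy.symm⟩ h2
      · exact absurd ⟨r, by simpa [hy] using hxy⟩ h2
      · rw [h1 (by simpa using hxy : k r = k r')]
  have h := (Fin.insertNthEquiv (fun _ => Fin m) l).sum_comp
    fun κ : Fin (n + 1) → Fin m => if Function.Injective κ then
      F (κ l) (fun r => κ (l.succAbove r)) else 0
  rw [Finset.sum_filter, ← h, Fintype.sum_prod_type, Finset.sum_comm, Finset.sum_filter]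
  refine Finset.sum_congr rfl fun k _ => ?_
  simp only [hinj]
  simp only [Fin.insertNthEquiv_apply, Fin.insertNth_apply_same, Fin.insertNth_apply_succAbove]
  by_cases hk : Function.Injective k
  · simp [hk, Finset.sum_filter]
  · simp [hk]

end Counting

/-! ### Words in the generators -/

section Words

variable {N : ℕ} {e : SpinIndexInf N → SpinIndexInf N → ℝ}

/-- The word `x_{f 0}(k 0) ⋯ x_{f (n - 1)}(k (n - 1))`. -/
def word (e : SpinIndexInf N → SpinIndexInf N → ℝ) (m : ℕ) {n : ℕ} (f : Fin n → Fin N)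
    (k : Fin n → Fin m) : SpinMat N m :=
  spinWord (fun a b : SpinIndex N m => e a.incl b.incl) fun r => toLex (f r, k r)

/-- The sequence of the special Wick word of a family of letters. -/
def wickFn (e : SpinIndexInf N → SpinIndexInf N → ℝ) {n : ℕ} (f : Fin n → Fin N) (m : ℕ) :
    SpinMat N m :=
  ((Real.sqrt m : ℂ)⁻¹ ^ n) • ∑ k : Fin n → Fin m with Function.Injective k, word e m f k

/-- The normalized sum `m^{-n/2} ∑_k c_k x_{f 0}(k 0) ⋯ x_{f (n - 1)}(k (n - 1))`. -/
def chaos (e : SpinIndexInf N → SpinIndexInf N → ℝ) {n : ℕ} (f : Fin n → Fin N) {m : ℕ}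
    (c : (Fin n → Fin m) → ℂ) : SpinMat N m :=
  ((Real.sqrt m : ℂ)⁻¹ ^ n) • ∑ k, c k • word e m f k

lemma wickFn_eq_chaos {n : ℕ} (f : Fin n → Fin N) (m : ℕ) :
    wickFn e f m = chaos e f fun k : Fin n → Fin m => if Function.Injective k then 1 else 0 := by
  simp [wickFn, chaos, Finset.sum_filter]

lemma wickSeq_eq_wickFn_get (i : List (Fin N)) : wickSeq e i = wickFn e i.get := by
  funext m
  rw [wickSeq, wickFn]
  congr 1
  rw [Finset.sum_subtype (p := Function.Injective) _ (by simp),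
    ← (Equiv.subtypeInjectiveEquivEmbedding _ _).symm.sum_comp]
  rfl

lemma wickSeq_ofFn {n : ℕ} (f : Fin n → Fin N) : wickSeq e (List.ofFn f) = wickFn e f := by
  have h : ∀ {n' : ℕ} (h : n' = n), wickFn e (f ∘ Fin.cast h) = wickFn e f := by
    rintro _ rfl; rfl
  rw [wickSeq_eq_wickFn_get, ← h List.length_ofFn]
  congr 1
  funext r
  exact List.get_ofFn f r

lemma word_mem_spinAlgebra {n m : ℕ} (f : Fin n → Fin N) (k : Fin n → Fin m) :
    word e m f k ∈ spinAlgebra e m := by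
  refine list_prod_mem fun x hx => ?_
  rw [List.mem_ofFn] at hx
  obtain ⟨r, rfl⟩ := hx
  exact gen_mem_spinAlgebra m (f r) (k r)

lemma chaos_mem_spinAlgebra {n m : ℕ} (f : Fin n → Fin N) (c : (Fin n → Fin m) → ℂ) :
    chaos e f c ∈ spinAlgebra e m :=
  (spinAlgebra e m).smul_mem (sum_mem fun k _ =>
    (spinAlgebra e m).smul_mem (word_mem_spinAlgebra f k) _) _

lemma gen_mul_word {n m : ℕ} (j : Fin N) (i : Fin m) (f : Fin n → Fin N) (k : Fin n → Fin m) :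
    gen e m j i * word e m f k = word e m (Fin.cons j f : Fin (n + 1) → Fin N) (Fin.cons i k) := by
  rw [word, word, spinWord_succ]
  rfl

/-- Because `chaos` allows repeated indices and arbitrary coefficients, it is stable under
multiplication by the generators. One norm bound for `chaos` therefore covers Wick sums and their
products with one or two generators. -/
lemma genSeq_mul_chaos {n m : ℕ} (j : Fin N) (f : Fin n → Fin N) (c : (Fin n → Fin m) → ℂ) :
    genSeq e j m * chaos e f c =
      chaos e (Fin.cons j f : Fin (n + 1) → Fin N) fun κ => c fun r => κ r.succ := by
  rw [genSeq, chaos, chaos, Matrix.smul_mul, Matrix.mul_smul, smul_smul, ← pow_succ',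
    ← (Fin.consEquiv fun _ : Fin (n + 1) => Fin m).sum_comp, Fintype.sum_prod_type, Finset.sum_mul]
  congr 1
  refine Finset.sum_congr rfl fun i _ => ?_
  rw [Finset.mul_sum]
  refine Finset.sum_congr rfl fun k _ => ?_
  rw [Matrix.mul_smul, gen_mul_word]
  rfl

/-! ### Norm bounds -/

/-- The letters of a word. -/
def letters {n m : ℕ} (f : Fin n → Fin N) (k : Fin n → Fin m) (r : Fin n) : SpinIndex N m :=
  toLex (f r, k r)

lemma letters_eq_iff {n n' m : ℕ} {f : Fin n → Fin N} {k : Fin n → Fin m} {f' : Fin n' → Fin N}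
    {k' : Fin n' → Fin m} {r : Fin n} {r' : Fin n'} :
    letters f k r = letters f' k' r' ↔ f r = f' r' ∧ k r = k' r' := by
  simp [letters]

lemma letters_injective {n m : ℕ} (f : Fin n → Fin N) {k : Fin n → Fin m}
    (hk : Function.Injective k) : Function.Injective (letters f k) :=
  fun _ _ h => hk (letters_eq_iff.1 h).2

lemma isShift_word (he : ∀ a b, e a b = -1 ∨ e a b = 1)
    {n m : ℕ} (f : Fin n → Fin N) (k : Fin n → Fin m) :
    IsShift (oddLetters (letters f k)) (word e m f k) :=
  isShift_spinWord (fun _ _ => he _ _) _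

lemma norm_nip_word_le (he : ∀ a b, e a b = -1 ∨ e a b = 1)
    {n n' m : ℕ} (f : Fin n → Fin N) (k : Fin n → Fin m) (f' : Fin n' → Fin N)
    (k' : Fin n' → Fin m) : ‖nip (word e m f k) (word e m f' k')‖ ≤ 1 :=
  (isShift_word he f k).norm_nip_le (isShift_word he f' k')

lemma oddLetters_eq_of_nip_ne_zero (he : ∀ a b, e a b = -1 ∨ e a b = 1)
    {n n' m : ℕ} {f : Fin n → Fin N} {k : Fin n → Fin m}
    {f' : Fin n' → Fin N} {k' : Fin n' → Fin m} (h : nip (word e m f k) (word e m f' k') ≠ 0) :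
    oddLetters (letters f k) = oddLetters (letters f' k') := by
  by_contra hne
  exact h ((isShift_word he f k).nip_eq_zero (isShift_word he f' k') hne)

lemma exists_letters_eq_of_nip_ne_zero (he : ∀ a b, e a b = -1 ∨ e a b = 1)
    {n n' m : ℕ} {f : Fin n → Fin N} {k : Fin n → Fin m}
    {f' : Fin n' → Fin N} {k' : Fin n' → Fin m} (hk : Function.Injective (letters f k))
    (hk' : Function.Injective (letters f' k')) (h : nip (word e m f k) (word e m f' k') ≠ 0)
    (r : Fin n') : ∃ r', letters f k r' = letters f' k' r := by
  have h1 := oddLetters_eq_of_nip_ne_zero he h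
  rw [oddLetters_of_injective hk, oddLetters_of_injective hk'] at h1
  have h2 : letters f' k' r ∈ Finset.univ.image (letters f k) := by
    rw [h1]; exact Finset.mem_image_of_mem _ (Finset.mem_univ r)
  simpa using h2

/-- An index occurring only once in the first word and never in the second gives a letter that is
odd in the first word only, and the words would be orthogonal. -/
lemma exists_ne_of_nip_ne_zero (he : ∀ a b, e a b = -1 ∨ e a b = 1)
    {n n' m : ℕ} {f : Fin n → Fin N} {k : Fin n → Fin m}
    {f' : Fin n' → Fin N} {k' : Fin n' → Fin m} (h : nip (word e m f k) (word e m f' k') ≠ 0)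
    (r : Fin n) : (∃ r', r' ≠ r ∧ k r' = k r) ∨ ∃ r', k' r' = k r := by
  by_cases h1 : ∃ r', r' ≠ r ∧ k r' = k r
  · exact Or.inl h1
  · right
    push Not at h1
    have h2 : letters f k r ∈ oddLetters (letters f k) := by
      simp only [oddLetters, Finset.mem_filter, Finset.mem_univ, true_and]
      rw [Finset.sum_eq_single r]
      · simp
      · intro r' _ hr'
        rw [if_neg]
        exact fun h3 => h1 r' hr' (letters_eq_iff.1 h3).2
      · simp
    rw [oddLetters_eq_of_nip_ne_zero he h] at h2
    simp only [oddLetters, Finset.mem_filter, Finset.mem_univ, true_and] at h2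
    by_contra! h3
    rw [Finset.sum_eq_zero] at h2
    · simp at h2
    · intro r' _
      rw [if_neg]
      exact fun h4 => h3 r' (letters_eq_iff.1 h4).2

lemma norm_sqrt_inv_pow_sq (m n : ℕ) :
    ‖((Real.sqrt m : ℂ)⁻¹ ^ n)‖ ^ 2 = ((m : ℝ) ^ n)⁻¹ := by
  rw [norm_pow, norm_inv, Complex.norm_real, Real.norm_eq_abs, abs_of_nonneg (Real.sqrt_nonneg _),
    ← pow_mul, mul_comm, pow_mul, inv_pow, Real.sq_sqrt (Nat.cast_nonneg m), inv_pow]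

/-- In a pair `(k, k')` with nonzero inner product, no value occurs exactly once among the `2 n`
indices. There are at most `n ^ (2 n) m ^ n` such pairs, and the normalization contributes `m ^
(-n)`. -/
lemma nip_chaos_self_le (he : ∀ a b, e a b = -1 ∨ e a b = 1)
    {n m : ℕ} (f : Fin n → Fin N) (c : (Fin n → Fin m) → ℂ)
    (hc : ∀ k, ‖c k‖ ≤ 1) :
    (nip (chaos e f c) (chaos e f c)).re ≤ (n : ℝ) ^ (2 * n) := by
  classical
  have hneg : ∀ {n n' : ℕ} {f : Fin n → Fin N} {k : Fin n → Fin m} {f' : Fin n' → Fin N}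
      {k' : Fin n' → Fin m}, nip (word e m f k) (word e m f' k') ≠ 0 →
      nip (word e m f' k') (word e m f k) ≠ 0 := by
    intro _ _ f k f' k' h h'
    have h2 : conj (nip (word e m f' k') (word e m f k)) = nip (word e m f k) (word e m f' k') :=
      (nipCore _).conj_inner_symm _ _
    rw [h', map_zero] at h2
    exact h h2.symm
  have h1 : (nip (∑ k, c k • word e m f k) (∑ k, c k • word e m f k)).re ≤
      (n : ℝ) ^ (2 * n) * (m : ℝ) ^ n := by
    rw [nip_sum_left, Complex.re_sum]
    simp only [nip_sum_right, Complex.re_sum]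
    have h2 : ∀ k k' : Fin n → Fin m, (nip (c k • word e m f k) (c k' • word e m f k')).re ≤
        if nip (word e m f k) (word e m f k') ≠ 0 then 1 else 0 := by
      intro k k'
      rw [nip_smul_left, nip_smul_right]
      split_ifs with h
      · refine (Complex.re_le_norm _).trans ?_
        rw [norm_mul, norm_mul, RCLike.norm_conj]
        exact mul_le_one₀ (hc k) (by positivity)
          (mul_le_one₀ (hc k') (norm_nonneg _) (norm_nip_word_le he f k f k'))
      · rw [not_not] at h
        simp [h]
    refine (Finset.sum_le_sum fun k _ => Finset.sum_le_sum fun k' _ => h2 k k').trans ?_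
    rw [← Fintype.sum_prod_type (fun p : (Fin n → Fin m) × (Fin n → Fin m) =>
      if nip (word e m f p.1) (word e m f p.2) ≠ 0 then (1 : ℝ) else 0),
      ← (Equiv.sumArrowEquivProdArrow (Fin n) (Fin n) (Fin m)).sum_comp, ← Finset.sum_filter,
      Finset.sum_const, nsmul_eq_mul, mul_one]
    have h3 := card_le_of_no_singleton_fiber (Finset.univ.filter fun κ : Fin n ⊕ Fin n → Fin m =>
      nip (word e m f (Equiv.sumArrowEquivProdArrow (Fin n) (Fin n) (Fin m) κ).1)
        (word e m f (Equiv.sumArrowEquivProdArrow (Fin n) (Fin n) (Fin m) κ).2) ≠ 0) ?_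
    · exact_mod_cast h3
    · intro κ hκ x
      have h4 := (Finset.mem_filter.1 hκ).2
      rcases x with r | r
      · rcases exists_ne_of_nip_ne_zero he h4 r with ⟨r', h5, h6⟩ | ⟨r', h6⟩
        · exact ⟨Sum.inl r', by simpa using h5, h6⟩
        · exact ⟨Sum.inr r', by simp, h6⟩
      · rcases exists_ne_of_nip_ne_zero he (hneg h4) r with ⟨r', h5, h6⟩ | ⟨r', h6⟩
        · exact ⟨Sum.inr r', by simpa using h5, h6⟩
        · exact ⟨Sum.inl r', by simp, h6⟩
  rw [chaos, nip_smul_self, norm_sqrt_inv_pow_sq]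
  rcases eq_or_ne ((m : ℝ) ^ n) 0 with h | h
  · rw [h, inv_zero, zero_mul]; positivity
  · rw [inv_mul_le_iff₀ (lt_of_le_of_ne (by positivity) h.symm), mul_comm]
    exact h1

lemma chaos_mem_L2Seq (he : ∀ a b, e a b = -1 ∨ e a b = 1)
    {n : ℕ} (f : Fin n → Fin N) (c : ∀ m : ℕ, (Fin n → Fin m) → ℂ)
    (hc : ∀ m k, ‖c m k‖ ≤ 1) : (fun m => chaos e f (c m)) ∈ L2Seq e :=
  ⟨fun m => chaos_mem_spinAlgebra f (c m), _, fun m => nip_chaos_self_le he f (c m) (hc m)⟩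

lemma wickSeq_mem_L2Seq (he : ∀ a b, e a b = -1 ∨ e a b = 1)
    (i : List (Fin N)) : wickSeq e i ∈ L2Seq e := by
  rw [wickSeq_eq_wickFn_get, funext (wickFn_eq_chaos (e := e) i.get)]
  exact chaos_mem_L2Seq he _ _ fun m k => by split_ifs <;> simp

lemma genSeq_mul_wickSeq_mem_L2Seq (he : ∀ a b, e a b = -1 ∨ e a b = 1)
    (j : Fin N) (i : List (Fin N)) :
    (fun m => genSeq e j m * wickSeq e i m) ∈ L2Seq e := by
  simp only [wickSeq_eq_wickFn_get, wickFn_eq_chaos, genSeq_mul_chaos]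
  exact chaos_mem_L2Seq he _ _ fun m k => by split_ifs <;> simp

lemma genSeq_mul_genSeq_mul_wickSeq_mem_L2Seq (he : ∀ a b, e a b = -1 ∨ e a b = 1)
    (j : Fin N) (i : List (Fin N)) :
    (fun m => genSeq e j m * (genSeq e j m * wickSeq e i m)) ∈ L2Seq e := by
  simp only [wickSeq_eq_wickFn_get, wickFn_eq_chaos, genSeq_mul_chaos]
  exact chaos_mem_L2Seq he _ _ fun m k => by split_ifs <;> simp

/-- Sums over injective index families of words that are determined by their index sets. -/
lemma nip_sum_injective_self_le (he : ∀ a b, e a b = -1 ∨ e a b = 1)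
    {n n' m : ℕ} (g : (Fin n → Fin m) → Fin n' → Fin N)
    (κ : (Fin n → Fin m) → Fin n' → Fin m)
    (hinj : ∀ k, Function.Injective k → Function.Injective (letters (g k) (κ k)))
    (h1 : ∀ k r, κ k r ∈ Set.range k) (h2 : ∀ k r, k r ∈ Set.range (κ k))
    (c : (Fin n → Fin m) → ℂ) :
    (nip (∑ k with Function.Injective k, c k • word e m (g k) (κ k))
      (∑ k with Function.Injective k, c k • word e m (g k) (κ k))).re ≤
      (n ^ n : ℕ) * ∑ k : Fin n → Fin m with Function.Injective k, ‖c k‖ ^ 2 := by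
  classical
  refine nip_sum_smul_self_le _ _ _ _ (fun k _ k' _ => norm_nip_word_le he _ _ _ _) fun k hk => ?_
  refine card_filter_forall_mem_range_le k _ fun k' hk' r => ?_
  rw [Finset.mem_filter, Finset.mem_filter] at hk'
  obtain ⟨r', hr'⟩ := h2 k' r
  obtain ⟨t, h⟩ := exists_letters_eq_of_nip_ne_zero he (hinj k (Finset.mem_filter.1 hk).2)
    (hinj k' hk'.1.2) hk'.2 r'
  rw [← hr', ← (letters_eq_iff.1 h).2]
  exact h1 k t

/-- Wick words of different lengths are orthogonal. -/
lemma nip_wickFn_eq_zero (he : ∀ a b, e a b = -1 ∨ e a b = 1)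
    {n n' m : ℕ} (f : Fin n → Fin N) (f' : Fin n' → Fin N)
    (h : n ≠ n') : nip (wickFn e f m) (wickFn e f' m) = 0 := by
  rw [wickFn, wickFn, nip_smul_left, nip_smul_right, nip_sum_left, Finset.sum_eq_zero, mul_zero,
    mul_zero]
  intro k hk
  rw [nip_sum_right, Finset.sum_eq_zero]
  intro k' hk'
  by_contra hne
  have h1 := oddLetters_eq_of_nip_ne_zero he hne
  have h2 := letters_injective f (Finset.mem_filter.1 hk).2
  have h3 := letters_injective f' (Finset.mem_filter.1 hk').2
  rw [oddLetters_of_injective h2, oddLetters_of_injective h3] at h1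
  have h4 := congrArg Finset.card h1
  rw [Finset.card_image_of_injective _ h2, Finset.card_image_of_injective _ h3] at h4
  simp at h4
  exact h h4

end Words

/-! ### The annihilation formula -/

section AnnihilationSum

variable {N : ℕ} {V : Type*} [AddCommMonoid V] [Module ℂ V] (Q : Matrix (Fin N) (Fin N) ℝ)

/-- Annihilating a later letter passes the first letter `k` at the cost of one factor `Q k j`. This
identity is the commutation relation evaluated on a word. -/
lemma annihilationSum_cons (w : List (Fin N) → V) (j k : Fin N) (i : List (Fin N)) :
    annihilationSum Q w j (k :: i) =
      (if j = k then w i else 0) + (Q k j : ℂ) • annihilationSum Q (fun i' => w (k :: i')) j i := by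
  simp only [annihilationSum, Finset.sum_filter, Finset.smul_sum]
  refine (Fin.sum_univ_succ (n := i.length) _).trans ?_
  congr 1
  · refine if_congr Iff.rfl ?_ rfl
    rw [Finset.prod_eq_one]
    · simp
    · intro r hr
      exact absurd (Finset.mem_filter.1 hr).2 (Nat.not_lt_zero r.1)
  · refine Finset.sum_congr rfl fun l _ => ?_
    simp only [Finset.prod_filter]
    rw [smul_ite, smul_zero]
    by_cases h : j = i.get l
    · rw [if_pos (by simpa using h), if_pos h, smul_smul]
      refine congrArg₂ _ ?_ rfl
      rw [← Complex.ofReal_mul]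
      congr 1
      refine (Fin.prod_univ_succ (n := i.length) _).trans ?_
      congr 1
      · rw [if_pos (Fin.succ_pos l)]
        simp [h]
      · refine Finset.prod_congr rfl fun r _ => ?_
        exact if_congr Fin.succ_lt_succ_iff rfl rfl
    · rw [if_neg (by simpa using h), if_neg h]

lemma map_annihilationSum {W : Type*} [AddCommMonoid W] [Module ℂ W] (g : V →ₗ[ℂ] W)
    (w : List (Fin N) → V) (j : Fin N) (i : List (Fin N)) :
    g (annihilationSum Q w j i) = annihilationSum Q (fun i' => g (w i')) j i := by
  simp [annihilationSum]

lemma prod_filter_lt_eq_prod_succAbove {n : ℕ} {M : Type*} [CommMonoid M] (l : Fin (n + 1))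
    (g : Fin (n + 1) → M) :
    ∏ r with r < l, g r = ∏ r : Fin n with r.castSucc < l, g (l.succAbove r) := by
  rw [Finset.prod_filter, Finset.prod_filter, Fin.prod_univ_succAbove _ l]
  simp [Fin.succAbove_lt_iff_castSucc_lt]

lemma ofFn_eraseIdx {n : ℕ} {α : Type*} (f : Fin (n + 1) → α) (l : Fin (n + 1)) :
    (List.ofFn f).eraseIdx l = List.ofFn fun r => f (l.succAbove r) := by
  refine List.ext_getElem ?_ fun r h1 h2 => ?_
  · rw [List.length_eraseIdx_of_lt (by simpa using Nat.le_of_lt_succ l.2)]; simp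
  · rw [List.getElem_eraseIdx]
    simp only [List.getElem_ofFn, Fin.succAbove, Fin.lt_def]
    simp only [List.length_ofFn] at h2
    split_ifs with h <;> simp_all

lemma annihilationSum_ofFn {n : ℕ} (w : List (Fin N) → V) (j : Fin N) (f : Fin (n + 1) → Fin N) :
    annihilationSum Q w j (List.ofFn f) = ∑ l, if j = f l then
      ((∏ r : Fin n with r.castSucc < l, Q (f (l.succAbove r)) (f l) : ℝ) : ℂ) •
        w (List.ofFn fun r => f (l.succAbove r)) else 0 := by
  rw [annihilationSum, Finset.sum_filter, ← (finCongr List.length_ofFn).symm.sum_comp]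
  refine Finset.sum_congr rfl fun l _ => ?_
  rw [← ofFn_eraseIdx, ← prod_filter_lt_eq_prod_succAbove l (fun r => Q (f r) (f l)),
    Finset.prod_filter, Finset.prod_filter, ← (finCongr List.length_ofFn).symm.prod_comp]
  have h : ∀ r, (List.ofFn f).get ((finCongr List.length_ofFn).symm r) = f r := by
    intro r
    exact List.get_ofFn f _
  simp only [h]
  rfl

end AnnihilationSum

/-! ### The action of the generators on the Wick words -/

section Action

variable {N : ℕ} {e : SpinIndexInf N → SpinIndexInf N → ℝ}

/-- The contribution to `x_j w(f)` of the terms where `x_j(k)` meets `x_{f l}(k)`. -/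
def contraction (e : SpinIndexInf N → SpinIndexInf N → ℝ) (j : Fin N) {n : ℕ} (f : Fin n → Fin N)
    (l : Fin n) (m : ℕ) : SpinMat N m :=
  ((Real.sqrt m : ℂ)⁻¹ ^ (n + 1)) •
    ∑ k : Fin n → Fin m with Function.Injective k, gen e m j (k l) * word e m f k

/-- The index of the new generator either avoids `k`, giving an injective tuple of length `n + 1`,
or equals `k l` for exactly one `l`. -/
lemma genSeq_mul_wickFn (j : Fin N) {n : ℕ} (f : Fin n → Fin N) (m : ℕ) :
    genSeq e j m * wickFn e f m =
      wickFn e (Fin.cons j f : Fin (n + 1) → Fin N) m + ∑ l, contraction e j f l m := by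
  classical
  have h1 : ∑ i : Fin m, gen e m j i * ∑ k with Function.Injective k, word e m f k =
      ∑ κ with Function.Injective κ, word e m (Fin.cons j f : Fin (n + 1) → Fin N) κ +
        ∑ l, ∑ k : Fin n → Fin m with Function.Injective k, gen e m j (k l) * word e m f k := by
    have h2 := sum_injective_succ (m := m) (0 : Fin (n + 1))
      fun i k => word e m (Fin.cons j f : Fin (n + 1) → Fin N) (Fin.cons i k)
    have h3 : ∀ κ : Fin (n + 1) → Fin m,
        (Fin.cons (κ 0) fun r => κ ((0 : Fin (n + 1)).succAbove r) : Fin (n + 1) → Fin m) = κ :=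
      fun κ => Fin.cons_self_tail κ
    simp only [h3] at h2
    rw [h2, Finset.sum_comm (s := Finset.univ (α := Fin n)), ← Finset.sum_add_distrib]
    simp only [Finset.mul_sum]
    rw [Finset.sum_comm]
    refine Finset.sum_congr rfl fun k hk => ?_
    simp only [← gen_mul_word]
    rw [← Finset.sum_filter_not_add_sum_filter Finset.univ (fun i => i ∈ Set.range k)]
    congr 1
    have h4 : (Finset.univ.filter fun i => i ∈ Set.range k) = Finset.univ.image k := by
      ext i; simp
    rw [h4, Finset.sum_image fun _ _ _ _ h => (Finset.mem_filter.1 hk).2 h]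
  rw [genSeq, wickFn, Matrix.smul_mul, Matrix.mul_smul, smul_smul, ← pow_succ', Finset.sum_mul, h1,
    smul_add]
  congr 1
  exact Finset.smul_sum

/-- As `j ≠ f l`, the letters stay distinct although an index is repeated, so almost orthogonality
applies. There are at most `m ^ n` terms, and the squared normalization is `m ^ (-(n + 1))`. -/
lemma tendsto_contraction_of_ne (he : ∀ a b, e a b = -1 ∨ e a b = 1) (j : Fin N) {n : ℕ}
    (f : Fin n → Fin N) (l : Fin n) (h : j ≠ f l) :
    Filter.Tendsto (fun m => (nip (contraction e j f l m) (contraction e j f l m)).re)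
      Filter.atTop (nhds 0) := by
  have h1 : ∀ m : ℕ, (nip (contraction e j f l m) (contraction e j f l m)).re ≤
      (n ^ n : ℕ) * (m : ℝ)⁻¹ := by
    intro m
    have h2 := nip_sum_injective_self_le he (m := m) (fun _ => (Fin.cons j f : Fin (n + 1) → Fin N))
      (fun k : Fin n → Fin m => Fin.cons (k l) k) ?_ ?_ ?_ (fun _ => 1)
    · simp only [one_smul, ← gen_mul_word, norm_one, one_pow, Finset.sum_const, nsmul_eq_mul,
        mul_one] at h2
      rw [contraction, nip_smul_self, norm_sqrt_inv_pow_sq]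
      have h3 : ((Finset.univ.filter fun k : Fin n → Fin m => Function.Injective k).card : ℝ) ≤
          (m : ℝ) ^ n := by exact_mod_cast card_injective_le n m
      rcases Nat.eq_zero_or_pos m with rfl | hm
      · simp
      have hm' : (0 : ℝ) < m := by exact_mod_cast hm
      rw [inv_mul_le_iff₀ (by positivity), pow_succ]
      refine h2.trans ?_
      rw [show (m : ℝ) ^ n * m * (((n ^ n : ℕ) : ℝ) * (m : ℝ)⁻¹) = (n ^ n : ℕ) * (m : ℝ) ^ n by
        field_simp]
      gcongr
    · intro k hk r r' hr
      rw [letters_eq_iff] at hr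
      obtain ⟨hr1, hr2⟩ := hr
      induction r using Fin.cases with
      | zero =>
        induction r' using Fin.cases with
        | zero => rfl
        | succ r' =>
          simp only [Fin.cons_zero, Fin.cons_succ] at hr1 hr2
          rw [← hk hr2] at hr1
          exact absurd hr1 h
      | succ r =>
        induction r' using Fin.cases with
        | zero =>
          simp only [Fin.cons_zero, Fin.cons_succ] at hr1 hr2
          rw [hk hr2] at hr1
          exact absurd hr1.symm h
        | succ r' =>
          simp only [Fin.cons_succ] at hr2
          rw [hk hr2]
    · intro k r
      induction r using Fin.cases with
      | zero => exact ⟨l, rfl⟩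
      | succ r => exact ⟨r, rfl⟩
    · exact fun k r => ⟨r.succ, rfl⟩
  refine squeeze_zero (fun m => (nipCore _).re_inner_nonneg _) h1 ?_
  simpa using (tendsto_inv_atTop_nhds_zero_nat (𝕜 := ℝ)).const_mul ((n ^ n : ℕ) : ℝ)

/-- Cancelling `x_{f l}(k l)` against its copy removes the letter at `l`. The index `k l` then
survives only in the signs, and summing over it turns them into an average like that of
`SignAverage`. -/
lemma contraction_eq (he : ∀ a b, e a b = -1 ∨ e a b = 1) (hs : ∀ a b, e a b = e b a)
    {n : ℕ} (f : Fin (n + 1) → Fin N) (l : Fin (n + 1)) (m : ℕ) :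
    contraction e (f l) f l m = ((Real.sqrt m : ℂ)⁻¹ ^ n) •
      ∑ k : Fin n → Fin m with Function.Injective k,
        (((m : ℝ)⁻¹ * ∑ i : Fin m with i ∉ Set.range k, ∏ r with r.castSucc < l,
          e (toLex (f (l.succAbove r), (k r : ℕ))) (toLex (f l, (i : ℕ))) : ℝ) : ℂ) •
          word e m (fun r => f (l.succAbove r)) k := by
  have h1 : ∀ k ∈ Finset.univ.filter fun k : Fin (n + 1) → Fin m => Function.Injective k,
      gen e m (f l) (k l) * word e m f k = ((∏ r with r.castSucc < l,
        e (toLex (f (l.succAbove r), (k (l.succAbove r) : ℕ))) (toLex (f l, (k l : ℕ))) : ℝ) : ℂ) •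
          word e m (fun r => f (l.succAbove r)) fun r => k (l.succAbove r) := by
    intro k hk
    have h2 := spinMatrix_mul_spinWord (e := fun a b : SpinIndex N m => e a.incl b.incl)
      (fun _ _ => he _ _) (fun _ _ => hs _ _) (letters f k)
      (letters_injective f (Finset.mem_filter.1 hk).2) l
    refine h2.trans ?_
    rw [Complex.ofReal_prod]
    rfl
  rw [contraction, Finset.sum_congr rfl h1, sum_injective_succ l fun i k =>
    ((∏ r with r.castSucc < l,
        e (toLex (f (l.succAbove r), (k r : ℕ))) (toLex (f l, (i : ℕ))) : ℝ) : ℂ) •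
          word e m (fun r => f (l.succAbove r)) k, pow_succ, pow_succ, mul_assoc, ← smul_smul]
  congr 1
  rw [Finset.smul_sum]
  refine Finset.sum_congr rfl fun k _ => ?_
  rw [← Finset.sum_smul, smul_smul]
  congr 1
  rw [← mul_inv, ← Complex.ofReal_mul, Real.mul_self_sqrt (Nat.cast_nonneg m)]
  push_cast
  rfl

/-- The coefficients differ from their limit by at most `η`, uniformly in the remaining indices, and
almost orthogonality turns this into the bound `n ^ n η²` for the squared norm. -/
lemma tendsto_contraction_sub (he : ∀ a b, e a b = -1 ∨ e a b = 1) (hs : ∀ a b, e a b = e b a)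
    {Q : Matrix (Fin N) (Fin N) ℝ} (hQe : SignAverage Q e)
    {n : ℕ} (f : Fin (n + 1) → Fin N) (l : Fin (n + 1)) :
    Filter.Tendsto (fun m => (nip
      (contraction e (f l) f l m - ((∏ r with r.castSucc < l, Q (f (l.succAbove r)) (f l) : ℝ) : ℂ) •
        wickFn e (fun r => f (l.succAbove r)) m)
      (contraction e (f l) f l m - ((∏ r with r.castSucc < l, Q (f (l.succAbove r)) (f l) : ℝ) : ℂ) •
        wickFn e (fun r => f (l.succAbove r)) m)).re) Filter.atTop (nhds 0) := by
  rw [Metric.tendsto_nhds]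
  intro δ hδ
  obtain ⟨η, hη, hηδ⟩ : ∃ η : ℝ, 0 < η ∧ ((n ^ n : ℕ) : ℝ) * η ^ 2 < δ := by
    have h : Filter.Tendsto (fun η : ℝ => ((n ^ n : ℕ) : ℝ) * η ^ 2) (nhds 0) (nhds 0) := by
      have : Continuous fun η : ℝ => ((n ^ n : ℕ) : ℝ) * η ^ 2 := by fun_prop
      simpa using this.tendsto 0
    have h2 := (h.mono_left (nhdsWithin_le_nhds (s := Set.Ioi 0))).eventually_lt_const hδ
    obtain ⟨η, h3, h4⟩ := (h2.and self_mem_nhdsWithin).exists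
    exact ⟨η, h4, h3⟩
  filter_upwards [hQe n (fun r => f (l.succAbove r)) (Finset.univ.filter fun r => r.castSucc < l)
    (f l) η hη] with m hm
  rw [Real.dist_eq, sub_zero, abs_of_nonneg (nip_self_nonneg _), contraction_eq he hs,
    wickFn, smul_comm, ← smul_sub, Finset.smul_sum, ← Finset.sum_sub_distrib]
  simp only [← sub_smul, ← Complex.ofReal_sub]
  rw [nip_smul_self, norm_sqrt_inv_pow_sq]
  have h2 := nip_sum_injective_self_le he (m := m) (fun _ r => f (l.succAbove r))
      (fun k : Fin n → Fin m => k) (fun k hk => letters_injective _ hk) (fun k r => ⟨r, rfl⟩)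
      (fun k r => ⟨r, rfl⟩) (fun k => (((m : ℝ)⁻¹ * ∑ i : Fin m with i ∉ Set.range k,
        ∏ r with r.castSucc < l,
          e (toLex (f (l.succAbove r), (k r : ℕ))) (toLex (f l, (i : ℕ))) -
          ∏ r with r.castSucc < l, Q (f (l.succAbove r)) (f l) : ℝ) : ℂ))
  refine lt_of_le_of_lt ?_ hηδ
  have h3 : ((Finset.univ.filter fun k : Fin n → Fin m => Function.Injective k).card : ℝ) ≤
      (m : ℝ) ^ n := by exact_mod_cast card_injective_le n m
  rcases eq_or_ne ((m : ℝ) ^ n) 0 with h0 | h0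
  · rw [h0, inv_zero, zero_mul]; positivity
  rw [inv_mul_le_iff₀ (lt_of_le_of_ne (by positivity) h0.symm)]
  refine h2.trans ?_
  rw [mul_left_comm]
  refine mul_le_mul_of_nonneg_left ?_ (by positivity)
  refine (Finset.sum_le_sum fun k hk => ?_).trans
    ((Finset.sum_const (η ^ 2)).le.trans ?_)
  · rw [Complex.norm_real, Real.norm_eq_abs]
    exact pow_le_pow_left₀ (abs_nonneg _) (hm k (Finset.mem_filter.1 hk).2) 2
  · rw [nsmul_eq_mul]
    gcongr

/-- In the limit, the generators act on the special Wick words by creation and annihilation. -/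
lemma tendsto_genSeq_mul_wickSeq_sub (he : ∀ a b, e a b = -1 ∨ e a b = 1)
    (hs : ∀ a b, e a b = e b a) {Q : Matrix (Fin N) (Fin N) ℝ} (hQe : SignAverage Q e)
    (j : Fin N) (i : List (Fin N)) :
    Filter.Tendsto (fun m => (nip
      (genSeq e j m * wickSeq e i m - (wickSeq e (j :: i) m + annihilationSum Q (wickSeq e) j i m))
      (genSeq e j m * wickSeq e i m -
        (wickSeq e (j :: i) m + annihilationSum Q (wickSeq e) j i m))).re)
      Filter.atTop (nhds 0) := by
  obtain ⟨n, f, rfl⟩ : ∃ (n : ℕ) (f : Fin n → Fin N), i = List.ofFn f :=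
    ⟨i.length, i.get, (List.ofFn_get i).symm⟩
  have hcons : j :: List.ofFn f = List.ofFn (Fin.cons j f : Fin (n + 1) → Fin N) := by
    rw [List.ofFn_succ]; simp
  simp only [hcons, wickSeq_ofFn, genSeq_mul_wickFn, add_sub_add_left_eq_sub]
  rcases n with _ | n
  · have : annihilationSum Q (wickSeq e) j (List.ofFn f) = 0 := by
      rw [List.ofFn_zero]; rfl
    simp only [this]
    simp [nip, ntrace]
  rw [annihilationSum_ofFn]
  simp only [Finset.sum_apply, ← Finset.sum_sub_distrib]
  have h1 : Filter.Tendsto (fun m => ((Finset.univ : Finset (Fin (n + 1))).card : ℝ) *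
      ∑ l, (nip (contraction e j f l m - (if j = f l then
      ((∏ r : Fin n with r.castSucc < l, Q (f (l.succAbove r)) (f l) : ℝ) : ℂ) •
        wickSeq e (List.ofFn fun r => f (l.succAbove r)) else 0) m)
        (contraction e j f l m - (if j = f l then
      ((∏ r : Fin n with r.castSucc < l, Q (f (l.succAbove r)) (f l) : ℝ) : ℂ) •
        wickSeq e (List.ofFn fun r => f (l.succAbove r)) else 0) m)).re)
      Filter.atTop (nhds 0) := by
    have h2 := (tendsto_finsetSum Finset.univ fun (l : Fin (n + 1)) _ =>
      (show Filter.Tendsto (fun m => (nip (contraction e j f l m - (if j = f l then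
      ((∏ r : Fin n with r.castSucc < l, Q (f (l.succAbove r)) (f l) : ℝ) : ℂ) •
        wickSeq e (List.ofFn fun r => f (l.succAbove r)) else 0) m)
        (contraction e j f l m - (if j = f l then
      ((∏ r : Fin n with r.castSucc < l, Q (f (l.succAbove r)) (f l) : ℝ) : ℂ) •
        wickSeq e (List.ofFn fun r => f (l.succAbove r)) else 0) m)).re)
      Filter.atTop (nhds 0) from ?_)).const_mul ((Finset.univ : Finset (Fin (n + 1))).card : ℝ)
    · simpa using h2
    · by_cases h : j = f l
      · subst h
        simp only [if_true, Pi.smul_apply, wickSeq_ofFn]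
        exact tendsto_contraction_sub he hs hQe f l
      · simp only [h, if_false, Pi.zero_apply, sub_zero]
        exact tendsto_contraction_of_ne he j f l h
  refine squeeze_zero (fun m => (nipCore _).re_inner_nonneg _) (fun m => ?_) h1
  exact nip_sum_self_le _ _

end Action

/-! ### Families of vectors with the relations of the mixed Fock space -/

section WickFamily

variable {N : ℕ} {H : Type*} [NormedAddCommGroup H] [InnerProductSpace ℂ H]

/-- The relations between the special Wick words: words of different lengths are orthogonal, and
creation is adjoint to annihilation. -/
structure IsWickFamily (Q : Matrix (Fin N) (Fin N) ℝ) (w : List (Fin N) → H) : Prop where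
  inner_nil : ⟪w [], w []⟫ = 1
  inner_eq_zero : ∀ i i' : List (Fin N), i.length ≠ i'.length → ⟪w i, w i'⟫ = 0
  inner_cons : ∀ j i i', ⟪w (j :: i), w i'⟫ = ⟪w i, annihilationSum Q w j i'⟫

lemma inner_annihilationSum_eq_zero {Q : Matrix (Fin N) (Fin N) ℝ} {w : List (Fin N) → H}
    (hw : ∀ i i' : List (Fin N), i.length ≠ i'.length → ⟪w i, w i'⟫ = 0) (j : Fin N)
    {i i' : List (Fin N)} (h : i.length + 1 ≠ i'.length) : ⟪w i, annihilationSum Q w j i'⟫ = 0 := by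
  rw [annihilationSum, inner_sum]
  refine Finset.sum_eq_zero fun l _ => ?_
  rw [inner_smul_right, hw, mul_zero]
  have h1 := List.length_eraseIdx_add_one l.2
  omega

end WickFamily

/-! ### The special Wick words in the ultraproduct -/

section WickWords

open Filter

variable {N : ℕ} {e : SpinIndexInf N → SpinIndexInf N → ℝ} {Q : Matrix (Fin N) (Fin N) ℝ}
  {U : Ultrafilter ℕ}

lemma wickSeq_nil : wickSeq e [] = fun _ => 1 := by
  funext m
  rw [wickSeq_eq_wickFn_get]
  have h : Function.Injective (default : Fin 0 → Fin m) := fun r => r.elim0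
  simp only [wickFn, List.length_nil, pow_zero, one_smul]
  rw [Finset.sum_filter, Fintype.sum_unique, if_pos h]
  rfl

lemma Represents.annihilationSum {w : List (Fin N) → L2A U e} (j : Fin N) (i : List (Fin N))
    (h : ∀ i' : List (Fin N), i'.length + 1 = i.length → Represents U (wickSeq e i') (w i')) :
    Represents U (annihilationSum Q (wickSeq e) j i) (annihilationSum Q w j i) := by
  have h1 := Represents.sum (U := U) (Finset.univ.filter fun l => j = i.get l)
    (y := fun l m => ((∏ r : Fin i.length with r < l, Q (i.get r) (i.get l) : ℝ) : ℂ) •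
      wickSeq e (i.eraseIdx l) m)
    (ξ := fun l => ((∏ r : Fin i.length with r < l, Q (i.get r) (i.get l) : ℝ) : ℂ) •
      w (i.eraseIdx l))
    fun l _ => (h _ (List.length_eraseIdx_add_one l.2)).smul _
  convert h1 using 1
  · funext m
    simp [MixedQGaussian.annihilationSum]
  · rfl

lemma tendsto_ultrafilter_genSeq_mul_wickSeq_sub (he : ∀ a b, e a b = -1 ∨ e a b = 1)
    (hs : ∀ a b, e a b = e b a) (hQe : SignAverage Q e) (hU : (U : Filter ℕ) ≤ cofinite)
    (j : Fin N) (i : List (Fin N)) :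
    Tendsto (fun m => (nip
      (genSeq e j m * wickSeq e i m - (wickSeq e (j :: i) m + annihilationSum Q (wickSeq e) j i m))
      (genSeq e j m * wickSeq e i m -
        (wickSeq e (j :: i) m + annihilationSum Q (wickSeq e) j i m))).re) U (nhds 0) :=
  (tendsto_genSeq_mul_wickSeq_sub he hs hQe j i).mono_left (Nat.cofinite_eq_atTop ▸ hU)

lemma nip_neg_neg {n : Type*} [Fintype n] (A : Matrix n n ℂ) : nip (-A) (-A) = nip A A := by
  simp [nip]

/-- Up to a null sequence, `w(j, i)` is `x_j w(i)` minus a combination of shorter words. The product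
with `x_j` represents a vector by the resolvent cutoff, since multiplying once or twice by `x_j`
preserves `L₂` boundedness. -/
lemma exists_represents_wickSeq (he : ∀ a b, e a b = -1 ∨ e a b = 1)
    (hs : ∀ a b, e a b = e b a) (hQe : SignAverage Q e) (hU : (U : Filter ℕ) ≤ cofinite)
    (i : List (Fin N)) : ∃ ξ : L2A U e, Represents U (wickSeq e i) ξ := by
  induction h : i.length using Nat.strong_induction_on generalizing i with
  | _ s ih =>
    subst h
    rcases i with _ | ⟨j, i⟩
    · rw [wickSeq_nil]
      exact IsBddSeq.one.exists_represents
    · have hsh : ∀ i' : List (Fin N), i'.length < (j :: i).length →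
          Represents U (wickSeq e i') (wick U e i') := fun i' h' =>
        represents_bullet (ih _ h' i' rfl)
      obtain ⟨η, hη⟩ := (hsh i (by simp)).genSeq_mul (genSeq_mul_wickSeq_mem_L2Seq he j i)
        (genSeq_mul_genSeq_mul_wickSeq_mem_L2Seq he j i)
      have ha := Represents.annihilationSum (Q := Q) j i fun i' h' => hsh i' (by simp; omega)
      refine ⟨_, (hη.sub ha).of_null (wickSeq_mem_L2Seq he _) ?_⟩
      refine (tendsto_ultrafilter_genSeq_mul_wickSeq_sub he hs hQe hU j i).congr fun m => ?_
      rw [← nip_neg_neg]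
      congr 2 <;> abel

lemma represents_wick (he : ∀ a b, e a b = -1 ∨ e a b = 1)
    (hs : ∀ a b, e a b = e b a) (hQe : SignAverage Q e) (hU : (U : Filter ℕ) ≤ cofinite)
    (i : List (Fin N)) : Represents U (wickSeq e i) (wick U e i) :=
  represents_bullet (exists_represents_wickSeq he hs hQe hU i)

lemma represents_genSeq_mul_wickSeq (he : ∀ a b, e a b = -1 ∨ e a b = 1)
    (hs : ∀ a b, e a b = e b a) (hQe : SignAverage Q e) (hU : (U : Filter ℕ) ≤ cofinite)
    (j : Fin N) (i : List (Fin N)) : Represents U (fun m => genSeq e j m * wickSeq e i m)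
      (wick U e (j :: i) + annihilationSum Q (wick U e) j i) := by
  have ha := Represents.annihilationSum (Q := Q) j i fun i' _ => represents_wick he hs hQe hU i'
  exact ((represents_wick he hs hQe hU (j :: i)).add ha).of_null
    (genSeq_mul_wickSeq_mem_L2Seq he j i)
    (tendsto_ultrafilter_genSeq_mul_wickSeq_sub he hs hQe hU j i)

lemma exists_represents_genSeq (he : ∀ a b, e a b = -1 ∨ e a b = 1)
    (hs : ∀ a b, e a b = e b a) (hQe : SignAverage Q e) (hU : (U : Filter ℕ) ≤ cofinite)
    (j : Fin N) : ∃ ξ : L2A U e, Represents U (genSeq e j) ξ := by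
  have h := represents_genSeq_mul_wickSeq he hs hQe hU j []
  simp only [wickSeq_nil, mul_one] at h
  exact ⟨_, h⟩

lemma wick_mem_generator_graph (he : ∀ a b, e a b = -1 ∨ e a b = 1)
    (hs : ∀ a b, e a b = e b a) (hQe : SignAverage Q e) (hU : (U : Filter ℕ) ≤ cofinite)
    (j : Fin N) (i : List (Fin N)) :
    (wick U e i, wick U e (j :: i) + annihilationSum Q (wick U e) j i) ∈
      (generator U e j).graph :=
  mem_generator_graph (exists_represents_genSeq he hs hQe hU j) (represents_wick he hs hQe hU i)
    (represents_genSeq_mul_wickSeq he hs hQe hU j i)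

lemma vacuum_eq_wick_nil : vacuum U e = wick U e [] := by
  rw [vacuum, wick, wickSeq_nil]

/-- For the adjoint relation, both sides of `⟪x_j w(i), w(i')⟫ = ⟪w(i), x_j w(i')⟫` are expanded. If
`i'` is one letter longer than `i`, orthogonality of lengths leaves only creation on the left and
annihilation on the right; otherwise both terms of the relation vanish. -/
lemma isWickFamily_wick (he : ∀ a b, e a b = -1 ∨ e a b = 1)
    (hs : ∀ a b, e a b = e b a) (hQe : SignAverage Q e) (hU : (U : Filter ℕ) ≤ cofinite) :
    IsWickFamily Q (wick U e) := by
  have h0 : ∀ i i' : List (Fin N), i.length ≠ i'.length → ⟪wick U e i, wick U e i'⟫ = 0 := by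
    intro i i' h
    refine tendsto_nhds_unique ((represents_wick he hs hQe hU i).tendsto
      (represents_wick he hs hQe hU i')) (tendsto_const_nhds.congr fun m => ?_)
    rw [wickSeq_eq_wickFn_get, wickSeq_eq_wickFn_get, nip_wickFn_eq_zero he _ _ h]
  refine ⟨?_, h0, fun j i i' => ?_⟩
  · refine tendsto_nhds_unique ((represents_wick he hs hQe hU []).tendsto
      (represents_wick he hs hQe hU [])) (tendsto_const_nhds.congr fun m => ?_)
    simp [wickSeq_nil, nip, ntrace]
  · by_cases h : i.length + 1 = i'.length
    · have h1 := (represents_wick he hs hQe hU i).inner_genSeq_mul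
        (represents_genSeq_mul_wickSeq he hs hQe hU j i) (represents_wick he hs hQe hU i')
        (represents_genSeq_mul_wickSeq he hs hQe hU j i')
      rw [inner_add_left, inner_add_right, h0 i (j :: i') (by simp; omega), zero_add] at h1
      have h2 : ⟪annihilationSum Q (wick U e) j i, wick U e i'⟫ = 0 := by
        rw [← inner_conj_symm, inner_annihilationSum_eq_zero h0 j (by omega), map_zero]
      rwa [h2, add_zero] at h1
    · rw [h0 _ _ (by simpa using h), inner_annihilationSum_eq_zero h0 j h]

end WickWords

/-! ### The crossing sum -/

section Bipartite

variable {N : ℕ} (Q : Matrix (Fin N) (Fin N) ℝ)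

/-- The bipartite crossing sum of two families of letters. -/
def crossingSum {n n' : ℕ} (f : Fin n → Fin N) (f' : Fin n' → Fin N) : ℝ :=
  ∑ π : Fin n ≃ Fin n' with ∀ r, f r = f' (π r),
    ∏ p : Fin n × Fin n with p.1 < p.2 ∧ π p.2 < π p.1, Q (f p.1) (f p.2)

lemma bipartiteSum_ofFn {n n' : ℕ} (f : Fin n → Fin N) (f' : Fin n' → Fin N) :
    bipartiteSum Q (List.ofFn f) (List.ofFn f') = crossingSum Q f f' := by
  have h : ∀ {a a' : ℕ} (h : a = n) (h' : a' = n'),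
      crossingSum Q (f ∘ Fin.cast h) (f' ∘ Fin.cast h') = crossingSum Q f f' := by
    rintro _ _ rfl rfl; rfl
  rw [← h (List.length_ofFn (f := f)) (List.length_ofFn (f := f'))]
  have h1 : ∀ {n : ℕ} (f : Fin n → Fin N), f ∘ Fin.cast List.length_ofFn = (List.ofFn f).get := by
    intro n f
    funext r
    exact (List.get_ofFn f r).symm
  rw [h1, h1]
  rfl

/-- The bijection that sends `l` to `0` and is given by `σ` on the other elements. -/
def insertZero {n n' : ℕ} (l : Fin (n + 1)) (σ : Fin n ≃ Fin n') : Fin (n + 1) ≃ Fin (n' + 1) :=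
  (finSuccEquiv' l).trans (σ.optionCongr.trans (finSuccEquiv' 0).symm)

@[simp]
lemma insertZero_self {n n' : ℕ} (l : Fin (n + 1)) (σ : Fin n ≃ Fin n') : insertZero l σ l = 0 := by
  simp [insertZero]

@[simp]
lemma insertZero_succAbove {n n' : ℕ} (l : Fin (n + 1)) (σ : Fin n ≃ Fin n') (r : Fin n) :
    insertZero l σ (l.succAbove r) = (σ r).succ := by
  simp [insertZero]

lemma insertZero_bijective {n n' : ℕ} : Function.Bijective
    fun p : Fin (n + 1) × (Fin n ≃ Fin n') => insertZero p.1 p.2 := by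
  constructor
  · rintro ⟨l, σ⟩ ⟨l', σ'⟩ h
    simp only at h
    have hl : l = l' := by
      apply (insertZero l σ).injective
      rw [insertZero_self, h, insertZero_self]
    subst hl
    refine Prod.ext rfl (Equiv.ext fun r => Fin.succ_injective _ ?_)
    rw [← insertZero_succAbove l, h, insertZero_succAbove]
  · intro π
    obtain ⟨l, hl⟩ : ∃ l, π l = 0 := ⟨π.symm 0, by simp⟩
    let ρ : Option (Fin n) ≃ Option (Fin n') :=
      (finSuccEquiv' l).symm.trans (π.trans (finSuccEquiv' 0))
    have hρ : ρ none = none := by simp [ρ, hl]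
    refine ⟨(l, Equiv.removeNone ρ), Equiv.ext fun x => ?_⟩
    induction x using Fin.succAboveCases l with
    | x => simp [hl]
    | p r =>
      rw [insertZero_succAbove]
      have h1 : some (Equiv.removeNone ρ r) = ρ (some r) :=
        Equiv.removeNone_some ρ (Option.ne_none_iff_exists'.1 fun h =>
          Option.some_ne_none r (ρ.injective (h.trans hρ.symm)))
      have h2 : ρ (some r) = finSuccEquiv' 0 (π (l.succAbove r)) := by simp [ρ]
      rw [h2] at h1
      have h3 := congrArg (finSuccEquiv' (0 : Fin (n' + 1))).symm h1
      simpa using h3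

/-- The pair `(l, 0)` is crossed exactly by the pairs that start before `l`, because every other
image exceeds `0`. The remaining crossings are those of `σ`. -/
lemma prod_crossings_insertZero {n n' : ℕ} (l : Fin (n + 1)) (σ : Fin n ≃ Fin n')
    (g : Fin (n + 1) → Fin (n + 1) → ℝ) :
    ∏ p : Fin (n + 1) × Fin (n + 1) with p.1 < p.2 ∧ insertZero l σ p.2 < insertZero l σ p.1,
      g p.1 p.2 = (∏ r with r.castSucc < l, g (l.succAbove r) l) *
        ∏ p : Fin n × Fin n with p.1 < p.2 ∧ σ p.2 < σ p.1,
          g (l.succAbove p.1) (l.succAbove p.2) := by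
  simp only [Finset.prod_filter, Fintype.prod_prod_type]
  rw [Fin.prod_univ_succAbove _ l]
  simp only [Fin.prod_univ_succAbove (fun x => ite _ (g _ x) 1) l, insertZero_self,
    insertZero_succAbove, Fin.not_lt_zero, and_false, if_false, Finset.prod_const_one, one_mul,
    Fin.succ_pos, and_true, Fin.succ_lt_succ_iff, Fin.succAbove_lt_iff_castSucc_lt,
    (Fin.strictMono_succAbove l).lt_iff_lt,
    Finset.prod_mul_distrib]

lemma crossingSum_cons {n n' : ℕ} (f : Fin (n + 1) → Fin N) (j : Fin N) (f' : Fin n' → Fin N) :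
    crossingSum Q f (Fin.cons j f' : Fin (n' + 1) → Fin N) = ∑ l, if j = f l then
      (∏ r : Fin n with r.castSucc < l, Q (f (l.succAbove r)) (f l)) *
        crossingSum Q (fun r => f (l.succAbove r)) f' else 0 := by
  rw [crossingSum, Finset.sum_filter,
    ← insertZero_bijective.sum_comp, Fintype.sum_prod_type]
  refine Finset.sum_congr rfl fun l _ => ?_
  simp only [Fin.forall_iff_succAbove l, insertZero_self, insertZero_succAbove, Fin.cons_zero,
    Fin.cons_succ, prod_crossings_insertZero l _ fun a b => Q (f a) (f b)]
  by_cases h : j = f l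
  · rw [if_pos h, crossingSum, Finset.sum_filter, Finset.mul_sum]
    refine Finset.sum_congr rfl fun σ _ => ?_
    simp only [h, true_and, mul_ite, mul_zero]
  · rw [if_neg h]
    refine Finset.sum_eq_zero fun σ _ => if_neg fun h' => h h'.1.symm

lemma bipartiteSum_nil_nil : bipartiteSum Q [] [] = 1 := by
  rw [← List.ofFn_zero (f := fun r : Fin 0 => (r.elim0 : Fin N)), bipartiteSum_ofFn, crossingSum]
  simp

lemma bipartiteSum_eq_zero_of_not_perm {i i' : List (Fin N)}
    (h : (i : Multiset (Fin N)) ≠ (i' : Multiset (Fin N))) : bipartiteSum Q i i' = 0 := by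
  rw [bipartiteSum, Finset.filter_eq_empty_iff.2, Finset.sum_empty]
  intro π _ hπ
  apply h
  have h1 : ∀ i : List (Fin N), (i : Multiset (Fin N)) =
      (Finset.univ : Finset (Fin i.length)).val.map i.get := by
    intro i
    simp [Fin.univ_val_map]
  rw [h1 i, h1 i', ← Finset.map_univ_equiv π, Finset.map_val, Multiset.map_map]
  exact Multiset.map_congr rfl fun r _ => hπ r

lemma bipartiteSum_cons (i : List (Fin N)) (j : Fin N) (i' : List (Fin N)) :
    bipartiteSum Q i (j :: i') = ∑ l : Fin i.length with j = i.get l,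
      (∏ r : Fin i.length with r < l, Q (i.get r) (i.get l)) *
        bipartiteSum Q (i.eraseIdx l) i' := by
  obtain ⟨n, f, rfl⟩ : ∃ (n : ℕ) (f : Fin n → Fin N), i = List.ofFn f :=
    ⟨i.length, i.get, (List.ofFn_get i).symm⟩
  rcases n with _ | n
  · rw [bipartiteSum_eq_zero_of_not_perm, Finset.sum_eq_zero]
    · exact fun l => (Fin.cast List.length_ofFn l).elim0
    · exact fun h => by simpa using congrArg Multiset.card h
  · have h1 := annihilationSum_ofFn Q (fun i => ((bipartiteSum Q i i' : ℝ) : ℂ)) j f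
    simp only [annihilationSum, smul_eq_mul] at h1
    obtain ⟨n', f', rfl⟩ : ∃ (n' : ℕ) (f' : Fin n' → Fin N), i' = List.ofFn f' :=
      ⟨i'.length, i'.get, (List.ofFn_get i').symm⟩
    have hcons : j :: List.ofFn f' = List.ofFn (Fin.cons j f' : Fin (n' + 1) → Fin N) := by
      rw [List.ofFn_succ]; simp
    rw [hcons, bipartiteSum_ofFn, crossingSum_cons, ← Complex.ofReal_inj]
    push_cast at h1 ⊢
    rw [h1]
    refine Finset.sum_congr rfl fun l _ => ?_
    split_ifs <;> simp [bipartiteSum_ofFn]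

variable {H : Type*} [NormedAddCommGroup H] [InnerProductSpace ℂ H] {Q}

/-- Moving the first letter of `i'` across the inner product yields the recursion obtained for the
crossing sum by choosing the partner of that letter. -/
lemma IsWickFamily.inner_eq_bipartiteSum {w : List (Fin N) → H} (hw : IsWickFamily Q w)
    (i i' : List (Fin N)) : ⟪w i', w i⟫ = ((bipartiteSum Q i i' : ℝ) : ℂ) := by
  induction i' generalizing i with
  | nil =>
    rcases i with _ | ⟨j, i⟩
    · rw [hw.inner_nil, bipartiteSum_nil_nil, Complex.ofReal_one]
    · rw [hw.inner_eq_zero _ _ (by simp), bipartiteSum_eq_zero_of_not_perm _ (by simp),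
        Complex.ofReal_zero]
  | cons j i' ih =>
    rw [hw.inner_cons, bipartiteSum_cons, annihilationSum, inner_sum]
    simp only [inner_smul_right, ih]
    push_cast
    rfl

lemma IsWickFamily.inner_eq {w : List (Fin N) → H} (hw : IsWickFamily Q w)
    (i i' : List (Fin N)) : ⟪w i', w i⟫ =
      if (i : Multiset (Fin N)) = (i' : Multiset (Fin N)) then
        ((bipartiteSum Q i i' : ℝ) : ℂ) else 0 := by
  rw [hw.inner_eq_bipartiteSum]
  split_ifs with h
  · rfl
  · rw [bipartiteSum_eq_zero_of_not_perm Q h, Complex.ofReal_zero]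

end Bipartite

/-! ### Creation and annihilation operators -/

section FockOperators

variable {N : ℕ} {H : Type*} [NormedAddCommGroup H] [InnerProductSpace ℂ H]
  {Q : Matrix (Fin N) (Fin N) ℝ} {w : List (Fin N) → H}

/-- The span of the vectors of length `s`. -/
def level (w : List (Fin N) → H) (s : ℕ) : Submodule ℂ H :=
  Submodule.span ℂ (w '' {i | i.length = s})

/-- The span of the vectors of length less than `s`. -/
def levelsBelow (w : List (Fin N) → H) (s : ℕ) : Submodule ℂ H :=
  Submodule.span ℂ (w '' {i | i.length < s})

instance (w : List (Fin N) → H) (s : ℕ) : FiniteDimensional ℂ (level w s) :=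
  FiniteDimensional.span_of_finite ℂ ((List.finite_length_eq (Fin N) s).image _)

instance (w : List (Fin N) → H) (s : ℕ) : FiniteDimensional ℂ (levelsBelow w s) :=
  FiniteDimensional.span_of_finite ℂ ((List.finite_length_lt (Fin N) s).image _)

/-- The graph of the creation operator. -/
def creationGraph (w : List (Fin N) → H) (j : Fin N) : Submodule ℂ (H × H) :=
  Submodule.span ℂ (Set.range fun i => (w i, w (j :: i)))

/-- The graph of the annihilation operator. -/
def annihilationGraph (Q : Matrix (Fin N) (Fin N) ℝ) (w : List (Fin N) → H) (j : Fin N) :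
    Submodule ℂ (H × H) :=
  Submodule.span ℂ (Set.range fun i => (w i, annihilationSum Q w j i))

lemma mem_level (w : List (Fin N) → H) (i : List (Fin N)) : w i ∈ level w i.length :=
  Submodule.subset_span ⟨i, rfl, rfl⟩

lemma mem_creationGraph (w : List (Fin N) → H) (j : Fin N) (i : List (Fin N)) :
    (w i, w (j :: i)) ∈ creationGraph w j := Submodule.subset_span ⟨i, rfl⟩

lemma mem_annihilationGraph (Q : Matrix (Fin N) (Fin N) ℝ) (w : List (Fin N) → H) (j : Fin N)
    (i : List (Fin N)) : (w i, annihilationSum Q w j i) ∈ annihilationGraph Q w j :=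
  Submodule.subset_span ⟨i, rfl⟩

lemma annihilationSum_mem {K : Submodule ℂ H} (j : Fin N) {i : List (Fin N)}
    (h : ∀ i' : List (Fin N), i'.length + 1 = i.length → w i' ∈ K) :
    annihilationSum Q w j i ∈ K :=
  Submodule.sum_mem _ fun l _ => K.smul_mem _ (h _ (List.length_eraseIdx_add_one l.2))

lemma exists_mem_creationGraph (j : Fin N) {S : Set (List (Fin N))} {K : Submodule ℂ H}
    (h : ∀ i ∈ S, w (j :: i) ∈ K) {u : H} (hu : u ∈ Submodule.span ℂ (w '' S)) :
    ∃ v ∈ K, (u, v) ∈ creationGraph w j := by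
  induction hu using Submodule.span_induction with
  | mem x hx =>
    obtain ⟨i, hi, rfl⟩ := hx
    exact ⟨_, h i hi, mem_creationGraph w j i⟩
  | zero => exact ⟨0, zero_mem _, zero_mem (creationGraph w j)⟩
  | add x y _ _ hx hy =>
    obtain ⟨v, hv, hv'⟩ := hx
    obtain ⟨v', h1, h2⟩ := hy
    exact ⟨v + v', add_mem hv h1, add_mem hv' h2⟩
  | smul a x _ hx =>
    obtain ⟨v, hv, hv'⟩ := hx
    exact ⟨a • v, K.smul_mem a hv, Submodule.smul_mem _ a hv'⟩

lemma exists_mem_annihilationGraph (Q : Matrix (Fin N) (Fin N) ℝ) (j : Fin N)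
    {S : Set (List (Fin N))} {K : Submodule ℂ H}
    (h : ∀ i ∈ S, annihilationSum Q w j i ∈ K) {u : H} (hu : u ∈ Submodule.span ℂ (w '' S)) :
    ∃ v ∈ K, (u, v) ∈ annihilationGraph Q w j := by
  induction hu using Submodule.span_induction with
  | mem x hx =>
    obtain ⟨i, hi, rfl⟩ := hx
    exact ⟨_, h i hi, mem_annihilationGraph Q w j i⟩
  | zero => exact ⟨0, zero_mem _, zero_mem (annihilationGraph Q w j)⟩
  | add x y _ _ hx hy =>
    obtain ⟨v, hv, hv'⟩ := hx
    obtain ⟨v', h1, h2⟩ := hy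
    exact ⟨v + v', add_mem hv h1, add_mem hv' h2⟩
  | smul a x _ hx =>
    obtain ⟨v, hv, hv'⟩ := hx
    exact ⟨a • v, K.smul_mem a hv, Submodule.smul_mem _ a hv'⟩

lemma fst_mem_of_mem_creationGraph {j : Fin N} {p : H × H} (hp : p ∈ creationGraph w j) :
    p.1 ∈ Submodule.span ℂ (Set.range w) ∧ p.2 ∈ Submodule.span ℂ (Set.range w) := by
  have h : creationGraph w j ≤
      (Submodule.span ℂ (Set.range w)).prod (Submodule.span ℂ (Set.range w)) := by
    rw [creationGraph, Submodule.span_le]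
    rintro _ ⟨i, rfl⟩
    exact ⟨Submodule.subset_span ⟨i, rfl⟩, Submodule.subset_span ⟨_, rfl⟩⟩
  exact h hp

lemma fst_mem_of_mem_annihilationGraph {j : Fin N} {p : H × H}
    (hp : p ∈ annihilationGraph Q w j) :
    p.1 ∈ Submodule.span ℂ (Set.range w) ∧ p.2 ∈ Submodule.span ℂ (Set.range w) := by
  have h : annihilationGraph Q w j ≤
      (Submodule.span ℂ (Set.range w)).prod (Submodule.span ℂ (Set.range w)) := by
    rw [annihilationGraph, Submodule.span_le]
    rintro _ ⟨i, rfl⟩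
    exact ⟨Submodule.subset_span ⟨i, rfl⟩,
      annihilationSum_mem j fun i' _ => Submodule.subset_span ⟨i', rfl⟩⟩
  exact h hp

lemma map_fst_creationGraph (w : List (Fin N) → H) (j : Fin N) :
    (creationGraph w j).map (LinearMap.fst ℂ H H) = Submodule.span ℂ (Set.range w) := by
  rw [creationGraph, Submodule.map_span, ← Set.range_comp]
  rfl

lemma map_fst_annihilationGraph (Q : Matrix (Fin N) (Fin N) ℝ) (w : List (Fin N) → H)
    (j : Fin N) :
    (annihilationGraph Q w j).map (LinearMap.fst ℂ H H) = Submodule.span ℂ (Set.range w) := by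
  rw [annihilationGraph, Submodule.map_span, ← Set.range_comp]
  rfl

lemma eq_zero_of_mem_span_of_inner {u : H} (hu : u ∈ Submodule.span ℂ (Set.range w))
    (h : ∀ i, ⟪u, w i⟫ = 0) : u = 0 := by
  have h1 : Submodule.span ℂ (Set.range w) ≤ (ℂ ∙ u)ᗮ := by
    rw [Submodule.span_le]
    rintro _ ⟨i, rfl⟩
    exact Submodule.mem_orthogonal_singleton_iff_inner_right.2 (h i)
  exact inner_self_eq_zero.1 (Submodule.mem_orthogonal_singleton_iff_inner_right.1 (h1 hu))

namespace IsWickFamily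

lemma inner_graph (hw : IsWickFamily Q w) {j : Fin N} {p q : H × H} (hp : p ∈ creationGraph w j)
    (hq : q ∈ annihilationGraph Q w j) : ⟪p.2, q.1⟫ = ⟪p.1, q.2⟫ := by
  induction hp using Submodule.span_induction with
  | mem p hp =>
    obtain ⟨i, rfl⟩ := hp
    induction hq using Submodule.span_induction with
    | mem q hq =>
      obtain ⟨i', rfl⟩ := hq
      exact hw.inner_cons j i i'
    | zero => simp
    | add x y _ _ hx hy => simp only [Prod.fst_add, Prod.snd_add, inner_add_right, hx, hy]
    | smul a x _ hx => simp only [Prod.smul_fst, Prod.smul_snd, inner_smul_right, hx]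
  | zero => simp
  | add x y _ _ hx hy => simp only [Prod.fst_add, Prod.snd_add, inner_add_left, hx, hy]
  | smul a x _ hx => simp only [Prod.smul_fst, Prod.smul_snd, inner_smul_left, hx]

/-- The Wick words may be linearly dependent, so it has to be checked that the relation is a map. If
`p.1 = 0`, formal adjointness makes `p.2` orthogonal to all `w i`, while `p.2` lies in their span.
-/
lemma creationGraph_fst_eq_zero (hw : IsWickFamily Q w) (j : Fin N) :
    ∀ p ∈ creationGraph w j, p.1 = 0 → p.2 = 0 := by
  intro p hp h0
  refine eq_zero_of_mem_span_of_inner (fst_mem_of_mem_creationGraph hp).2 fun i => ?_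
  rw [hw.inner_graph hp (mem_annihilationGraph Q w j i), h0, inner_zero_left]

lemma annihilationGraph_fst_eq_zero (hw : IsWickFamily Q w) (j : Fin N) :
    ∀ p ∈ annihilationGraph Q w j, p.1 = 0 → p.2 = 0 := by
  intro p hp h0
  refine eq_zero_of_mem_span_of_inner (fst_mem_of_mem_annihilationGraph hp).2 fun i => ?_
  rw [← inner_conj_symm, ← hw.inner_graph (mem_creationGraph w j i) hp, h0, inner_zero_right,
    map_zero]

lemma creationGraph_unique (hw : IsWickFamily Q w) {j : Fin N} {u v v' : H}
    (h : (u, v) ∈ creationGraph w j) (h' : (u, v') ∈ creationGraph w j) : v = v' :=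
  sub_eq_zero.1 (hw.creationGraph_fst_eq_zero j _ (sub_mem h h') (sub_self u))

lemma annihilationGraph_unique (hw : IsWickFamily Q w) {j : Fin N} {u v v' : H}
    (h : (u, v) ∈ annihilationGraph Q w j) (h' : (u, v') ∈ annihilationGraph Q w j) : v = v' :=
  sub_eq_zero.1 (hw.annihilationGraph_fst_eq_zero j _ (sub_mem h h') (sub_self u))

/-- A linear relation that contains all `(w i, c_j w i + a_j w i)` contains `c_j + a_j`. -/
lemma add_mem_of_mem_graph (hw : IsWickFamily Q w) {j : Fin N} {X : Submodule ℂ (H × H)}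
    (hX : ∀ i, (w i, w (j :: i) + annihilationSum Q w j i) ∈ X) {u v z : H}
    (hv : (u, v) ∈ creationGraph w j) (hz : (u, z) ∈ annihilationGraph Q w j) :
    (u, v + z) ∈ X := by
  have h : ∃ v z, (u, v) ∈ creationGraph w j ∧ (u, z) ∈ annihilationGraph Q w j ∧
      (u, v + z) ∈ X := by
    have hu := (fst_mem_of_mem_creationGraph hv).1
    clear hv hz
    simp only at hu
    induction hu using Submodule.span_induction with
    | mem x hx =>
      obtain ⟨i, rfl⟩ := hx
      exact ⟨_, _, mem_creationGraph w j i, mem_annihilationGraph Q w j i, hX i⟩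
    | zero => exact ⟨0, 0, zero_mem (creationGraph w j), zero_mem (annihilationGraph Q w j),
        by rw [add_zero]; exact zero_mem X⟩
    | add x y _ _ hx hy =>
      obtain ⟨v, z, h1, h2, h3⟩ := hx
      obtain ⟨v', z', h1', h2', h3'⟩ := hy
      refine ⟨v + v', z + z', add_mem h1 h1', add_mem h2 h2', ?_⟩
      rw [add_add_add_comm]
      exact add_mem h3 h3'
    | smul a x _ hx =>
      obtain ⟨v, z, h1, h2, h3⟩ := hx
      refine ⟨a • v, a • z, Submodule.smul_mem _ a h1, Submodule.smul_mem _ a h2, ?_⟩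
      rw [← smul_add]
      exact X.smul_mem a h3
  obtain ⟨v', z', h1, h2, h3⟩ := h
  rwa [hw.creationGraph_unique hv h1, hw.annihilationGraph_unique hz h2]

lemma isOrtho_level (hw : IsWickFamily Q w) {s t : ℕ} (h : s ≠ t) : level w s ⟂ level w t := by
  rw [level, level, Submodule.isOrtho_span]
  rintro _ ⟨i, hi, rfl⟩ _ ⟨i', hi', rfl⟩
  rw [Set.mem_ofPred_eq] at hi hi'
  exact hw.inner_eq_zero i i' (by omega)

end IsWickFamily

lemma exists_mem_level_creation (w : List (Fin N) → H) (j : Fin N) {s : ℕ} {u : H}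
    (hu : u ∈ level w s) : ∃ v ∈ level w (s + 1), (u, v) ∈ creationGraph w j :=
  exists_mem_creationGraph j (S := {i | i.length = s}) (K := level w (s + 1)) (fun i hi =>
    Submodule.subset_span ⟨j :: i, by simpa using hi, rfl⟩) hu

lemma exists_mem_level_annihilation (Q : Matrix (Fin N) (Fin N) ℝ) (w : List (Fin N) → H)
    (j : Fin N) {s : ℕ} {u : H}
    (hu : u ∈ level w (s + 1)) : ∃ v ∈ level w s, (u, v) ∈ annihilationGraph Q w j :=
  exists_mem_annihilationGraph Q j (S := {i | i.length = s + 1}) (K := level w s) (fun i hi =>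
    annihilationSum_mem j fun i' hi' => Submodule.subset_span ⟨i', by
      rw [Set.mem_ofPred_eq] at hi ⊢; omega, rfl⟩) hu

lemma mem_annihilationGraph_of_mem_level_zero (Q : Matrix (Fin N) (Fin N) ℝ)
    (w : List (Fin N) → H) (j : Fin N) {u : H} (hu : u ∈ level w 0) :
    (u, 0) ∈ annihilationGraph Q w j := by
  obtain ⟨v, hv, h⟩ := exists_mem_annihilationGraph Q j (S := {i | i.length = 0}) (K := ⊥)
    (fun i hi => annihilationSum_mem j fun i' hi' => by
      rw [Set.mem_ofPred_eq] at hi; omega) hu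
  rwa [(Submodule.mem_bot ℂ).1 hv] at h

/-- The `q`-commutation relation. -/
lemma exists_commutation (Q : Matrix (Fin N) (Fin N) ℝ) (w : List (Fin N) → H) (j k : Fin N)
    {u : H} (hu : u ∈ Submodule.span ℂ (Set.range w)) :
    ∃ v y z t, (u, v) ∈ creationGraph w j ∧ (v, y) ∈ annihilationGraph Q w k ∧
      (u, z) ∈ annihilationGraph Q w k ∧ (z, t) ∈ creationGraph w j ∧
      y - (Q j k : ℂ) • t = if j = k then u else 0 := by
  induction hu using Submodule.span_induction with
  | mem x hx =>
    obtain ⟨i, rfl⟩ := hx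
    refine ⟨_, _, _, annihilationSum Q (fun i' => w (j :: i')) k i, mem_creationGraph w j i,
      mem_annihilationGraph Q w k _, mem_annihilationGraph Q w k i, ?_, ?_⟩
    · have h : ((annihilationSum Q w k i, annihilationSum Q (fun i' => w (j :: i')) k i) : H × H) =
          annihilationSum Q (fun i' => (w i', w (j :: i'))) k i := by
        refine Prod.ext ?_ ?_
        · exact (map_annihilationSum Q
            (LinearMap.fst ℂ H H) (fun i' => (w i', w (j :: i'))) k i).symm
        · exact (map_annihilationSum Q
            (LinearMap.snd ℂ H H) (fun i' => (w i', w (j :: i'))) k i).symm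
      rw [h]
      exact Submodule.sum_mem _ fun l _ => Submodule.smul_mem _ _ (mem_creationGraph w j _)
    · rw [annihilationSum_cons, add_sub_cancel_right]
      simp only [eq_comm]
  | zero =>
    exact ⟨0, 0, 0, 0, zero_mem (creationGraph w j), zero_mem (annihilationGraph Q w k),
      zero_mem (annihilationGraph Q w k), zero_mem (creationGraph w j), by simp⟩
  | add x x' _ _ hx hx' =>
    obtain ⟨v, y, z, t, h1, h2, h3, h4, h5⟩ := hx
    obtain ⟨v', y', z', t', h1', h2', h3', h4', h5'⟩ := hx'
    refine ⟨v + v', y + y', z + z', t + t', add_mem h1 h1', add_mem h2 h2', add_mem h3 h3',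
      add_mem h4 h4', ?_⟩
    rw [smul_add, add_sub_add_comm, h5, h5']
    split_ifs <;> simp
  | smul a x _ hx =>
    obtain ⟨v, y, z, t, h1, h2, h3, h4, h5⟩ := hx
    refine ⟨a • v, a • y, a • z, a • t, Submodule.smul_mem _ a h1, Submodule.smul_mem _ a h2,
      Submodule.smul_mem _ a h3, Submodule.smul_mem _ a h4, ?_⟩
    rw [smul_comm, ← smul_sub, h5]
    split_ifs <;> simp

/-- The commutation relation gives `‖c u‖² = ‖u‖² + q(j, j) ‖a u‖²` with `q(j, j) ≤ 1`. On level `s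
+ 1`, the bound `‖a u‖² = ⟪u, c a u⟫ ≤ ‖u‖ ‖c a u‖` and the induction hypothesis for `a u` on level
`s` give `‖a u‖² ≤ (s + 1) ‖u‖²`. -/
lemma IsWickFamily.norm_sq_creation_le (hw : IsWickFamily Q w)
    (hQ : ∀ i j, Q i j ∈ Set.Icc (-1 : ℝ) 1) {j : Fin N} {s : ℕ} {u v : H} (hu : u ∈ level w s)
    (hv : (u, v) ∈ creationGraph w j) : ‖v‖ ^ 2 ≤ (s + 1) * ‖u‖ ^ 2 := by
  induction s generalizing u v with
  | zero =>
    have hz := mem_annihilationGraph_of_mem_level_zero Q w j hu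
    obtain ⟨v', y, z, t, h1, h2, h3, h4, h5⟩ :=
      exists_commutation Q w j j (fst_mem_of_mem_creationGraph hv).1
    rw [if_pos rfl] at h5
    obtain rfl := hw.creationGraph_unique hv h1
    obtain rfl := hw.annihilationGraph_unique hz h3
    obtain rfl := hw.creationGraph_fst_eq_zero j _ h4 rfl
    have h6 := congrArg Complex.re (hw.inner_graph hv h2)
    simp only [smul_zero, sub_zero] at h5
    subst h5
    rw [re_inner_self, re_inner_self] at h6
    simp [h6]
  | succ s ih =>
    obtain ⟨v', y, z, t, h1, h2, h3, h4, h5⟩ :=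
      exists_commutation Q w j j (fst_mem_of_mem_creationGraph hv).1
    obtain ⟨z', hz', h3'⟩ := exists_mem_level_annihilation Q w j hu
    rw [if_pos rfl] at h5
    obtain rfl := hw.creationGraph_unique hv h1
    obtain rfl := hw.annihilationGraph_unique h3 h3'
    have h6 := congrArg Complex.re (hw.inner_graph hv h2)
    have h7 : ⟪t, u⟫ = ⟪z, z⟫ := hw.inner_graph h4 h3
    have h8 : (⟪u, t⟫).re = ‖z‖ ^ 2 := by
      rw [← inner_conj_symm, h7, Complex.conj_re, re_inner_self]
    obtain rfl : y = u + (Q j j : ℂ) • t := sub_eq_iff_eq_add.1 h5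
    simp only [inner_add_right, inner_smul_right, Complex.add_re, Complex.re_ofReal_mul,
      re_inner_self, h8] at h6
    have h9 : ‖t‖ ^ 2 ≤ (s + 1) * ‖z‖ ^ 2 := ih hz' h4
    have h10 : ‖z‖ ^ 2 ≤ ‖u‖ * ‖t‖ := by
      rw [← h8]
      exact (Complex.re_le_norm _).trans (norm_inner_le_norm _ _)
    have h11 : ‖z‖ ^ 2 ≤ (s + 1) * ‖u‖ ^ 2 := by
      rcases eq_or_lt_of_le (sq_nonneg ‖z‖) with h0 | h0
      · rw [← h0]; positivity
      · have h12 : ‖z‖ ^ 2 * ‖z‖ ^ 2 ≤ ((s + 1) * ‖u‖ ^ 2) * ‖z‖ ^ 2 := by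
          calc ‖z‖ ^ 2 * ‖z‖ ^ 2 ≤ (‖u‖ * ‖t‖) * (‖u‖ * ‖t‖) :=
                mul_le_mul h10 h10 (by positivity) (by positivity)
            _ = ‖u‖ ^ 2 * ‖t‖ ^ 2 := by ring
            _ ≤ ‖u‖ ^ 2 * ((s + 1) * ‖z‖ ^ 2) := by gcongr
            _ = _ := by ring
        exact le_of_mul_le_mul_right h12 h0
    have h12 : Q j j * ‖z‖ ^ 2 ≤ ‖z‖ ^ 2 := mul_le_of_le_one_left (sq_nonneg _) (hQ j j).2
    push_cast
    linarith

variable [CompleteSpace H]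

/-- The adjoint of the creation operator is the closure of the annihilation operator. -/
lemma IsWickFamily.adjoint_creation (hw : IsWickFamily Q w)
    (hd : Dense (Submodule.span ℂ (Set.range w) : Set H)) (j : Fin N) :
    LinearPMap.adjoint (𝕜 := ℂ) (creationGraph w j).toLinearPMap =
        (annihilationGraph Q w j).toLinearPMap.closure ∧
      (annihilationGraph Q w j).toLinearPMap ≤
        LinearPMap.adjoint (𝕜 := ℂ) (creationGraph w j).toLinearPMap := by
  have hC := (creationGraph w j).toLinearPMap_graph_eq (hw.creationGraph_fst_eq_zero j)
  have hA := (annihilationGraph Q w j).toLinearPMap_graph_eq (hw.annihilationGraph_fst_eq_zero j)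
  have hdom : Dense ((creationGraph w j).toLinearPMap.domain : Set H) := by
    rwa [Submodule.toLinearPMap_domain, map_fst_creationGraph]
  have hle : (annihilationGraph Q w j).toLinearPMap ≤
      LinearPMap.adjoint (𝕜 := ℂ) (creationGraph w j).toLinearPMap := by
    refine LinearPMap.le_of_le_graph fun q hq => ?_
    rw [hA] at hq
    refine (mem_adjoint_graph_iff hdom (u := q.1) (v := q.2)).2 fun p hp => ?_
    rw [hC] at hp
    exact hw.inner_graph hp hq
  have hcl := LinearPMap.adjoint_isClosed (𝕜 := ℂ) hdom
  refine ⟨LinearPMap.eq_of_eq_graph (le_antisymm ?_ ?_), hle⟩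
  · rintro ⟨u, v⟩ huv
    rw [mem_adjoint_graph_iff hdom, hC] at huv
    rw [← (hcl.isClosable.leIsClosable hle).graph_closure_eq_closure_graph, hA]
    have hmono : Monotone (levelsBelow w) := fun s t hst => Submodule.span_mono
      (Set.image_mono fun i hi => lt_of_lt_of_le (Set.mem_ofPred_eq.mp hi) hst)
    have htop : ⊤ ≤ (⨆ s, levelsBelow w s).topologicalClosure := by
      have h1 : Submodule.span ℂ (Set.range w) ≤ ⨆ s, levelsBelow w s := by
        rw [Submodule.span_le]
        rintro _ ⟨i, rfl⟩
        exact Submodule.mem_iSup_of_mem (i.length + 1)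
          (Submodule.subset_span ⟨i, Nat.lt_succ_self _, rfl⟩)
      intro x _
      exact Submodule.topologicalClosure_mono h1 (hd x)
    have hu := (Submodule.starProjection_tendsto_self _ hmono u htop).comp
      (Filter.tendsto_add_atTop_nat 1)
    have hv := Submodule.starProjection_tendsto_self _ hmono v htop
    -- A pair in the graph of the adjoint is the limit of its truncations. The cutoff for `u` is one
    -- level higher than that for `v`, since creation maps the levels below `n` into those below `n
    -- + 1`; the truncated pair then lies in the annihilation graph.
    refine mem_closure_of_tendsto (hu.prodMk_nhds hv) (Filter.Eventually.of_forall fun n => ?_)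
    change ((levelsBelow w (n + 1)).starProjection u, (levelsBelow w n).starProjection v) ∈
      annihilationGraph Q w j
    obtain ⟨z, hz, h1⟩ := exists_mem_annihilationGraph Q j (S := {i | i.length < n + 1})
      (K := levelsBelow w n) (fun i hi => annihilationSum_mem j fun i' hi' =>
        Submodule.subset_span ⟨i', by rw [Set.mem_ofPred_eq] at hi ⊢; omega, rfl⟩)
      ((levelsBelow w (n + 1)).starProjection_apply_mem u)
    suffices h : (levelsBelow w n).starProjection v = z by rwa [h]
    refine Submodule.eq_starProjection_of_mem_of_inner_eq_zero hz fun x hx => ?_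
    obtain ⟨y, hy, h2⟩ := exists_mem_creationGraph j (S := {i | i.length < n})
      (K := levelsBelow w (n + 1)) (fun i hi => Submodule.subset_span ⟨j :: i, by
        rw [Set.mem_ofPred_eq] at hi ⊢; simpa using hi, rfl⟩) hx
    have h3 : ⟪y, (levelsBelow w (n + 1)).starProjection u⟫ = ⟪x, z⟫ := hw.inner_graph h2 h1
    have h4 : ⟪y, u⟫ = ⟪x, v⟫ := huv _ h2
    have h5 : ⟪u - (levelsBelow w (n + 1)).starProjection u, y⟫ = 0 :=
      Submodule.starProjection_inner_eq_zero u y hy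
    have h6 : ⟪y, u - (levelsBelow w (n + 1)).starProjection u⟫ = 0 := by
      rw [← inner_conj_symm, h5, map_zero]
    rw [inner_sub_right, sub_eq_zero] at h6
    change ⟪v - z, x⟫ = 0
    rw [← inner_conj_symm, inner_sub_right, ← h3, ← h4, h6, sub_self, map_zero]
  · rw [← (hcl.isClosable.leIsClosable hle).graph_closure_eq_closure_graph]
    exact Submodule.topologicalClosure_minimal _ (LinearPMap.le_graph_of_le hle) hcl

end FockOperators

/-! ### Essential self-adjointness on the algebraic Fock space -/

section Carleman

/-- If `a n > 0`, the partial sums stay above `a n`, so `a k + a (k + 1)` dominates a multiple of `1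
/ (k + 1)` for `k ≥ n`. This contradicts summability, and replacing the root by `k + 1` loses
nothing essential. -/
lemma eq_zero_of_sum_le_sqrt_mul {a : ℕ → ℝ} (ha : ∀ n, 0 ≤ a n) (hs : Summable a) {c : ℝ}
    (hc : 0 < c) (h : ∀ n : ℕ, c * ∑ s ∈ Finset.range (n + 1), a s ≤
      Real.sqrt (n + 1) * (a n + a (n + 1))) (n : ℕ) : a n = 0 := by
  by_contra hn
  have hpos : 0 < c * a n := mul_pos hc (lt_of_le_of_ne (ha n) (Ne.symm hn))
  have h1 : ∀ k : ℕ, c * a n * (1 / ((k + (n + 1) : ℕ) : ℝ)) ≤ a (k + n) + a (k + n + 1) := by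
    intro k
    have h2 : c * a n ≤ c * ∑ s ∈ Finset.range (k + n + 1), a s :=
      mul_le_mul_of_nonneg_left (Finset.single_le_sum (f := a) (fun s _ => ha s)
        (by simp)) hc.le
    have h3 : Real.sqrt ((k + n : ℕ) + 1) ≤ (k + n : ℕ) + 1 := by
      rw [Real.sqrt_le_left (by positivity)]
      nlinarith [Nat.cast_nonneg (α := ℝ) (k + n)]
    rw [mul_one_div, div_le_iff₀ (by positivity)]
    refine (h2.trans (h (k + n))).trans ?_
    rw [mul_comm]
    refine mul_le_mul_of_nonneg_left (h3.trans (le_of_eq ?_)) (add_nonneg (ha _) (ha _))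
    push_cast
    ring
  have h4 : Summable fun k : ℕ => c * a n * (1 / ((k + (n + 1) : ℕ) : ℝ)) :=
    Summable.of_nonneg_of_le (fun k => by positivity) h1
      (((summable_nat_add_iff n).2 hs).add ((summable_nat_add_iff (n + 1)).2 hs))
  rw [summable_mul_left_iff hpos.ne',
    summable_nat_add_iff (f := fun k : ℕ => 1 / (k : ℝ)) (n + 1)] at h4
  exact Real.not_summable_one_div_natCast h4

variable {N : ℕ} {H : Type*} [NormedAddCommGroup H] [InnerProductSpace ℂ H]
  {Q : Matrix (Fin N) (Fin N) ℝ} {w : List (Fin N) → H}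

lemma IsWickFamily.orthogonalFamily (hw : IsWickFamily Q w) :
    OrthogonalFamily ℂ (fun s => level w s) fun s => (level w s).subtypeₗᵢ :=
  OrthogonalFamily.of_pairwise fun _ _ h => hw.isOrtho_level h

lemma inner_starProjection_of_mem {K : Submodule ℂ H} [K.HasOrthogonalProjection] {x : H}
    (hx : x ∈ K) (y : H) : ⟪x, K.starProjection y⟫ = ⟪x, y⟫ := by
  have h1 : ⟪y - K.starProjection y, x⟫ = 0 := Submodule.starProjection_inner_eq_zero y x hx
  have h2 : ⟪x, y - K.starProjection y⟫ = 0 := by rw [← inner_conj_symm, h1, map_zero]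
  rw [inner_sub_right, sub_eq_zero] at h2
  exact h2.symm

lemma IsWickFamily.summable_norm_sq_starProjection (hw : IsWickFamily Q w) (v : H) :
    Summable fun s => ‖(level w s).starProjection v‖ ^ 2 := by
  refine summable_of_sum_range_le (c := ‖v‖ ^ 2) (fun s => sq_nonneg _) fun n => ?_
  have h1 : ‖∑ s ∈ Finset.range n, (level w s).starProjection v‖ ^ 2 =
      ∑ s ∈ Finset.range n, ‖(level w s).starProjection v‖ ^ 2 := hw.orthogonalFamily.norm_sum
    (fun s => ⟨(level w s).starProjection v, (level w s).starProjection_apply_mem v⟩)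
    (Finset.range n)
  set t := ∑ s ∈ Finset.range n, (level w s).starProjection v with ht
  have h2 : ‖t‖ ^ 2 ≤ ‖t‖ * ‖v‖ := by
    have h3 : (⟪t, v⟫).re = ‖t‖ ^ 2 := by
      rw [h1, ht, sum_inner, Complex.re_sum]
      refine Finset.sum_congr rfl fun s _ => ?_
      rw [← inner_starProjection_of_mem ((level w s).starProjection_apply_mem v), re_inner_self]
    rw [← h3]
    exact (Complex.re_le_norm _).trans (norm_inner_le_norm _ _)
  rw [← h1]
  rcases eq_or_lt_of_le (norm_nonneg t) with h0 | h0
  · rw [← h0]; simp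
  · have h4 : ‖t‖ ≤ ‖v‖ := le_of_mul_le_mul_left (by rwa [← sq]) h0
    exact pow_le_pow_left₀ h0.le h4 2

/-- Carleman's criterion: the ranges of `c_j + a_j + z`, `z` not real, are dense. -/
lemma IsWickFamily.eq_zero_of_orthogonal (hw : IsWickFamily Q w)
    (hQ : ∀ i j, Q i j ∈ Set.Icc (-1 : ℝ) 1)
    (hd : Dense (Submodule.span ℂ (Set.range w) : Set H)) (j : Fin N) {z : ℂ} (hz : z.im ≠ 0)
    {x : H} (hx : ∀ i, ⟪w (j :: i) + annihilationSum Q w j i + z • w i, x⟫ = 0) : x = 0 := by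
  let X : Submodule ℂ (H × H) :=
    (ℂ ∙ x)ᗮ.comap (LinearMap.snd ℂ H H + z • LinearMap.fst ℂ H H)
  have hX : ∀ {u v y : H}, (u, v) ∈ creationGraph w j → (u, y) ∈ annihilationGraph Q w j →
      ⟪v, x⟫ + ⟪y, x⟫ + conj z * ⟪u, x⟫ = 0 := by
    intro u v y hv hy
    have h1 : (u, v + y) ∈ X := hw.add_mem_of_mem_graph (fun i =>
      Submodule.mem_orthogonal_singleton_iff_inner_left.2 (hx i)) hv hy
    have h2 : ⟪v + y + z • u, x⟫ = 0 := Submodule.mem_orthogonal_singleton_iff_inner_left.1 h1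
    rwa [inner_add_left, inner_add_left, inner_smul_left] at h2
  set p : ℕ → H := fun s => (level w s).starProjection x with hp
  have hpm : ∀ s, p s ∈ level w s := fun s => (level w s).starProjection_apply_mem x
  have hpx : ∀ {s u}, u ∈ level w s → ⟪u, x⟫ = ⟪u, p s⟫ := fun hu =>
    (inner_starProjection_of_mem hu x).symm
  choose y hym hy using fun s => exists_mem_level_creation w j (hpm s)
  -- Here `p s` is the component of `x` on level `s`. Orthogonality of `x` to `(c_j + a_j + z) p s`
  -- yields an identity whose imaginary parts telescope over `s`, because the annihilation term is
  -- conjugate to the creation term one level lower.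
  have him : ∀ n, (⟪y n, p (n + 1)⟫).im =
      z.im * ∑ s ∈ Finset.range (n + 1), ‖p s‖ ^ 2 := by
    intro n
    have h3 : ∀ s, (conj z * ⟪p s, p s⟫).im = -(z.im * ‖p s‖ ^ 2) := by
      intro s
      rw [Complex.mul_im, im_inner_self, re_inner_self, Complex.conj_im]
      ring
    induction n with
    | zero =>
      have h1 := hX (hy 0) (mem_annihilationGraph_of_mem_level_zero Q w j (hpm 0))
      rw [inner_zero_left, add_zero, hpx (hym 0), hpx (hpm 0)] at h1
      have h2 := congrArg Complex.im h1
      rw [Complex.add_im, h3, Complex.zero_im] at h2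
      rw [Finset.sum_range_one]
      linarith
    | succ n ih =>
      obtain ⟨t, htm, ht⟩ := exists_mem_level_annihilation Q w j (hpm (n + 1))
      have h1 := hX (hy (n + 1)) ht
      have h4 : ⟪y n, p (n + 1)⟫ = ⟪p n, t⟫ := hw.inner_graph (hy n) ht
      rw [hpx (hym (n + 1)), hpx (hpm (n + 1)), hpx htm, ← inner_conj_symm t, ← h4] at h1
      have h2 := congrArg Complex.im h1
      rw [Complex.add_im, Complex.add_im, h3, Complex.conj_im, Complex.zero_im] at h2
      rw [Finset.sum_range_succ, mul_add, ← ih]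
      linarith
  have hzero := eq_zero_of_sum_le_sqrt_mul (a := fun s => ‖p s‖ ^ 2) (fun s => sq_nonneg _)
    (hw.summable_norm_sq_starProjection x) (abs_pos.2 hz) fun n => by
      rw [← abs_of_nonneg (a := ∑ s ∈ Finset.range (n + 1), ‖p s‖ ^ 2) (by positivity), ← abs_mul,
        ← him]
      refine (Complex.abs_im_le_norm _).trans ((norm_inner_le_norm _ _).trans ?_)
      have h1 : ‖y n‖ ≤ Real.sqrt (n + 1) * ‖p n‖ := by
        rw [← Real.sqrt_sq (norm_nonneg (p n)), ← Real.sqrt_mul (by positivity)]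
        exact Real.le_sqrt_of_sq_le (hw.norm_sq_creation_le hQ (hpm n) (hy n))
      refine (mul_le_mul_of_nonneg_right h1 (norm_nonneg _)).trans ?_
      rw [mul_assoc]
      refine mul_le_mul_of_nonneg_left ?_ (Real.sqrt_nonneg _)
      nlinarith [sq_nonneg (‖p n‖ - ‖p (n + 1)‖), sq_nonneg ‖p n‖, sq_nonneg ‖p (n + 1)‖]
  have h0 : ∀ i, ⟪x, w i⟫ = 0 := by
    intro i
    have h1 : p i.length = 0 := by
      have := hzero i.length
      simpa using this
    rw [← inner_conj_symm, hpx (mem_level w i), h1, inner_zero_right, map_zero]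
  exact hd.eq_zero_of_inner_left ℂ fun v hv => by
    have h1 : Submodule.span ℂ (Set.range w) ≤ (ℂ ∙ x)ᗮ := by
      rw [Submodule.span_le]
      rintro _ ⟨i, rfl⟩
      exact Submodule.mem_orthogonal_singleton_iff_inner_right.2 (h0 i)
    exact Submodule.mem_orthogonal_singleton_iff_inner_right.1 (h1 hv)

end Carleman

/-! ### The mixed Fock space in the ultraproduct -/

section MixedFock

variable {N : ℕ} {e : SpinIndexInf N → SpinIndexInf N → ℝ} {Q : Matrix (Fin N) (Fin N) ℝ}
  {U : Ultrafilter ℕ}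

lemma fock_eq_topologicalClosure_span (U : Ultrafilter ℕ)
    (e : SpinIndexInf N → SpinIndexInf N → ℝ) :
    fock U e = (Submodule.span ℂ (Set.range (wick U e))).topologicalClosure := by
  rw [fock]
  congr 1
  refine le_antisymm (iSup_le fun s => Submodule.span_mono (Set.image_subset_range _ _)) ?_
  rw [Submodule.span_le]
  rintro _ ⟨i, rfl⟩
  exact Submodule.mem_iSup_of_mem i.length (mem_level (wick U e) i)

lemma wick_mem_fock (i : List (Fin N)) : wick U e i ∈ fock U e := (wickFock U e i).2

lemma coe_annihilationSum_wickFock (j : Fin N) (i : List (Fin N)) :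
    ((annihilationSum Q (wickFock U e) j i : FockSpace U e) : L2A U e) =
      annihilationSum Q (wick U e) j i :=
  map_annihilationSum Q (fock U e).subtype (wickFock U e) j i

lemma dense_finiteParticle : Dense (finiteParticle U e : Set (FockSpace U e)) := by
  intro x
  rw [closure_subtype]
  have h1 : ((↑) '' (finiteParticle U e : Set (FockSpace U e)) : Set (L2A U e)) =
      Submodule.span ℂ (Set.range (wick U e)) := by
    have h2 : (finiteParticle U e).map (fock U e).subtype =
        Submodule.span ℂ (Set.range (wick U e)) := by
      rw [finiteParticle, Submodule.map_span, ← Set.range_comp]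
      rfl
    rw [← h2]
    rfl
  rw [h1]
  exact (fock_eq_topologicalClosure_span U e).le x.2

lemma IsWickFamily.wickFock (hw : IsWickFamily Q (wick U e)) :
    IsWickFamily Q (wickFock U e) := by
  refine ⟨hw.inner_nil, hw.inner_eq_zero, fun j i i' => ?_⟩
  change ⟪wick U e (j :: i), wick U e i'⟫ =
    ⟪wick U e i, ((annihilationSum Q (MixedQGaussian.wickFock U e) j i' : FockSpace U e) : L2A U e)⟫
  rw [coe_annihilationSum_wickFock]
  exact hw.inner_cons j i i'

/-- By Carleman's criterion the vectors `(x_j + z) w(i)` span a dense subspace of the Fock space,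
and the continuous operator `R` sends each of them to `w(i)`. -/
lemma resolvent_mem_fock (hw : IsWickFamily Q (wick U e))
    (hQ : ∀ i j, Q i j ∈ Set.Icc (-1 : ℝ) 1) {j : Fin N}
    (hx : ∀ i, (wick U e i, wick U e (j :: i) + annihilationSum Q (wick U e) j i) ∈
      (generator U e j).graph) {z : ℂ} (hz : z.im ≠ 0) {R : L2A U e →L[ℂ] L2A U e}
    (hR : IsResolvent (generator U e j) z R) : ∀ x ∈ fock U e, R x ∈ fock U e := by
  let S : Submodule ℂ (FockSpace U e) := Submodule.span ℂ (Set.range fun i =>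
    wickFock U e (j :: i) + annihilationSum Q (wickFock U e) j i + z • wickFock U e i)
  have hS : S.topologicalClosure = ⊤ := by
    rw [Submodule.topologicalClosure_eq_top_iff, Submodule.eq_bot_iff]
    intro x hx
    refine hw.wickFock.eq_zero_of_orthogonal hQ dense_finiteParticle j hz fun i => ?_
    exact (Submodule.mem_orthogonal S x).1 hx _ (Submodule.subset_span ⟨i, rfl⟩)
  let K : Submodule ℂ (FockSpace U e) :=
    (fock U e).comap (R.comp (fock U e).subtypeL : FockSpace U e →ₗ[ℂ] L2A U e)
  have hK : S.topologicalClosure ≤ K := by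
    refine Submodule.topologicalClosure_minimal _ ?_ ?_
    · rw [Submodule.span_le]
      rintro _ ⟨i, rfl⟩
      change R (wick U e (j :: i) +
        ((annihilationSum Q (wickFock U e) j i : FockSpace U e) : L2A U e) +
        z • wick U e i) ∈ fock U e
      rw [coe_annihilationSum_wickFock, hR.apply_eq _ _ (hx i)]
      exact wick_mem_fock i
    · exact (Submodule.isClosed_topologicalClosure _).preimage
        (R.comp (fock U e).subtypeL).continuous
  intro x hx
  have h1 : (⟨x, hx⟩ : FockSpace U e) ∈ S.topologicalClosure := hS ▸ Submodule.mem_top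
  exact hK h1

lemma mem_mixedGaussian_iff {T : L2A U e →L[ℂ] L2A U e} :
    T ∈ mixedGaussian U e ↔ T ∈ StarSubalgebra.centralizer ℂ (StarSubalgebra.centralizer ℂ
      {P | ∃ (j : Fin N) (t : ℝ), IsSpectralProjection (generator U e j) t P} :
        Set (L2A U e →L[ℂ] L2A U e)) := Iff.rfl

lemma mixedGaussian_subset_commute {T A : L2A U e →L[ℂ] L2A U e} (hT : T ∈ mixedGaussian U e)
    (hA : ∀ (j : Fin N) (t : ℝ) (P : L2A U e →L[ℂ] L2A U e),
      IsSpectralProjection (generator U e j) t P → Commute A P) : Commute A T := by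
  rw [mem_mixedGaussian_iff, StarSubalgebra.mem_centralizer_iff] at hT
  refine (hT A ?_).1
  rw [SetLike.mem_coe, StarSubalgebra.mem_centralizer_iff]
  rintro P ⟨j, t, hP⟩
  have h := (hA j t P hP).symm.eq
  exact ⟨h, by rwa [hP.isStarProjection.isSelfAdjoint.star_eq]⟩

lemma mem_generatedVN {H : Type*} [NormedAddCommGroup H] [InnerProductSpace ℂ H] [CompleteSpace H]
    {S : Set (H →L[ℂ] H)} {P : H →L[ℂ] H} (hP : P ∈ S) (hsa : IsSelfAdjoint P) :
    P ∈ generatedVN S := by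
  change P ∈ StarSubalgebra.centralizer ℂ (StarSubalgebra.centralizer ℂ S : Set (H →L[ℂ] H))
  rw [StarSubalgebra.mem_centralizer_iff]
  intro A hA
  rw [SetLike.mem_coe, StarSubalgebra.mem_centralizer_iff] at hA
  have h1 := (hA P hP).1
  have h2 := congrArg star h1
  rw [star_mul, star_mul, hsa.star_eq] at h2
  exact ⟨h1.symm, h2⟩

lemma spectralProjection_mem_mixedGaussian {j : Fin N} {t : ℝ} {P : L2A U e →L[ℂ] L2A U e}
    (hP : IsSpectralProjection (generator U e j) t P) : P ∈ mixedGaussian U e :=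
  mem_generatedVN ⟨j, t, hP⟩ hP.isStarProjection.isSelfAdjoint

lemma apply_vacuum_mem_L2Gaussian {T : L2A U e →L[ℂ] L2A U e} (hT : T ∈ mixedGaussian U e) :
    T (vacuum U e) ∈ L2Gaussian U e :=
  Submodule.le_topologicalClosure _ (Submodule.subset_span ⟨T, hT, rfl⟩)

lemma apply_mem_L2Gaussian {T : L2A U e →L[ℂ] L2A U e} (hT : T ∈ mixedGaussian U e)
    {x : L2A U e} (hx : x ∈ L2Gaussian U e) : T x ∈ L2Gaussian U e := by
  have h : L2Gaussian U e ≤ (L2Gaussian U e).comap (T : L2A U e →ₗ[ℂ] L2A U e) := by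
    refine Submodule.topologicalClosure_minimal _ ?_ ?_
    · rw [Submodule.span_le]
      rintro _ ⟨T', hT', rfl⟩
      exact apply_vacuum_mem_L2Gaussian (mul_mem hT hT')
    · exact (Submodule.isClosed_topologicalClosure _).preimage T.continuous
  exact h hx

instance : CompleteSpace (L2Gaussian U e) :=
  inferInstanceAs (CompleteSpace (Submodule.topologicalClosure _))

lemma commute_starProjection_of_isStarProjection {H : Type*} [NormedAddCommGroup H]
    [InnerProductSpace ℂ H] [CompleteSpace H] {P : H →L[ℂ] H} (hP : IsStarProjection P)
    {K : Submodule ℂ H} [K.HasOrthogonalProjection] (h : ∀ x ∈ K, P x ∈ K) :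
    Commute K.starProjection P := by
  ext y
  rw [mul_apply_eq_comp, mul_apply_eq_comp]
  refine Submodule.eq_starProjection_of_mem_of_inner_eq_zero
    (h _ (K.starProjection_apply_mem y)) fun x hx => ?_
  rw [← map_sub]
  refine (inner_apply_of_isSelfAdjoint hP.isSelfAdjoint _ _).trans ?_
  exact Submodule.starProjection_inner_eq_zero y _ (h x hx)

theorem L2Gaussian_eq_fock (hw : IsWickFamily Q (wick U e))
    (hQ : ∀ i j, Q i j ∈ Set.Icc (-1 : ℝ) 1)
    (hsa : ∀ j, IsSelfAdjoint (generator U e j))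
    (hx : ∀ j i, (wick U e i, wick U e (j :: i) + annihilationSum Q (wick U e) j i) ∈
      (generator U e j).graph) : L2Gaussian U e = fock U e := by
  apply le_antisymm
  · refine Submodule.topologicalClosure_minimal _ ?_ (Submodule.isClosed_topologicalClosure _)
    rw [Submodule.span_le]
    rintro _ ⟨T, hT, rfl⟩
    -- Invariance under the resolvents at `i` and `-i` makes the Fock space reduce each `x_j`. Its
    -- projection then commutes with all spectral projections and so with `Γ_Q`; since it fixes the
    -- vacuum, it fixes `T` applied to the vacuum.
    have hc : Commute (fock U e).starProjection T := by
      refine mixedGaussian_subset_commute hT fun j t P hP => hP.commute (hsa j) fun u v huv => ?_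
      obtain ⟨R, hR⟩ := exists_isResolvent (hsa j) (z := Complex.I) (by simp)
      obtain ⟨R', hR'⟩ := exists_isResolvent (hsa j) (z := -Complex.I) (by simp)
      exact starProjection_mem_graph_of_invariant (hsa j) hR hR'
        (resolvent_mem_fock hw hQ (hx j) (by simp) hR)
        (resolvent_mem_fock hw hQ (hx j) (by simp) hR') huv
    have h1 : (fock U e).starProjection (vacuum U e) = vacuum U e :=
      Submodule.starProjection_eq_self_iff.2 (vacuum_eq_wick_nil ▸ wick_mem_fock [])
    have h2 := DFunLike.congr_fun hc.eq (vacuum U e)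
    rw [mul_apply_eq_comp, mul_apply_eq_comp, h1] at h2
    exact Submodule.starProjection_eq_self_iff.1 h2
  · rw [fock_eq_topologicalClosure_span]
    refine Submodule.topologicalClosure_minimal _ ?_ (Submodule.isClosed_topologicalClosure _)
    rw [Submodule.span_le]
    rintro _ ⟨i, rfl⟩
    rw [SetLike.mem_coe]
    induction h : i.length using Nat.strong_induction_on generalizing i with
    | _ s ih =>
      subst h
      rcases i with _ | ⟨j, i⟩
      · rw [← vacuum_eq_wick_nil]
        exact apply_vacuum_mem_L2Gaussian (one_mem (mixedGaussian U e))
      · have hmem : ∀ i' : List (Fin N), i'.length < (j :: i).length →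
            wick U e i' ∈ L2Gaussian U e := fun i' h' => ih _ h' i' rfl
        -- `Γ_Q` leaves `L₂(Γ_Q)` invariant, so the projection onto it commutes with the spectral
        -- projections and hence with `x_j`. Thus `x_j w(i)` stays in `L₂(Γ_Q)`, and subtracting the
        -- shorter words leaves `w(j, i)`.
        have h1 := mem_graph_of_commute_spectralProjections (hsa j)
          (A := (L2Gaussian U e).starProjection) (fun t P hP =>
            commute_starProjection_of_isStarProjection hP.isStarProjection fun x hx =>
              apply_mem_L2Gaussian (spectralProjection_mem_mixedGaussian hP) hx) _ _ (hx j i)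
        rw [Submodule.starProjection_eq_self_iff.2 (hmem i (by simp))] at h1
        have h2 := Submodule.starProjection_eq_self_iff.1 (snd_eq_of_mem_graph h1 (hx j i))
        have h3 : annihilationSum Q (wick U e) j i ∈ L2Gaussian U e :=
          annihilationSum_mem j fun i' h' => hmem i' (by simp; omega)
        exact ((L2Gaussian U e).add_mem_iff_left h3).1 h2

lemma add_wickFock_mem_generator_graph (hw : IsWickFamily Q (wick U e)) {j : Fin N}
    (hx : ∀ i, (wick U e i, wick U e (j :: i) + annihilationSum Q (wick U e) j i) ∈
      (generator U e j).graph) {u v z : FockSpace U e}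
    (hv : (u, v) ∈ creationGraph (wickFock U e) j)
    (hz : (u, z) ∈ annihilationGraph Q (wickFock U e) j) :
    ((u : L2A U e), ((v + z : FockSpace U e) : L2A U e)) ∈ (generator U e j).graph := by
  let X : Submodule ℂ (FockSpace U e × FockSpace U e) :=
    (generator U e j).graph.comap ((fock U e).subtype.prodMap (fock U e).subtype)
  have hX : ∀ i, (wickFock U e i,
      wickFock U e (j :: i) + annihilationSum Q (wickFock U e) j i) ∈ X := by
    intro i
    change (wick U e i, wick U e (j :: i) +
      ((annihilationSum Q (wickFock U e) j i : FockSpace U e) : L2A U e)) ∈ (generator U e j).graph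
    rw [coe_annihilationSum_wickFock]
    exact hx i
  exact hw.wickFock.add_mem_of_mem_graph hX hv hz

/-- `c_j = ∑ P_{s+1} x_j P_s` and `a_j = ∑ P_{s-1} x_j P_s`. -/
lemma exists_creation_annihilation_starProjection (hw : IsWickFamily Q (wick U e))
    {j : Fin N}
    (hx : ∀ i, (wick U e i, wick U e (j :: i) + annihilationSum Q (wick U e) j i) ∈
      (generator U e j).graph) {s : ℕ} {u : FockSpace U e}
    (hu : (u : L2A U e) ∈ wickLevel U e s) :
    ∃ (y : L2A U e) (v z : FockSpace U e), ((u : L2A U e), y) ∈ (generator U e j).graph ∧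
      (u, v) ∈ creationGraph (wickFock U e) j ∧
      (v : L2A U e) = (wickLevel U e (s + 1)).starProjection y ∧
      (u, z) ∈ annihilationGraph Q (wickFock U e) j ∧
      (z : L2A U e) = if s = 0 then 0 else (wickLevel U e (s - 1)).starProjection y := by
  have hmap : ∀ s, (level (wickFock U e) s).map (fock U e).subtype = level (wick U e) s := by
    intro s
    rw [level, Submodule.map_span, ← Set.image_comp]
    rfl
  have hu' : u ∈ level (wickFock U e) s := by
    change (u : L2A U e) ∈ level (wick U e) s at hu
    rw [← hmap] at hu
    obtain ⟨u', h1, h2⟩ := hu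
    rwa [← Subtype.ext h2]
  have hlevel : ∀ {s} {x : FockSpace U e}, x ∈ level (wickFock U e) s →
      (x : L2A U e) ∈ level (wick U e) s := by
    intro s x hx
    rw [← hmap]
    exact ⟨x, hx, rfl⟩
  obtain ⟨v, hv, hc⟩ := exists_mem_level_creation (wickFock U e) j hu'
  -- On level `0` annihilation vanishes and `x_j u` is pure creation. The case is separate because
  -- `0 - 1 = 0` for natural numbers.
  rcases s with _ | s
  · have ha := mem_annihilationGraph_of_mem_level_zero Q (wickFock U e) j hu'
    have hgr := add_wickFock_mem_generator_graph hw hx hc ha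
    rw [add_zero] at hgr
    exact ⟨v, v, 0, hgr, hc, (Submodule.starProjection_eq_self_iff.2 (hlevel hv)).symm, ha, rfl⟩
  · obtain ⟨z, hz, ha⟩ := exists_mem_level_annihilation Q (wickFock U e) j hu'
    have hgr := add_wickFock_mem_generator_graph hw hx hc ha
    refine ⟨v + z, v, z, hgr, hc, ?_, ha, ?_⟩
    · exact (Submodule.eq_starProjection_of_mem_orthogonal' (hlevel hv)
        (hw.isOrtho_level (by omega) (hlevel hz)) rfl).symm
    · rw [if_neg (Nat.succ_ne_zero s)]
      exact (Submodule.eq_starProjection_of_mem_orthogonal' (K := level (wick U e) s) (hlevel hz)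
        (hw.isOrtho_level (by omega) (hlevel hv)) (add_comm _ _)).symm

end MixedFock

end MixedQGaussian

end

/-! ### The main theorem. -/

open MixedQGaussian
theorem mainTheorem5 {N : ℕ} (Q : Matrix (Fin N) (Fin N) ℝ) (hsymm : Q.IsSymm)
    (hQ : ∀ i j, Q i j ∈ Set.Icc (-1 : ℝ) 1)
    {Ω : Type*} [MeasurableSpace Ω] (P : MeasureTheory.Measure Ω)
    [MeasureTheory.IsProbabilityMeasure P]
    (ε : Ω → SpinIndexInf N → SpinIndexInf N → ℝ) (hε : IsRandomSigns P Q ε) :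
    ∀ᵐ ω ∂P, ∀ U : Ultrafilter ℕ, (U : Filter ℕ) ≤ Filter.cofinite →
      -- the special Wick words are well defined vectors of `L₂(𝓐_U, τ_U)`
      (∀ i, Represents U (wickSeq (ε ω) i) (wick U (ε ω) i)) ∧
      -- the generators are well defined self-adjoint operators
      (∀ j, (generator U (ε ω) j).graph = generatorGraph U (ε ω) j ∧
        IsSelfAdjoint (generator U (ε ω) j)) ∧
      -- `L₂(Γ_Q)` is the closed span of the special Wick words
      L2Gaussian U (ε ω) =
        (Submodule.span ℂ (Set.range (wick U (ε ω)))).topologicalClosure ∧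
      -- the inner product `τ_U(w(i')^* w(i))`
      (∀ i i' : List (Fin N), inner ℂ (wick U (ε ω) i') (wick U (ε ω) i) =
        if (i : Multiset (Fin N)) = (i' : Multiset (Fin N)) then
          ((bipartiteSum Q i i' : ℝ) : ℂ) else 0) ∧
      -- `L₂(Γ_Q)` is the mixed Fock space, the orthogonal sum of the `H_Q^s`
      L2Gaussian U (ε ω) = fock U (ε ω) ∧
      OrthogonalFamily ℂ (fun s => wickLevel U (ε ω) s)
        (fun s => (wickLevel U (ε ω) s).subtypeₗᵢ) ∧
      -- the action of the generators on the special Wick words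
      (∀ j i, (wick U (ε ω) i,
        wick U (ε ω) (j :: i) + annihilationSum Q (wick U (ε ω)) j i) ∈
          (generator U (ε ω) j).graph) ∧
      -- creation operators `c_j` and annihilation operators `a_j`
      ∃ c a : Fin N → (FockSpace U (ε ω) →ₗ.[ℂ] FockSpace U (ε ω)),
        (∀ j, (c j).domain = finiteParticle U (ε ω) ∧
          ∀ i, (wickFock U (ε ω) i, wickFock U (ε ω) (j :: i)) ∈ (c j).graph) ∧
        (∀ j, (a j).domain = finiteParticle U (ε ω) ∧
          ∀ i, (wickFock U (ε ω) i, annihilationSum Q (wickFock U (ε ω)) j i) ∈ (a j).graph) ∧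
        -- `x_j = c_j + a_j`
        (∀ j u v, (u, v) ∈ (c j + a j).graph →
          ((u : L2A U (ε ω)), (v : L2A U (ε ω))) ∈ (generator U (ε ω) j).graph) ∧
        -- `c_j = ∑_{s ≥ 0} P_{s+1} x_j P_s` and `a_j = ∑_{s ≥ 1} P_{s-1} x_j P_s`
        (∀ j s, ∀ u : FockSpace U (ε ω), (u : L2A U (ε ω)) ∈ wickLevel U (ε ω) s →
          ∃ (y : L2A U (ε ω)) (v z : FockSpace U (ε ω)),
            ((u : L2A U (ε ω)), y) ∈ (generator U (ε ω) j).graph ∧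
            (u, v) ∈ (c j).graph ∧
            (v : L2A U (ε ω)) = (wickLevel U (ε ω) (s + 1)).starProjection y ∧
            (u, z) ∈ (a j).graph ∧
            (z : L2A U (ε ω)) =
              if s = 0 then 0 else (wickLevel U (ε ω) (s - 1)).starProjection y) ∧
        -- `c_j^* = a_j`: the adjoint of `c_j` is the closure of `a_j`
        (∀ j, LinearPMap.adjoint (𝕜 := ℂ) (c j) = (a j).closure ∧
          a j ≤ LinearPMap.adjoint (𝕜 := ℂ) (c j)) ∧
        -- `c_k^* c_j - q_{jk} c_j c_k^* = δ_{jk}`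
        (∀ j k, ∀ u ∈ finiteParticle U (ε ω), ∃ v y z t : FockSpace U (ε ω),
          (u, v) ∈ (c j).graph ∧ (v, y) ∈ (LinearPMap.adjoint (𝕜 := ℂ) (c k)).graph ∧
          (u, z) ∈ (LinearPMap.adjoint (𝕜 := ℂ) (c k)).graph ∧ (z, t) ∈ (c j).graph ∧
          y - (Q j k : ℂ) • t = if j = k then u else 0) := by
  -- The law of large numbers is the only almost sure input; it precedes the choice of `U`, so one
  -- set of full probability serves all ultrafilters.
  filter_upwards [hε.ae_signAverage hsymm hQ] with ω hQe
  intro U hU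
  have he : ∀ a b, ε ω a b = -1 ∨ ε ω a b = 1 := fun a b => hε.values a b ω
  have hs : ∀ a b, ε ω a b = ε ω b a := fun a b => hε.symm a b ω
  have hw := isWickFamily_wick he hs hQe hU
  have hx := wick_mem_generator_graph he hs hQe hU
  have hsa := fun j => generator_isSelfAdjoint (exists_represents_genSeq he hs hQe hU j)
  have hΓ := L2Gaussian_eq_fock hw hQ (fun j => (hsa j).2) hx
  have hF := hw.wickFock
  have hC := fun j => (creationGraph (wickFock U (ε ω)) j).toLinearPMap_graph_eq
    (hF.creationGraph_fst_eq_zero j)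
  have hA := fun j => (annihilationGraph Q (wickFock U (ε ω)) j).toLinearPMap_graph_eq
    (hF.annihilationGraph_fst_eq_zero j)
  have hadj := fun j => hF.adjoint_creation dense_finiteParticle j
  refine ⟨represents_wick he hs hQe hU, hsa, hΓ.trans (fock_eq_topologicalClosure_span U (ε ω)),
    fun i i' => hw.inner_eq i i', hΓ, hw.orthogonalFamily, hx,
    fun j => (creationGraph (wickFock U (ε ω)) j).toLinearPMap,
    fun j => (annihilationGraph Q (wickFock U (ε ω)) j).toLinearPMap,
    fun j => ⟨map_fst_creationGraph _ j, fun i => ?_⟩,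
    fun j => ⟨map_fst_annihilationGraph Q _ j, fun i => ?_⟩,
    fun j u v huv => ?_, fun j s u hu => ?_, hadj, fun j k u hu => ?_⟩
  · rw [hC]
    exact mem_creationGraph _ j i
  · rw [hA]
    exact mem_annihilationGraph Q _ j i
  · obtain ⟨y, rfl, rfl⟩ := (LinearPMap.mem_graph_iff _).1 huv
    have h1 := (creationGraph (wickFock U (ε ω)) j).toLinearPMap.mem_graph ⟨y, y.2.1⟩
    have h2 := (annihilationGraph Q (wickFock U (ε ω)) j).toLinearPMap.mem_graph ⟨y, y.2.2⟩
    rw [hC] at h1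
    rw [hA] at h2
    exact add_wickFock_mem_generator_graph hw (hx j) h1 h2
  · simp only [hC, hA]
    exact exists_creation_annihilation_starProjection hw (hx j) hu
  · obtain ⟨v, y, z, t, h1, h2, h3, h4, h5⟩ := exists_commutation Q (wickFock U (ε ω)) j k hu
    -- The relation is algebraic for the annihilation operators and carries over to the adjoints
    -- because `a_k` is a restriction of `c_k^*`.
    have hle := LinearPMap.le_graph_of_le (hadj k).2
    rw [← hC] at h1 h4
    rw [← hA] at h2 h3
    exact ⟨v, y, z, t, h1, hle h2, hle h3, h4, h5⟩
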